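/- **Setting.** Let $k\ge 2$. An environment is a family $\nu=(P_i)_{1\le i\le k}$ of probability measures on $\mathbb R$ with means $r_i$; its target distribution is $p_i=e^{r_i}/\sum_j e^{r_j}$. For $\sigma>0$, $\nu$ is *$\sigma$-subgaussian* if $\mathbb E_{X\sim P_i}\,e^{s(X-r_i)}\le e^{\sigma^2s^2/2}$ for all $i$ and $s\in\mathbb R$, and has *noise bounded by $\sigma$* if $|X-r_i|\le\sigma$ for $P_i$-almost every $X$, for all $i$. A realization $\omega^\nu\in\mathbb R^{T\times k}$ has independent entries $\omega^\nu_{t,i}\sim P_i$; playing arm $a_t$ at time $t$ reveals $x_t=\omega^\nu_{t,a_t}$. The randomness $\omega^\pi$ of the policy is independent of $\omega^\nu$. **Algorithm** (Active Sampling with Exploration, horizon $T$, exploration factor $M\in\mathbb R$, $1\le M\le T/k$). For $t\le Mk$ play $a_t=(t \bmod k)+1$. For $Mk<t\le T$ sample $a_t$ from $\mathrm{softmax}(\hat r_{t-1})$, where $\hat r_{t-1,i}$ is the average of the rewards observed from arm $i$ up to time $t-1$. **Regrets.** Let $\hat\pi_t$ be the conditional distribution of $a_t$ given $(a_1,x_1,\dots,a_{t-1},x_{t-1})$,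 and $q_t$ the empirical distribution of $a_1,\dots,a_t$. For $f_t\in\{\hat\pi_t,q_t\}$ (policy level, action level) and a distance $d$, the expected regret at time $t$ is $\mathbb E[d(f_t,p)]$ and its environment version is $\mathbb E_{\omega^\nu}[d(\mathbb E_{\omega^\pi}[f_t],p)]$. The simple regret is the one at $t=T$; the cumulative regret is the sum over $1\le t\le T$. The distances are $d^{\mathrm{TV}}(q,p)=\frac12\sum_i|q_i-p_i|$, $d^{\text{r-KL}}(q,p)=D_{\mathrm{KL}}(q\|p)$ and $d^{\text{f-KL}}(q,p)=D_{\mathrm{KL}}(p\|q)$, with values in $[0,\infty]$. For f-KL, the sum defining the cumulative regret runs only over $Mk<t\le T$ at the policy level and over $k\le t\le T$ at the action level (at earlier times the forward-KL distance is infinite). For a factor $g>0$, consider, for both the plain and the environment versions, the bounds - (SP) if $Mk<T$: the simple policy-level regrets are at most $g\,T^{-1/2}$ for TV and at most $g\,T^{-1}$ for r-KL, and, if the noise of $\nu$ is bounded by $\sigma$, at most $g\,T^{-1}$ for f-KL; - (SA) the same bounds for the simple action-level regrets; - (C) the cumulative policy-level and action-level regrets are at most $g\,T^{1/2}$ for TV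 and at most $g$ for r-KL, and, if the noise of $\nu$ is bounded by $\sigma$, at most $g$ for f-KL. **Theorem.** Fix $k\ge2$, $\sigma>0$ and $\alpha>0$. Below, $\nu$ ranges over all $\sigma$-subgaussian environments with $k$ arms and $\min_i p_i\ge\alpha$. 1. There are $C,n$ such that for all $\nu$, all $T$ and all $M$ with $1\le M\le T/k$ and $M\ge 36\sigma^2\log T$, (SP) holds with $g=C(\log T)^n$. 2. For all $A\in\mathbb R$ and $m\in\mathbb N$ there are $C,n$ such that for all $\nu$, all $T$ and all $M$ with $1\le M\le T/k$ and $36\sigma^2\log T\le M\le A(\log T)^m$, (SA) and (C) hold with $g=C(\log T)^n$. 3. (No exploration.) There is $C$ such that for all $\nu$ and all $T\ge k$, with $M=1$, (SP), (SA) and (C) hold with $g=C\exp(C\sqrt{\log T})$. -/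

import Mathlib

open MeasureTheory ProbabilityTheory
open scoped ENNReal NNReal

namespace MultiArmedSampling

noncomputable section

/-! ### Environments -/

/-- An environment with `k` arms: the reward distribution of each arm. -/
abbrev Environment (k : ℕ) : Type := Fin k → ProbabilityMeasure ℝ

/-- The reward `r i`, i.e. the mean of the distribution of arm `i`. -/
def meanReward {k : ℕ} (ν : Environment k) (i : Fin k) : ℝ :=
  ∫ x, x ∂(ν i : Measure ℝ)

/-- The softmax vector of `r`. -/
def softmax {k : ℕ} (r : Fin k → ℝ) (i : Fin k) : ℝ :=
  Real.exp (r i) / ∑ j, Real.exp (r j)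

/-- The target distribution `p = softmax r` of an environment. -/
def target {k : ℕ} (ν : Environment k) : Fin k → ℝ :=
  softmax (meanReward ν)

/-- Every arm is `σ`-subgaussian: `E exp (s (X - E X)) ≤ exp (σ² s² / 2)` for all real `s`. -/
def IsSubgaussianEnv {k : ℕ} (σ : ℝ≥0) (ν : Environment k) : Prop :=
  ∀ i, HasSubgaussianMGF (fun x : ℝ => x - meanReward ν i) (σ ^ 2) (ν i : Measure ℝ)

/-- The noise of every arm is at most `σ` in absolute value. -/
def IsBoundedEnv {k : ℕ} (σ : ℝ≥0) (ν : Environment k) : Prop :=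
  ∀ i, ∀ᵐ x ∂(ν i : Measure ℝ), |x - meanReward ν i| ≤ σ

/-- A realization of an environment: the reward that each arm gives at each time-step, if it is
played then.  The element `t : Fin T` stands for the time-step `t + 1`. -/
abbrev Realization (T k : ℕ) : Type := Fin T → Fin k → ℝ

/-- The law of the realization: all entries are independent, the column `i` has law `ν i`. -/
def realizationMeasure {k : ℕ} (T : ℕ) (ν : Environment k) : Measure (Realization T k) :=
  Measure.pi fun _ : Fin T => Measure.pi fun i : Fin k => (ν i : Measure ℝ)

/-! ### Policies and their interaction with the environment -/

/-- A history of `n` rounds: the played arms and the observed rewards. -/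
abbrev History (k n : ℕ) : Type := Fin n → Fin k × ℝ

/-- A policy with horizon `T`: a probability space for its randomness and, for each time-step, a
map from this space and the history to the next arm.  At the time-step `t + 1` with `t : Fin T`
the history has `t` rounds. -/
structure Policy (T k : ℕ) where
  Ω : Type
  [mΩ : MeasurableSpace Ω]
  prob : Measure Ω
  [isProb : IsProbabilityMeasure prob]
  act : (t : Fin T) → Ω → History k t → Fin k
  measurable_act : ∀ t : Fin T, Measurable fun z : Ω × History k t => act t z.1 z.2

attribute [instance] Policy.mΩ Policy.isProb

/-- The arm played at the time-step `t + 1`, given the randomness `ω` of the policy and the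
realization `w` of the environment. -/
def Policy.action {T k : ℕ} (π : Policy T k) (ω : π.Ω) (w : Realization T k) (t : Fin T) : Fin k :=
  π.act t ω fun s : Fin t =>
    (π.action ω w ⟨s, s.2.trans t.2⟩, w ⟨s, s.2.trans t.2⟩ (π.action ω w ⟨s, s.2.trans t.2⟩))
termination_by t.val

/-- The history before the time-step `t + 1`. -/
def Policy.history {T k : ℕ} (π : Policy T k) (ω : π.Ω) (w : Realization T k) (t : Fin T) :
    History k t :=
  fun s => (π.action ω w ⟨s, s.2.trans t.2⟩,
    w ⟨s, s.2.trans t.2⟩ (π.action ω w ⟨s, s.2.trans t.2⟩))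

/-- The joint law of the randomness of the policy and of the realization. -/
def Policy.joint {T k : ℕ} (π : Policy T k) (ν : Environment k) :
    Measure (π.Ω × Realization T k) :=
  π.prob.prod (realizationMeasure T ν)

/-! ### Performance distributions -/

/-- The conditional distribution of the arm played at the time-step `t + 1` given the history
before it; its `i`-th entry is the conditional probability that the arm is `i`. -/
def Policy.policyDist {T k : ℕ} (π : Policy T k) (ν : Environment k) (t : Fin T)
    (z : π.Ω × Realization T k) (i : Fin k) : ℝ :=
  (π.joint ν)[fun z' => if π.action z'.1 z'.2 t = i then (1 : ℝ) else 0 |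
    MeasurableSpace.comap (fun z' => π.history z'.1 z'.2 t) inferInstance] z

/-- The empirical distribution of the arms played up to and including the time-step `t + 1`. -/
def Policy.actionDist {T k : ℕ} (π : Policy T k) (t : Fin T)
    (z : π.Ω × Realization T k) (i : Fin k) : ℝ :=
  ((Finset.univ.filter fun s : Fin T => s ≤ t ∧ π.action z.1 z.2 s = i).card : ℝ) / ((t : ℕ) + 1)

/-- Whether a regret is about the policy (`policyDist`) or the actions (`actionDist`). -/
inductive Level
  | policy
  | action

/-- The performance distribution at the time-step `t + 1`. -/
def Policy.perf {T k : ℕ} (π : Policy T k) (ν : Environment k) :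
    Level → Fin T → π.Ω × Realization T k → Fin k → ℝ
  | .policy => π.policyDist ν
  | .action => π.actionDist

/-! ### Statistical distances -/

/-- Total variation distance of `q` and `p`. -/
def distTV {k : ℕ} (q p : Fin k → ℝ) : ℝ≥0∞ :=
  ENNReal.ofReal (1 / 2 * ∑ i, |q i - p i|)

open Classical in
/-- Kullback-Leibler divergence of the probability vectors `a` and `b`, with value `∞` if the
support of `a` is not contained in that of `b`. -/
def klVec {k : ℕ} (a b : Fin k → ℝ) : ℝ≥0∞ :=
  if ∀ i, b i = 0 → a i = 0 then ENNReal.ofReal (∑ i, a i * Real.log (a i / b i)) else ∞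

/-- Reverse-KL distance of `q` from the target `p`. -/
def distRKL {k : ℕ} (q p : Fin k → ℝ) : ℝ≥0∞ := klVec q p

/-- Forward-KL distance of `q` from the target `p`. -/
def distFKL {k : ℕ} (q p : Fin k → ℝ) : ℝ≥0∞ := klVec p q

/-! ### Expected regrets -/

/-- Whether the performance distribution is averaged over the randomness of the policy before it
is compared with the target (`environment`), or not (`plain`). -/
inductive Averaging
  | plain
  | environment

/-- The expected regret of the policy, summed over the time-steps `t + 1` with `t ∈ S`. -/
def Policy.expectedRegret {T k : ℕ} (π : Policy T k) (ν : Environment k)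
    (d : (Fin k → ℝ) → (Fin k → ℝ) → ℝ≥0∞) (l : Level) (S : Finset (Fin T)) : Averaging → ℝ≥0∞
  | .plain => ∫⁻ z, ∑ t ∈ S, d (π.perf ν l t z) (target ν) ∂(π.joint ν)
  | .environment =>
      ∫⁻ w, ∑ t ∈ S, d (fun i => ∫ ω, π.perf ν l t (ω, w) i ∂π.prob) (target ν)
        ∂(realizationMeasure T ν)

/-- The set that consists of the last time-step `T` (simple regret). -/
def lastStep (T : ℕ) : Finset (Fin T) := Finset.univ.filter fun t => (t : ℕ) + 1 = T

/-- The set of all time-steps (cumulative regret). -/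
def allSteps (T : ℕ) : Finset (Fin T) := Finset.univ

/-- The time-steps at which a cumulative forward-KL regret is counted: for the policy level those
after the exploration phase, for the action level those from `k` on, as before that some arm is
unplayed. -/
def fklSteps (T k : ℕ) (M : ℝ) : Level → Finset (Fin T)
  | .policy => Finset.univ.filter fun t => M * k < (t : ℕ) + 1
  | .action => Finset.univ.filter fun t => k ≤ (t : ℕ) + 1

/-! ### Active Sampling with Exploration -/

/-- The number of plays of arm `i` in a history. -/
def playCount {k n : ℕ} (h : History k n) (i : Fin k) : ℕ :=
  (Finset.univ.filter fun s => (h s).1 = i).card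

/-- The average of the rewards observed from arm `i` in a history. -/
def rewardEstimate {k n : ℕ} (h : History k n) (i : Fin k) : ℝ :=
  1 / (playCount h i : ℝ) * ∑ s, if (h s).1 = i then (h s).2 else 0

/-- Inverse transform sampling: if `u` is uniform on `[0, 1]` then `sampleArm p u` has the
distribution `p`.  It is the first arm `i` with `u ≤ p 0 + ⋯ + p i`, which exists if `p` is a
probability vector. -/
def sampleArm {k : ℕ} [NeZero k] (p : Fin k → ℝ) (u : ℝ) : Fin k :=
  ⟨min (Finset.univ.filter fun j : Fin k => ∑ l ∈ Finset.Iic j, p l < u).card (k - 1),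
    lt_of_le_of_lt (min_le_right _ _) (Nat.sub_lt (NeZero.pos k) one_pos)⟩

theorem measurable_rewardEstimate {k n : ℕ} (i : Fin k) :
    Measurable fun h : History k n => rewardEstimate h i := by
  have hs : ∀ s : Fin n, MeasurableSet {h : History k n | (h s).1 = i} := fun s =>
    (measurable_fst.comp (measurable_pi_apply s)) (MeasurableSet.singleton i)
  unfold rewardEstimate playCount
  refine Measurable.mul ?_ (Finset.measurable_sum _ fun s _ => ?_)
  · simp only [Finset.card_filter, Nat.cast_sum, Nat.cast_ite, Nat.cast_one, Nat.cast_zero]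
    exact (Finset.measurable_sum _ fun s _ =>
      Measurable.ite (hs s) measurable_const measurable_const).const_div 1
  · exact Measurable.ite (hs s) (measurable_snd.comp (measurable_pi_apply s)) measurable_const

theorem measurable_softmax {k : ℕ} : Measurable (softmax (k := k)) := by
  unfold softmax
  fun_prop

theorem measurable_sampleArm {k : ℕ} [NeZero k] :
    Measurable fun z : (Fin k → ℝ) × ℝ => sampleArm z.1 z.2 := by
  have hc : Measurable fun z : (Fin k → ℝ) × ℝ =>
      (Finset.univ.filter fun j : Fin k => ∑ l ∈ Finset.Iic j, z.1 l < z.2).card := by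
    simp only [Finset.card_filter]
    refine Finset.measurable_sum _ fun j _ => Measurable.ite ?_ measurable_const measurable_const
    exact measurableSet_lt (by fun_prop) (by fun_prop)
  refine measurable_to_countable' fun i => ?_
  have : (fun z : (Fin k → ℝ) × ℝ => sampleArm z.1 z.2) ⁻¹' {i} =
      (fun z : (Fin k → ℝ) × ℝ =>
        (Finset.univ.filter fun j : Fin k => ∑ l ∈ Finset.Iic j, z.1 l < z.2).card) ⁻¹'
        {c | min c (k - 1) = i} := by
    ext z
    simp [sampleArm, Fin.ext_iff]
  rw [this]
  exact hc (Set.to_countable _).measurableSet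

/-- The arm that Active Sampling with Exploration plays at the time-step `t + 1`: the arm
`(t + 1) mod k` (the arms being `0, …, k - 1`) if `t + 1 ≤ M k`, and otherwise an arm sampled
from the softmax of the reward estimates by means of the uniform variable `ω t`. -/
def aseArm {T k : ℕ} [NeZero k] (M : ℝ) (t : Fin T) (ω : Fin T → unitInterval)
    (h : History k (t : ℕ)) : Fin k :=
  if ((t : ℕ) + 1 : ℝ) ≤ M * k then ⟨((t : ℕ) + 1) % k, Nat.mod_lt _ (NeZero.pos k)⟩
  else sampleArm (softmax (rewardEstimate h)) (ω t)

theorem measurable_aseArm {T k : ℕ} [NeZero k] (t : Fin T) (M : ℝ) :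
    Measurable fun z : (Fin T → unitInterval) × History k (t : ℕ) => aseArm M t z.1 z.2 := by
  unfold aseArm
  by_cases hc : ((t : ℕ) + 1 : ℝ) ≤ M * k
  · simp only [hc, if_true]
    exact measurable_const
  · simp only [hc, if_false]
    have h0 : Measurable fun h : History k (t : ℕ) => rewardEstimate h :=
      measurable_pi_lambda _ fun i => measurable_rewardEstimate i
    have h1 : Measurable fun z : (Fin T → unitInterval) × History k (t : ℕ) =>
        softmax (rewardEstimate z.2) :=
      measurable_softmax.comp (h0.comp measurable_snd)
    have h2 : Measurable fun z : (Fin T → unitInterval) × History k (t : ℕ) => (z.1 t : ℝ) :=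
      measurable_subtype_coe.comp ((measurable_pi_apply t).comp measurable_fst)
    have h3 := Measurable.comp (f := fun z : (Fin T → unitInterval) × History k (t : ℕ) =>
      (softmax (rewardEstimate z.2), (z.1 t : ℝ))) (measurable_sampleArm (k := k)) (h1.prodMk h2)
    exact h3

/-- Active Sampling with Exploration, with horizon `T`, number of arms `k` and exploration factor
`M`.  Its randomness consists of one uniform variable per time-step, independent of each other. -/
def ase (T k : ℕ) [NeZero k] (M : ℝ) : Policy T k where
  Ω := Fin T → unitInterval
  prob := Measure.pi fun _ => (volume : Measure unitInterval)
  act t ω h := aseArm M t ω h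
  measurable_act t := measurable_aseArm t M

/-! ### Systems of regret bounds

Here `g` is the factor that the asymptotic notation hides. -/

/-- The bounds on the simple policy-level regrets, for a horizon beyond the exploration phase. -/
def SimplePolicyBounds {k : ℕ} [NeZero k] (σ : ℝ≥0) (ν : Environment k) (T : ℕ) (M g : ℝ) : Prop :=
  M * k < T → ∀ a : Averaging,
    (ase T k M).expectedRegret ν distTV .policy (lastStep T) a
      ≤ ENNReal.ofReal (g * (T : ℝ) ^ (-(1 / 2) : ℝ)) ∧
    (ase T k M).expectedRegret ν distRKL .policy (lastStep T) a
      ≤ ENNReal.ofReal (g * (T : ℝ)⁻¹) ∧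
    (IsBoundedEnv σ ν →
      (ase T k M).expectedRegret ν distFKL .policy (lastStep T) a
        ≤ ENNReal.ofReal (g * (T : ℝ)⁻¹))

/-- The bounds on the simple action-level regrets. -/
def SimpleActionBounds {k : ℕ} [NeZero k] (σ : ℝ≥0) (ν : Environment k) (T : ℕ) (M g : ℝ) : Prop :=
  ∀ a : Averaging,
    (ase T k M).expectedRegret ν distTV .action (lastStep T) a
      ≤ ENNReal.ofReal (g * (T : ℝ) ^ (-(1 / 2) : ℝ)) ∧
    (ase T k M).expectedRegret ν distRKL .action (lastStep T) a
      ≤ ENNReal.ofReal (g * (T : ℝ)⁻¹) ∧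
    (IsBoundedEnv σ ν →
      (ase T k M).expectedRegret ν distFKL .action (lastStep T) a
        ≤ ENNReal.ofReal (g * (T : ℝ)⁻¹))

/-- The bounds on the cumulative regrets, policy-level and action-level. -/
def CumulativeBounds {k : ℕ} [NeZero k] (σ : ℝ≥0) (ν : Environment k) (T : ℕ) (M g : ℝ) : Prop :=
  ∀ (l : Level) (a : Averaging),
    (ase T k M).expectedRegret ν distTV l (allSteps T) a
      ≤ ENNReal.ofReal (g * (T : ℝ) ^ (1 / 2 : ℝ)) ∧
    (ase T k M).expectedRegret ν distRKL l (allSteps T) a ≤ ENNReal.ofReal g ∧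
    (IsBoundedEnv σ ν →
      (ase T k M).expectedRegret ν distFKL l (fklSteps T k M l) a ≤ ENNReal.ofReal g)

end

end MultiArmedSampling

open MultiArmedSampling

namespace MultiArmedSampling

/-! ### Comparison of probability vectors -/

section Vectors

variable {k : ℕ}

/-! Everything rests on one estimate: after the exploration phase, the summed squared error of the
reward estimates in the history before step `t + 1` has mean at most `E / t`, where `E` is
polynomial in `log T` times `exp (2 * B)` and `B` is a radius around the true means that the
estimates do not leave with high probability (`upperMean_sq_error`).

The difficulty is circular: estimates improve only for arms that are played, and arms are played
according to the estimates. Exponential supermartingales break the circle. Let `N` be the number of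
plays of an arm, `S` the sum of its noise and `D` the sum of its conditional play probabilities.
Then `exp (c S - c² σ² N / 2)` and `exp (D / 2 - N)` have mean at most 1. On the event that the sum
of all these exponentials, over times, arms, signs and a grid of tilts, stays below `T ^ 6`, one has
`S² ≤ 2 σ² L N` and `N ≥ D / 2 - L` with `L = 6 log T`. As exploration gives `N ≥ ⌊M⌋`, the first
inequality keeps every estimate within `B` of its mean; hence every arm has conditional probability
at least `α exp (-2 B)`, so `D`, and by the second inequality `N`, grows linearly in `t`, and the
squared error `S² / N²` is of order `1 / t`. Off this event a fourth moment bound for `S`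
contributes only `O(1 / T)`.

The error passes to the regrets through the squared Euclidean distance `V` of the performance
distribution to the target. Softmax is Lipschitz, because the symmetrised divergence of two softmax
vectors is a bilinear expression in their differences (`jeffreys_softmax`); this settles the policy
level. At the action level the play counts differ from their targets by a martingale with second
moment at most `n`, by the exploration phase, and by accumulated policy errors (`sq_plays_sub_le`);
again `V` has mean of order `1 / n`, but the constant contains `M`, so `M` has to be polylogarithmic
there. Total variation, reverse KL and action-level forward KL are bounded by affine functions of
`V`, and policy-level forward KL by the squared error itself. The environment versions follow from
the same majorants by Jensen's inequality, and the cumulative ones by summing `1 / t` or `1 / √t`.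

Finally `B` is chosen: `B = 1` is possible if `M ≥ 36 σ² log T`, while `M = 1` needs `B` of order `σ
√(log T)`, whence the factor `exp (C √(log T))`. -/

theorem sum_exp_pos [NeZero k] (r : Fin k → ℝ) : 0 < ∑ j, Real.exp (r j) :=
  Finset.sum_pos (fun _ _ => Real.exp_pos _) ⟨0, Finset.mem_univ _⟩

theorem softmax_pos [NeZero k] (r : Fin k → ℝ) (i : Fin k) : 0 < softmax r i :=
  div_pos (Real.exp_pos _) (sum_exp_pos r)

theorem sum_softmax [NeZero k] (r : Fin k → ℝ) : ∑ i, softmax r i = 1 := by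
  simp only [softmax, ← Finset.sum_div]
  exact div_self (sum_exp_pos r).ne'

theorem softmax_le_one [NeZero k] (r : Fin k → ℝ) (i : Fin k) : softmax r i ≤ 1 := by
  rw [← sum_softmax r]
  exact Finset.single_le_sum (fun j _ => (softmax_pos r j).le) (Finset.mem_univ i)

/-- The real-valued Kullback-Leibler divergence. -/
noncomputable def klReal (a b : Fin k → ℝ) : ℝ := ∑ i, a i * Real.log (a i / b i)

theorem klVec_eq_ofReal {a b : Fin k → ℝ} (hb : ∀ i, 0 < b i) :
    klVec a b = ENNReal.ofReal (klReal a b) :=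
  if_pos fun i hi => absurd hi (hb i).ne'

/-- The bound `log x ≤ x - 1` gives the chi-square term plus `a i - b i`, and the latter cancels in
the sum. -/
theorem klReal_le_chiSq {a b : Fin k → ℝ} (ha : ∀ i, 0 ≤ a i) (hb : ∀ i, 0 < b i)
    (hab : ∑ i, a i = ∑ i, b i) : klReal a b ≤ ∑ i, (a i - b i) ^ 2 / b i := by
  have h1 : ∀ i, a i * Real.log (a i / b i) ≤ (a i - b i) ^ 2 / b i + (a i - b i) := by
    intro i
    have hbi := hb i
    have h2 : (a i - b i) ^ 2 / b i + (a i - b i) = a i * (a i / b i - 1) := by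
      field_simp
      ring
    rw [h2]
    rcases (ha i).eq_or_lt with h | h
    · simp [← h]
    · exact mul_le_mul_of_nonneg_left (Real.log_le_sub_one_of_pos (div_pos h hbi)) (ha i)
  calc klReal a b ≤ ∑ i, ((a i - b i) ^ 2 / b i + (a i - b i)) :=
        Finset.sum_le_sum fun i _ => h1 i
    _ = ∑ i, (a i - b i) ^ 2 / b i := by
        rw [Finset.sum_add_distrib, Finset.sum_sub_distrib, hab, sub_self, add_zero]

theorem klReal_nonneg {a b : Fin k → ℝ} (ha : ∀ i, 0 < a i) (hb : ∀ i, 0 < b i)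
    (hab : ∑ i, a i = ∑ i, b i) : 0 ≤ klReal a b := by
  have h1 : ∀ i, a i - b i ≤ a i * Real.log (a i / b i) := by
    intro i
    have h2 : a i - b i = a i * (1 - (a i / b i)⁻¹) := by
      have := (ha i).ne'
      field_simp
    rw [h2]
    exact mul_le_mul_of_nonneg_left
      (Real.one_sub_inv_le_log_of_pos (div_pos (ha i) (hb i))) (ha i).le
  calc (0 : ℝ) = ∑ i, (a i - b i) := by rw [Finset.sum_sub_distrib, hab, sub_self]
    _ ≤ klReal a b := Finset.sum_le_sum fun i _ => h1 i

/-- The right side is `(a - b) * log (a / b)`. For the larger number `x` and the smaller `y`, `log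
(x / y) ≥ 1 - y / x` bounds it below by `(x - y) ^ 2 / x`. -/
theorem sq_sub_div_add_le_mul_log {a b : ℝ} (ha : 0 < a) (hb : 0 < b) :
    (a - b) ^ 2 / (a + b) ≤ a * Real.log (a / b) + b * Real.log (b / a) := by
  have key : ∀ {x y : ℝ}, 0 < x → 0 < y → y ≤ x →
      (x - y) ^ 2 / (x + y) ≤ (x - y) * Real.log (x / y) := by
    intro x y hx hy hxy
    have h1 : 1 - (x / y)⁻¹ ≤ Real.log (x / y) := Real.one_sub_inv_le_log_of_pos (div_pos hx hy)
    calc (x - y) ^ 2 / (x + y) ≤ (x - y) ^ 2 / x :=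
          div_le_div_of_nonneg_left (sq_nonneg _) hx (by linarith)
      _ = (x - y) * (1 - (x / y)⁻¹) := by field_simp
      _ ≤ _ := mul_le_mul_of_nonneg_left h1 (sub_nonneg.2 hxy)
  have hl : Real.log (b / a) = - Real.log (a / b) := by rw [← Real.log_inv, inv_div]
  rcases le_total b a with h | h
  · have := key ha hb h
    rw [hl]
    linarith
  · have := key hb ha h
    rw [hl] at this ⊢
    have e : (a - b) ^ 2 / (a + b) = (b - a) ^ 2 / (b + a) := by
      rw [add_comm a b]; congr 1; ring
    rw [e]
    linarith

/-- A Pinsker inequality for the symmetrised divergence: Cauchy-Schwarz with the weights `a i + b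
i`, which sum to 2. -/
theorem sq_sum_abs_sub_le_jeffreys {a b : Fin k → ℝ} (ha : ∀ i, 0 < a i) (hb : ∀ i, 0 < b i)
    (ha1 : ∑ i, a i = 1) (hb1 : ∑ i, b i = 1) :
    (∑ i, |a i - b i|) ^ 2 ≤ 2 * (klReal a b + klReal b a) := by
  have h1 : (∑ i, |a i - b i|) ^ 2 ≤ (∑ i, (a i - b i) ^ 2 / (a i + b i)) * ∑ i, (a i + b i) := by
    refine Finset.sum_sq_le_sum_mul_sum_of_sq_le_mul _ (fun i _ => ?_) (fun i _ => ?_) fun i _ => ?_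
    · exact div_nonneg (sq_nonneg _) (add_pos (ha i) (hb i)).le
    · exact (add_pos (ha i) (hb i)).le
    · rw [sq_abs, div_mul_cancel₀ _ (add_pos (ha i) (hb i)).ne']
  have h2 : ∑ i, (a i + b i) = 2 := by
    rw [Finset.sum_add_distrib, ha1, hb1]; norm_num
  have h3 : ∑ i, (a i - b i) ^ 2 / (a i + b i) ≤ klReal a b + klReal b a := by
    rw [klReal, klReal, ← Finset.sum_add_distrib]
    exact Finset.sum_le_sum fun i _ => sq_sub_div_add_le_mul_log (ha i) (hb i)
  rw [h2] at h1
  linarith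

/-! ### Softmax vectors -/

theorem log_softmax_div [NeZero k] (r s : Fin k → ℝ) (i : Fin k) :
    Real.log (softmax r i / softmax s i) =
      r i - s i + (Real.log (∑ j, Real.exp (s j)) - Real.log (∑ j, Real.exp (r j))) := by
  rw [Real.log_div (softmax_pos r i).ne' (softmax_pos s i).ne', softmax, softmax,
    Real.log_div (Real.exp_pos _).ne' (sum_exp_pos r).ne',
    Real.log_div (Real.exp_pos _).ne' (sum_exp_pos s).ne', Real.log_exp, Real.log_exp]
  ring

/-- Each log ratio is `r i - s i` plus a constant coming from the normalisers. The constant is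
paired with the differences of two probability vectors and drops out. -/
theorem jeffreys_softmax [NeZero k] (r s : Fin k → ℝ) :
    klReal (softmax r) (softmax s) + klReal (softmax s) (softmax r) =
      ∑ i, (softmax r i - softmax s i) * (r i - s i) := by
  set c := Real.log (∑ j, Real.exp (s j)) - Real.log (∑ j, Real.exp (r j)) with hc
  have h1 : ∀ i, softmax r i * Real.log (softmax r i / softmax s i) +
      softmax s i * Real.log (softmax s i / softmax r i) =
      (softmax r i - softmax s i) * (r i - s i) + (softmax r i - softmax s i) * c := by
    intro i
    rw [log_softmax_div, log_softmax_div]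
    ring
  rw [klReal, klReal, ← Finset.sum_add_distrib, Finset.sum_congr rfl fun i _ => h1 i,
    Finset.sum_add_distrib, ← Finset.sum_mul, Finset.sum_sub_distrib, sum_softmax, sum_softmax]
  ring

/-- A self-bounding argument. With `A` the `ℓ¹` distance and `J` the symmetrised divergence, `J ≤ A
* δ` by `jeffreys_softmax` and `A ^ 2 ≤ 2 * J` by Pinsker, so `A ≤ 2 * δ`, and then `J ≤ 2 * δ ^ 2`.
-/
theorem sum_abs_softmax_sub_le [NeZero k] {r s : Fin k → ℝ} {δ : ℝ} (h : ∀ i, |r i - s i| ≤ δ) :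
    ∑ i, |softmax r i - softmax s i| ≤ 2 * δ ∧
      klReal (softmax r) (softmax s) + klReal (softmax s) (softmax r) ≤ 2 * δ ^ 2 := by
  set A := ∑ i, |softmax r i - softmax s i| with hA
  have hA0 : 0 ≤ A := Finset.sum_nonneg fun i _ => abs_nonneg _
  have hδ : 0 ≤ δ := (abs_nonneg _).trans (h 0)
  have h1 : klReal (softmax r) (softmax s) + klReal (softmax s) (softmax r) ≤ A * δ := by
    rw [jeffreys_softmax, hA, Finset.sum_mul]
    refine Finset.sum_le_sum fun i _ => (le_abs_self _).trans ?_
    rw [abs_mul]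
    exact mul_le_mul_of_nonneg_left (h i) (abs_nonneg _)
  have h2 := sq_sum_abs_sub_le_jeffreys (softmax_pos r) (softmax_pos s) (sum_softmax r)
    (sum_softmax s)
  rw [← hA] at h2
  have h3 : A ≤ 2 * δ := by
    by_contra hlt
    push Not at hlt
    nlinarith
  exact ⟨h3, by nlinarith⟩

theorem abs_sub_le_sqrt_sum_sq (r s : Fin k → ℝ) (i : Fin k) :
    |r i - s i| ≤ √(∑ j, (r j - s j) ^ 2) :=
  Real.abs_le_sqrt (Finset.single_le_sum (f := fun j => (r j - s j) ^ 2)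
    (fun _ _ => sq_nonneg _) (Finset.mem_univ i))

theorem sum_sq_softmax_sub_le [NeZero k] (r s : Fin k → ℝ) :
    ∑ i, (softmax r i - softmax s i) ^ 2 ≤ 4 * ∑ j, (r j - s j) ^ 2 := by
  have h0 : 0 ≤ ∑ j, (r j - s j) ^ 2 := Finset.sum_nonneg fun j _ => sq_nonneg _
  have h1 := (sum_abs_softmax_sub_le (abs_sub_le_sqrt_sum_sq r s)).1
  have h2 : ∑ i, (softmax r i - softmax s i) ^ 2 ≤ (∑ i, |softmax r i - softmax s i|) ^ 2 := by
    simp_rw [← sq_abs (softmax r _ - softmax s _)]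
    exact Finset.sum_sq_le_sq_sum_of_nonneg fun i _ => abs_nonneg _
  have h3 : (∑ i, |softmax r i - softmax s i|) ^ 2 ≤ (2 * √(∑ j, (r j - s j) ^ 2)) ^ 2 :=
    pow_le_pow_left₀ (Finset.sum_nonneg fun i _ => abs_nonneg _) h1 2
  rw [mul_pow, Real.sq_sqrt h0] at h3
  linarith

theorem klReal_softmax_le [NeZero k] (r s : Fin k → ℝ) :
    klReal (softmax s) (softmax r) ≤ 2 * ∑ j, (r j - s j) ^ 2 := by
  have h0 : 0 ≤ ∑ j, (r j - s j) ^ 2 := Finset.sum_nonneg fun j _ => sq_nonneg _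
  have h1 := (sum_abs_softmax_sub_le (abs_sub_le_sqrt_sum_sq r s)).2
  have h2 := klReal_nonneg (softmax_pos r) (softmax_pos s)
    ((sum_softmax r).trans (sum_softmax s).symm)
  rw [Real.sq_sqrt h0] at h1
  linarith

/-- The numerator loses at most `exp (-δ)` and the normaliser gains at most `exp δ`. -/
theorem softmax_ge_of_close [NeZero k] {r s : Fin k → ℝ} {δ : ℝ} (h : ∀ i, |r i - s i| ≤ δ)
    (i : Fin k) : softmax s i * Real.exp (-(2 * δ)) ≤ softmax r i := by
  have h1 : ∑ j, Real.exp (r j) ≤ (∑ j, Real.exp (s j)) * Real.exp δ := by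
    rw [Finset.sum_mul]
    refine Finset.sum_le_sum fun j _ => ?_
    rw [← Real.exp_add]
    exact Real.exp_le_exp.2 (by linarith [(abs_le.1 (h j)).2])
  have h2 : Real.exp (s i) * Real.exp (-δ) ≤ Real.exp (r i) := by
    rw [← Real.exp_add]
    exact Real.exp_le_exp.2 (by linarith [(abs_le.1 (h i)).1])
  have h3 : Real.exp (-(2 * δ)) = Real.exp (-δ) / Real.exp δ := by
    rw [← Real.exp_sub]; congr 1; ring
  rw [softmax, softmax, h3, div_mul_div_comm]
  exact div_le_div₀ (Real.exp_pos _).le h2 (sum_exp_pos r) h1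

/-! ### Distances bounded by the squared Euclidean distance -/

theorem distTV_le {q p : Fin k → ℝ} {η : ℝ} (hη : 0 < η) :
    1 / 2 * ∑ i, |q i - p i| ≤ (η * ∑ i, (q i - p i) ^ 2 + k / η) / 4 := by
  have h1 : ∀ i, |q i - p i| ≤ (η * (q i - p i) ^ 2 + 1 / η) / 2 := by
    intro i
    rw [← sq_abs]
    set x := |q i - p i|
    have : 0 ≤ (η * x - 1) ^ 2 / η := div_nonneg (sq_nonneg _) hη.le
    have e : (η * x - 1) ^ 2 / η = η * x ^ 2 - 2 * x + 1 / η := by field_simp; ring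
    linarith
  have h2 := Finset.sum_le_sum fun i (_ : i ∈ Finset.univ) => h1 i
  rw [← Finset.sum_div, Finset.sum_add_distrib, ← Finset.mul_sum] at h2
  simp only [Finset.sum_const, Finset.card_univ, Fintype.card_fin, nsmul_eq_mul] at h2
  have e : (k : ℝ) * (1 / η) = k / η := by ring
  rw [e] at h2
  linarith

theorem klReal_le_of_lower_bound {q p : Fin k → ℝ} {α : ℝ} (hα : 0 < α) (hq : ∀ i, 0 ≤ q i)
    (hp : ∀ i, α ≤ p i) (hq1 : ∑ i, q i = 1) (hp1 : ∑ i, p i = 1) :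
    klReal q p ≤ 1 / α * ∑ i, (q i - p i) ^ 2 := by
  refine (klReal_le_chiSq hq (fun i => hα.trans_le (hp i)) (hq1.trans hp1.symm)).trans ?_
  rw [Finset.mul_sum]
  refine Finset.sum_le_sum fun i _ => ?_
  rw [one_div, mul_comm, ← div_eq_mul_inv]
  exact div_le_div_of_nonneg_left (sq_nonneg _) hα (hp i)

/-- Forward KL is not bounded by the squared distance when entries of `q` are small; the lower bound
`1 / n` limits the damage to a logarithm. If `q` is at least half of `p` everywhere, chi-square
applies with denominators at least `α / 2`. Otherwise the divergence is at most `log n`, and some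
coordinate already makes the squared distance at least `α ^ 2 / 4`. -/
theorem klReal_forward_le {q p : Fin k → ℝ} {α l : ℝ} {n : ℕ} (hα : 0 < α)
    (hn : 1 ≤ n) (hl : Real.log n ≤ l)
    (hq : ∀ i, 1 / (n : ℝ) ≤ q i) (hp : ∀ i, α ≤ p i) (hq1 : ∑ i, q i = 1) (hp1 : ∑ i, p i = 1) :
    klReal p q ≤ (2 / α + 4 * l / α ^ 2) * ∑ i, (q i - p i) ^ 2 := by
  have hn0 : (0 : ℝ) < n := by exact_mod_cast hn
  have hl0 : 0 ≤ l := (Real.log_nonneg (by exact_mod_cast hn)).trans hl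
  have hq0 : ∀ i, 0 < q i := fun i => (one_div_pos.2 hn0).trans_le (hq i)
  have hp0 : ∀ i, 0 < p i := fun i => hα.trans_le (hp i)
  have hV : 0 ≤ ∑ i, (q i - p i) ^ 2 := Finset.sum_nonneg fun i _ => sq_nonneg _
  by_cases hc : ∀ i, p i / 2 ≤ q i
  · have h1 : klReal p q ≤ ∑ i, (p i - q i) ^ 2 / q i :=
      klReal_le_chiSq (fun i => (hp0 i).le) hq0 (hp1.trans hq1.symm)
    have h2 : ∑ i, (p i - q i) ^ 2 / q i ≤ 2 / α * ∑ i, (q i - p i) ^ 2 := by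
      rw [Finset.mul_sum]
      refine Finset.sum_le_sum fun i _ => ?_
      have h3 : α / 2 ≤ q i := by linarith [hc i, hp i]
      calc (p i - q i) ^ 2 / q i ≤ (p i - q i) ^ 2 / (α / 2) :=
            div_le_div_of_nonneg_left (sq_nonneg _) (by positivity) h3
        _ = 2 / α * (q i - p i) ^ 2 := by field_simp; ring
    have h4 : 0 ≤ 4 * l / α ^ 2 * ∑ i, (q i - p i) ^ 2 := by positivity
    linarith
  · push Not at hc
    obtain ⟨i, hi⟩ := hc
    have h1 : klReal p q ≤ l := by
      calc klReal p q ≤ ∑ i, p i * l := by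
            refine Finset.sum_le_sum fun j _ => mul_le_mul_of_nonneg_left ?_ (hp0 j).le
            refine le_trans (Real.log_le_log (div_pos (hp0 j) (hq0 j)) ?_) hl
            rw [div_le_iff₀ (hq0 j)]
            have hpj : p j ≤ 1 := by
              rw [← hp1]
              exact Finset.single_le_sum (fun j _ => (hp0 j).le) (Finset.mem_univ j)
            have := mul_le_mul_of_nonneg_left (hq j) hn0.le
            rw [mul_one_div_cancel hn0.ne'] at this
            linarith
        _ = l := by rw [← Finset.sum_mul, hp1, one_mul]
    have h2 : α ^ 2 / 4 ≤ ∑ i, (q i - p i) ^ 2 := by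
      refine le_trans ?_ (Finset.single_le_sum (f := fun i => (q i - p i) ^ 2)
        (fun _ _ => sq_nonneg _) (Finset.mem_univ i))
      have h3 : α / 2 ≤ p i - q i := by linarith [hp i]
      show α ^ 2 / 4 ≤ (q i - p i) ^ 2
      nlinarith
    have h3 : l = 4 * l / α ^ 2 * (α ^ 2 / 4) := by field_simp
    have h4 : 4 * l / α ^ 2 * (α ^ 2 / 4) ≤ 4 * l / α ^ 2 * ∑ i, (q i - p i) ^ 2 :=
      mul_le_mul_of_nonneg_left h2 (by positivity)
    have h5 : 0 ≤ 2 / α * ∑ i, (q i - p i) ^ 2 := by positivity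
    linarith

end Vectors

/-! ### Upper bounds on means -/

section UpperMean

variable {Ω : Type*} [MeasurableSpace Ω] {μ : Measure Ω} {f g : Ω → ℝ} {a b c : ℝ}

/-- The function `f` has an integrable majorant of mean at most `c`. -/
def UpperMean (μ : Measure Ω) (f : Ω → ℝ) (c : ℝ) : Prop :=
  ∃ g : Ω → ℝ, Integrable g μ ∧ f ≤ᵐ[μ] g ∧ ∫ x, g x ∂μ ≤ c

theorem UpperMean.mono_ae (h : UpperMean μ g c) (hfg : f ≤ᵐ[μ] g) : UpperMean μ f c := by
  obtain ⟨u, hu, hgu, hc⟩ := h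
  exact ⟨u, hu, hfg.trans hgu, hc⟩

theorem UpperMean.mono (h : UpperMean μ g c) (hfg : ∀ x, f x ≤ g x) : UpperMean μ f c :=
  h.mono_ae (Filter.Eventually.of_forall hfg)

theorem UpperMean.le_bound (h : UpperMean μ f a) (hab : a ≤ b) : UpperMean μ f b := by
  obtain ⟨u, hu, hfu, hc⟩ := h
  exact ⟨u, hu, hfu, hc.trans hab⟩

theorem UpperMean.add (hf : UpperMean μ f a) (hg : UpperMean μ g b) :
    UpperMean μ (fun x => f x + g x) (a + b) := by
  obtain ⟨u, hu, hfu, hua⟩ := hf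
  obtain ⟨v, hv, hgv, hvb⟩ := hg
  refine ⟨fun x => u x + v x, hu.add hv, ?_, ?_⟩
  · filter_upwards [hfu, hgv] with x h1 h2 using add_le_add h1 h2
  · rw [integral_add hu hv]
    exact add_le_add hua hvb

theorem UpperMean.const_mul (hf : UpperMean μ f a) (hc : 0 ≤ c) :
    UpperMean μ (fun x => c * f x) (c * a) := by
  obtain ⟨u, hu, hfu, hua⟩ := hf
  refine ⟨fun x => c * u x, hu.const_mul c, ?_, ?_⟩
  · filter_upwards [hfu] with x h1 using mul_le_mul_of_nonneg_left h1 hc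
  · rw [integral_const_mul]
    exact mul_le_mul_of_nonneg_left hua hc

theorem UpperMean.const [IsProbabilityMeasure μ] (c : ℝ) : UpperMean μ (fun _ => c) c :=
  ⟨fun _ => c, integrable_const c, Filter.EventuallyLE.refl _ _, by simp⟩

theorem UpperMean.sum {ι : Type*} {s : Finset ι} {F : ι → Ω → ℝ} {A : ι → ℝ}
    (h : ∀ i ∈ s, UpperMean μ (F i) (A i)) :
    UpperMean μ (fun x => ∑ i ∈ s, F i x) (∑ i ∈ s, A i) := by
  classical
  induction s using Finset.induction_on with
  | empty => exact ⟨fun _ => 0, integrable_zero _ _ _, by simpa using Filter.EventuallyLE.refl _ _, by simp⟩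
  | insert i s hi ih =>
    simp only [Finset.sum_insert hi]
    exact (h i (Finset.mem_insert_self i s)).add
      (ih fun j hj => h j (Finset.mem_insert_of_mem hj))

theorem UpperMean.of_lintegral (hf : Measurable f) (hf0 : ∀ x, 0 ≤ f x) (hc : 0 ≤ c)
    (h : ∫⁻ x, ENNReal.ofReal (f x) ∂μ ≤ ENNReal.ofReal c) : UpperMean μ f c := by
  refine ⟨f, ⟨hf.aestronglyMeasurable, ?_⟩, Filter.EventuallyLE.refl _ _, ?_⟩
  · rw [hasFiniteIntegral_iff_ofReal (Filter.Eventually.of_forall hf0)]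
    exact h.trans_lt ENNReal.ofReal_lt_top
  · rw [integral_eq_lintegral_of_nonneg_ae (Filter.Eventually.of_forall hf0)
      hf.aestronglyMeasurable]
    exact ENNReal.toReal_le_of_le_ofReal hc h

/-- Together with `UpperMean.of_lintegral` this translates between `ℝ≥0∞`-valued integrals, which
appear in martingale arguments and regrets, and real bounds, which can be added, scaled and compared
pointwise without integrability of the bounded function. -/
theorem UpperMean.lintegral_le (h : UpperMean μ f c) (hf0 : ∀ x, 0 ≤ f x) :
    ∫⁻ x, ENNReal.ofReal (f x) ∂μ ≤ ENNReal.ofReal c := by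
  obtain ⟨g, hg, hfg, hc⟩ := h
  have hg0 : 0 ≤ᵐ[μ] g := by filter_upwards [hfg] with x hx using (hf0 x).trans hx
  calc ∫⁻ x, ENNReal.ofReal (f x) ∂μ ≤ ∫⁻ x, ENNReal.ofReal (g x) ∂μ :=
        lintegral_mono_ae (by filter_upwards [hfg] with x hx using ENNReal.ofReal_le_ofReal hx)
    _ = ENNReal.ofReal (∫ x, g x ∂μ) := (ofReal_integral_eq_lintegral_ofReal hg hg0).symm
    _ ≤ ENNReal.ofReal c := ENNReal.ofReal_le_ofReal hc

end UpperMean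

/-! ### Resampling one coordinate of a product measure -/

/-- Both sides have the same marginal once coordinate `i` is integrated out, since the inner
integral on the right no longer depends on it. Resampling one coordinate in this way takes the place
of conditioning on the past. -/
theorem lintegral_pi_eq_lintegral_update {ι : Type*} [Fintype ι] [DecidableEq ι] {X : ι → Type*}
    [∀ i, MeasurableSpace (X i)] (μ : ∀ i, Measure (X i)) [∀ i, IsProbabilityMeasure (μ i)]
    {F : (∀ i, X i) → ℝ≥0∞} (hF : Measurable F) (i : ι) :
    ∫⁻ x, F x ∂Measure.pi μ = ∫⁻ x, ∫⁻ y, F (Function.update x i y) ∂μ i ∂Measure.pi μ := by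
  obtain ⟨x⟩ := nonempty_of_isProbabilityMeasure (Measure.pi μ)
  have hG : Measurable fun x => ∫⁻ y, F (Function.update x i y) ∂μ i := by
    rw [← lmarginal_singleton]
    exact hF.lmarginal μ
  rw [lintegral_eq_lmarginal_univ x, lintegral_eq_lmarginal_univ x,
    lmarginal_erase' F hF (Finset.mem_univ i), lmarginal_erase' _ hG (Finset.mem_univ i)]
  simp

/-! ### Inverse transform sampling -/

section SampleArm

variable {k : ℕ} [NeZero k]

/-- Partial sums are monotone, so `A` is an initial segment and its cardinality is the index of the
first arm whose cumulative sum reaches `u`. The cap at `k - 1` is inactive because the full sum is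
`1 ≥ u`. -/
theorem sampleArm_eq_iff {p : Fin k → ℝ} (hp : ∀ i, 0 ≤ p i) (hp1 : ∑ i, p i = 1) {u : ℝ}
    (hu0 : 0 < u) (hu1 : u ≤ 1) (i : Fin k) :
    sampleArm p u = i ↔ ∑ l ∈ Finset.Iio i, p l < u ∧ u ≤ ∑ l ∈ Finset.Iic i, p l := by
  set A := Finset.univ.filter fun j : Fin k => ∑ l ∈ Finset.Iic j, p l < u with hA
  have hmono : ∀ {s t : Finset (Fin k)}, s ⊆ t → ∑ l ∈ s, p l ≤ ∑ l ∈ t, p l := fun hst =>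
    Finset.sum_le_sum_of_subset_of_nonneg hst fun l _ _ => hp l
  have h1 : (i : ℕ) < A.card ↔ ∑ l ∈ Finset.Iic i, p l < u := by
    constructor
    · intro hlt
      by_contra hge
      push Not at hge
      have hsub : A ⊆ Finset.Iio i := by
        intro j hj
        rw [hA, Finset.mem_filter] at hj
        rw [Finset.mem_Iio]
        by_contra hij
        push Not at hij
        have := hmono (Finset.Iic_subset_Iic.2 hij)
        linarith [hj.2]
      have := Finset.card_le_card hsub
      rw [Fin.card_Iio] at this
      omega
    · intro hlt
      have hsub : Finset.Iic i ⊆ A := by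
        intro j hj
        rw [hA, Finset.mem_filter]
        exact ⟨Finset.mem_univ _,
          (hmono (Finset.Iic_subset_Iic.2 (Finset.mem_Iic.1 hj))).trans_lt hlt⟩
      have := Finset.card_le_card hsub
      rw [Fin.card_Iic] at this
      omega
  have h2 : (i : ℕ) ≤ A.card ↔ ∑ l ∈ Finset.Iio i, p l < u := by
    constructor
    · intro hle
      by_contra hge
      push Not at hge
      -- For arm 0 the sum over `Finset.Iio i` is empty, and `u > 0` rules this case out. Any other
      -- arm has a predecessor, to which the argument of `h1` applies.
      have hi : 0 < (i : ℕ) := by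
        by_contra h0
        have he : Finset.Iio i = ∅ := by
          ext j
          simp only [Finset.mem_Iio, Finset.notMem_empty, iff_false, Fin.lt_def]
          omega
        rw [he, Finset.sum_empty] at hge
        linarith
      have hsub : A ⊆ Finset.Iio (⟨i - 1, by omega⟩ : Fin k) := by
        intro j hj
        rw [hA, Finset.mem_filter] at hj
        rw [Finset.mem_Iio]
        by_contra hij
        rw [Fin.lt_def] at hij
        have hs : Finset.Iio i ⊆ Finset.Iic j := by
          intro l hl
          rw [Finset.mem_Iio, Fin.lt_def] at hl
          rw [Finset.mem_Iic, Fin.le_def]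
          simp only at hij
          omega
        have := hmono hs
        linarith [hj.2]
      have := Finset.card_le_card hsub
      rw [Fin.card_Iio] at this
      simp only at this
      omega
    · intro hlt
      have hsub : Finset.Iio i ⊆ A := by
        intro j hj
        rw [hA, Finset.mem_filter]
        refine ⟨Finset.mem_univ _, (hmono fun l hl => ?_).trans_lt hlt⟩
        exact Finset.mem_Iio.2 ((Finset.mem_Iic.1 hl).trans_lt (Finset.mem_Iio.1 hj))
      have := Finset.card_le_card hsub
      rwa [Fin.card_Iio] at this
  have h3 : A.card ≤ k - 1 := by
    have hne : (⟨k - 1, Nat.sub_lt (NeZero.pos k) one_pos⟩ : Fin k) ∉ A := by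
      rw [hA, Finset.mem_filter]
      rintro ⟨-, hlt⟩
      have he : Finset.Iic (⟨k - 1, Nat.sub_lt (NeZero.pos k) one_pos⟩ : Fin k) =
          Finset.univ := by
        ext j
        simp only [Finset.mem_Iic, Finset.mem_univ, iff_true, Fin.le_def]
        omega
      rw [he, hp1] at hlt
      linarith
    have := Finset.card_lt_card (Finset.ssubset_univ_iff.2 fun h : A = Finset.univ => hne (by
      rw [h]
      exact Finset.mem_univ _))
    rw [Finset.card_univ, Fintype.card_fin] at this
    omega
  have h4 : (sampleArm p u : ℕ) = A.card := by
    simp only [sampleArm]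
    exact min_eq_left h3
  have h5 : u ≤ ∑ l ∈ Finset.Iic i, p l ↔ A.card ≤ i := by rw [← not_lt, ← h1, not_lt]
  rw [Fin.ext_iff, h4, ← h2, h5]
  omega

theorem volume_sampleArm_eq {p : Fin k → ℝ} (hp : ∀ i, 0 ≤ p i) (hp1 : ∑ i, p i = 1) (i : Fin k) :
    (volume : Measure unitInterval) {u | sampleArm p u = i} = ENNReal.ofReal (p i) := by
  have hle : ∀ s : Finset (Fin k), ∑ l ∈ s, p l ∈ Set.Icc (0 : ℝ) 1 := fun s =>
    ⟨Finset.sum_nonneg fun l _ => hp l, hp1 ▸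
      Finset.sum_le_sum_of_subset_of_nonneg (Finset.subset_univ s) fun l _ _ => hp l⟩
  have h1 : {u : unitInterval | sampleArm p u = i} =ᵐ[volume]
      Set.Ioc (⟨_, hle (Finset.Iio i)⟩ : unitInterval) ⟨_, hle (Finset.Iic i)⟩ := by
    -- The seed 0 lies in none of the half-open intervals, but it is a null set.
    have h0 : ∀ᵐ u : unitInterval, u ≠ 0 := by
      rw [ae_iff]
      simp
    filter_upwards [h0] with u hu
    have hu0 : (0 : ℝ) < u := lt_of_le_of_ne u.2.1 fun h => hu (Subtype.ext h.symm)
    exact propext (sampleArm_eq_iff hp hp1 hu0 u.2.2 i)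
  rw [measure_congr h1, unitInterval.volume_Ioc]
  congr 1
  have h2 : Finset.Iic i = insert i (Finset.Iio i) := (Finset.Iio_insert i).symm
  simp only [h2, Finset.sum_insert Finset.notMem_Iio_self]
  ring

theorem measurableSet_sampleArm_eq (p : Fin k → ℝ) (i : Fin k) :
    MeasurableSet {u : unitInterval | sampleArm p u = i} :=
  (measurable_sampleArm.comp ((measurable_const (a := p)).prodMk measurable_subtype_coe))
    (MeasurableSet.singleton i)

theorem lintegral_ite_sampleArm {p : Fin k → ℝ} (hp : ∀ i, 0 ≤ p i) (hp1 : ∑ i, p i = 1)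
    (i : Fin k) (A B : ℝ≥0∞) :
    ∫⁻ u : unitInterval, (if sampleArm p u = i then A else B) =
      ENNReal.ofReal (p i) * A + ENNReal.ofReal (1 - p i) * B := by
  have hm := measurableSet_sampleArm_eq p i
  rw [← lintegral_add_compl _ hm]
  congr 1
  · have e : Set.EqOn (fun u : unitInterval => if sampleArm p u = i then A else B) (fun _ => A)
        {u | sampleArm p u = i} := fun u hu => if_pos hu
    rw [setLIntegral_congr_fun hm e, setLIntegral_const,
      volume_sampleArm_eq hp hp1, mul_comm]
  · have e : Set.EqOn (fun u : unitInterval => if sampleArm p u = i then A else B) (fun _ => B)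
        {u | sampleArm p u = i}ᶜ := fun u hu => if_neg hu
    rw [setLIntegral_congr_fun hm.compl e,
      setLIntegral_const, prob_compl_eq_one_sub hm, volume_sampleArm_eq hp hp1, mul_comm,
      ENNReal.ofReal_sub _ (hp i), ENNReal.ofReal_one]

end SampleArm

/-! ### The run of Active Sampling with Exploration -/

section Run

variable {T k : ℕ} [NeZero k] {M : ℝ}

/-- The randomness of the algorithm together with the realization of the environment. -/
abbrev Sample (T k : ℕ) : Type := (Fin T → unitInterval) × Realization T k

/-- The joint law of the randomness of the algorithm and of the realization. -/
noncomputable def sampleMeasure (T : ℕ) {k : ℕ} (ν : Environment k) : Measure (Sample T k) :=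
  (Measure.pi fun _ : Fin T => (volume : Measure unitInterval)).prod (realizationMeasure T ν)

instance (ν : Environment k) : IsProbabilityMeasure (realizationMeasure T ν) := by
  unfold realizationMeasure
  infer_instance

instance (ν : Environment k) : IsProbabilityMeasure (sampleMeasure T ν) := by
  unfold sampleMeasure
  infer_instance

/-- The arm played at the time-step `t + 1`. -/
noncomputable def arm (M : ℝ) (z : Sample T k) (t : Fin T) : Fin k := (ase T k M).action z.1 z.2 t

/-- The history before the time-step `t + 1`. -/
noncomputable def hist (M : ℝ) (z : Sample T k) (t : Fin T) : History k t :=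
  (ase T k M).history z.1 z.2 t

omit [NeZero k] in
theorem Policy.action_eq (π : Policy T k) (ω : π.Ω) (w : Realization T k) (t : Fin T) :
    π.action ω w t = π.act t ω (π.history ω w t) := by
  rw [Policy.action]
  rfl

theorem arm_eq (z : Sample T k) (t : Fin T) : arm M z t = aseArm M t z.1 (hist M z t) :=
  (ase T k M).action_eq z.1 z.2 t

theorem hist_apply (z : Sample T k) (t : Fin T) (s : Fin t) :
    hist M z t s = (arm M z ⟨s, s.2.trans t.2⟩,
      z.2 ⟨s, s.2.trans t.2⟩ (arm M z ⟨s, s.2.trans t.2⟩)) := rfl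

theorem hist_congr_of_arm {z z' : Sample T k} {t : Fin T}
    (h : ∀ s : Fin T, s < t → arm M z s = arm M z' s) (h2 : ∀ s : Fin T, s < t → z.2 s = z'.2 s) :
    hist M z t = hist M z' t := by
  funext s
  rw [hist_apply, hist_apply, h ⟨s, s.2.trans t.2⟩ s.2, h2 ⟨s, s.2.trans t.2⟩ s.2]

theorem aseArm_congr {t : Fin T} {ω ω' : Fin T → unitInterval} (h : ω t = ω' t)
    (g : History k t) : aseArm M t ω g = aseArm M t ω' g := by
  simp only [aseArm, h]

/-- Causality: the arm depends on seeds up to its own time but on rewards only from strictly earlier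
times. Hence resampling the rewards of a time-step leaves its arm unchanged, and resampling its seed
leaves its history unchanged. -/
theorem arm_congr {z z' : Sample T k} {t : Fin T} (h1 : ∀ s : Fin T, s ≤ t → z.1 s = z'.1 s)
    (h2 : ∀ s : Fin T, s < t → z.2 s = z'.2 s) : arm M z t = arm M z' t := by
  induction t using WellFoundedLT.induction with
  | ind t ih =>
    rw [arm_eq, arm_eq, hist_congr_of_arm (z' := z') (fun _ hs => ih _ hs
      (fun u hu => h1 u (hu.trans hs.le)) fun u hu => h2 u (hu.trans hs)) h2]
    exact aseArm_congr (h1 t le_rfl) _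

theorem hist_congr {z z' : Sample T k} {t : Fin T} (h1 : ∀ s : Fin T, s < t → z.1 s = z'.1 s)
    (h2 : ∀ s : Fin T, s < t → z.2 s = z'.2 s) : hist M z t = hist M z' t :=
  hist_congr_of_arm (fun _ hs => arm_congr (fun u hu => h1 u (hu.trans_lt hs))
    fun u hu => h2 u (hu.trans hs)) h2

omit [NeZero k] in
theorem measurable_reward (t : Fin T) (i : Fin k) : Measurable fun z : Sample T k => z.2 t i :=
  (measurable_pi_apply i).comp ((measurable_pi_apply t).comp measurable_snd)

theorem measurable_hist_of_arm {t : Fin T}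
    (h : ∀ s : Fin T, s < t → Measurable fun z : Sample T k => arm M z s) :
    Measurable fun z : Sample T k => hist M z t := by
  refine measurable_pi_lambda _ fun s => ?_
  have hs := h ⟨s, s.2.trans t.2⟩ s.2
  simp only [hist_apply]
  refine hs.prodMk ?_
  have h1 : Measurable fun z : Fin k × Realization T k => z.2 ⟨s, s.2.trans t.2⟩ z.1 :=
    measurable_from_prod_countable_right fun i =>
      (measurable_pi_apply i).comp (measurable_pi_apply _)
  exact h1.comp (hs.prodMk measurable_snd)

theorem measurable_arm (t : Fin T) : Measurable fun z : Sample T k => arm M z t := by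
  induction t using WellFoundedLT.induction with
  | ind t ih =>
    have h1 : Measurable fun z : Sample T k => (z.1, hist M z t) :=
      measurable_fst.prodMk (measurable_hist_of_arm ih)
    have h2 := Measurable.comp (f := fun z : Sample T k => (z.1, hist M z t))
      (measurable_aseArm t M) h1
    have h3 : (fun z : Sample T k => arm M z t) =
        (fun y : (Fin T → unitInterval) × History k t => aseArm M t y.1 y.2) ∘
          fun z : Sample T k => (z.1, hist M z t) := funext fun z => arm_eq z t
    rw [h3]
    exact h2

theorem measurable_hist (t : Fin T) : Measurable fun z : Sample T k => hist M z t :=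
  measurable_hist_of_arm fun s _ => measurable_arm s

/-- The conditional probability of playing arm `i` at the time-step `t + 1` after the history
`h`. -/
noncomputable def armProb (M : ℝ) (t : Fin T) (h : History k t) (i : Fin k) : ℝ :=
  if ((t : ℕ) + 1 : ℝ) ≤ M * k then (if ((t : ℕ) + 1) % k = i then 1 else 0)
  else softmax (rewardEstimate h) i

theorem armProb_nonneg (t : Fin T) (h : History k t) (i : Fin k) : 0 ≤ armProb M t h i := by
  unfold armProb
  split_ifs
  · exact zero_le_one
  · exact le_rfl
  · exact (softmax_pos _ i).le

theorem armProb_le_one (t : Fin T) (h : History k t) (i : Fin k) : armProb M t h i ≤ 1 := by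
  unfold armProb
  split_ifs
  · exact le_rfl
  · exact zero_le_one
  · exact softmax_le_one _ i

theorem sum_armProb (t : Fin T) (h : History k t) : ∑ i, armProb M t h i = 1 := by
  unfold armProb
  split_ifs
  · have e : ∀ i : Fin k, (((t : ℕ) + 1) % k = i ↔
        (⟨((t : ℕ) + 1) % k, Nat.mod_lt _ (NeZero.pos k)⟩ : Fin k) = i) := fun i => by
      rw [Fin.ext_iff]
    simp only [e, Finset.sum_ite_eq, Finset.mem_univ, if_true]
  · exact sum_softmax _

omit [NeZero k] in
theorem measurable_armProb (t : Fin T) (i : Fin k) :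
    Measurable fun h : History k t => armProb M t h i := by
  unfold armProb
  split_ifs
  · exact measurable_const
  · exact measurable_const
  · exact (measurable_pi_apply i).comp (measurable_softmax.comp
      (measurable_pi_lambda _ fun j => measurable_rewardEstimate j))

theorem lintegral_ite_aseArm (t : Fin T) (ω : Fin T → unitInterval) (h : History k t)
    (i : Fin k) (A B : ℝ≥0∞) :
    ∫⁻ u : unitInterval, (if aseArm M t (Function.update ω t u) h = i then A else B) =
      ENNReal.ofReal (armProb M t h i) * A + ENNReal.ofReal (1 - armProb M t h i) * B := by
  by_cases hc : ((t : ℕ) + 1 : ℝ) ≤ M * k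
  · simp only [aseArm, armProb, hc, if_true, Fin.ext_iff]
    split_ifs <;> simp
  · simp only [aseArm, armProb, hc, if_false, Function.update_self]
    exact lintegral_ite_sampleArm (fun j => (softmax_pos _ j).le) (sum_softmax _) i A B

/-- The conditional probability of playing arm `i` at the time-step `t + 1`. -/
noncomputable def condProb (M : ℝ) (z : Sample T k) (t : Fin T) (i : Fin k) : ℝ :=
  armProb M t (hist M z t) i

theorem measurable_condProb (t : Fin T) (i : Fin k) :
    Measurable fun z : Sample T k => condProb M z t i :=
  (measurable_armProb t i).comp (measurable_hist t)

/-- Replace the randomness of the algorithm at the time-step `t + 1`. -/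
def updateSeed (z : Sample T k) (t : Fin T) (u : unitInterval) : Sample T k :=
  (Function.update z.1 t u, z.2)

/-- Replace the rewards at the time-step `t + 1`. -/
def updateReward (z : Sample T k) (t : Fin T) (x : Fin k → ℝ) : Sample T k :=
  (z.1, Function.update z.2 t x)

omit [NeZero k] in
theorem lintegral_updateSeed (ν : Environment k) {F : Sample T k → ℝ≥0∞} (hF : Measurable F)
    (t : Fin T) : ∫⁻ z, F z ∂sampleMeasure T ν =
      ∫⁻ z, ∫⁻ u, F (updateSeed z t u) ∂volume ∂sampleMeasure T ν := by
  have hG : Measurable fun z : Sample T k => ∫⁻ u, F (updateSeed z t u) ∂volume := by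
    refine Measurable.lintegral_prod_right (f := fun (z : Sample T k) (u : unitInterval) =>
      F (updateSeed z t u)) (hF.comp ?_)
    exact (measurable_update'.comp ((measurable_fst.comp measurable_fst).prodMk measurable_snd)).prodMk
      (measurable_snd.comp measurable_fst)
  rw [sampleMeasure, lintegral_prod_symm _ hF.aemeasurable, lintegral_prod_symm _ hG.aemeasurable]
  refine lintegral_congr fun w => ?_
  exact lintegral_pi_eq_lintegral_update _ (hF.comp (measurable_id.prodMk measurable_const)) t

omit [NeZero k] in
theorem lintegral_updateReward (ν : Environment k) {F : Sample T k → ℝ≥0∞} (hF : Measurable F)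
    (t : Fin T) : ∫⁻ z, F z ∂sampleMeasure T ν =
      ∫⁻ z, ∫⁻ x, F (updateReward z t x) ∂(Measure.pi fun i : Fin k => (ν i : Measure ℝ))
        ∂sampleMeasure T ν := by
  have hG : Measurable fun z : Sample T k =>
      ∫⁻ x, F (updateReward z t x) ∂(Measure.pi fun i : Fin k => (ν i : Measure ℝ)) := by
    refine Measurable.lintegral_prod_right (f := fun (z : Sample T k) (x : Fin k → ℝ) =>
      F (updateReward z t x)) (hF.comp ?_)
    exact (measurable_fst.comp measurable_fst).prodMk
      (measurable_update'.comp ((measurable_snd.comp measurable_fst).prodMk measurable_snd))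
  rw [sampleMeasure, lintegral_prod _ hF.aemeasurable, lintegral_prod _ hG.aemeasurable]
  refine lintegral_congr fun ω => ?_
  exact lintegral_pi_eq_lintegral_update _ (hF.comp (measurable_const.prodMk measurable_id)) t

theorem arm_updateSeed_of_lt {s t : Fin T} (hst : s < t) (z : Sample T k) (u : unitInterval) :
    arm M (updateSeed z t u) s = arm M z s :=
  arm_congr (fun _ hr => Function.update_of_ne (hr.trans_lt hst).ne _ _) fun _ _ => rfl

theorem hist_updateSeed {s t : Fin T} (hst : s ≤ t) (z : Sample T k) (u : unitInterval) :
    hist M (updateSeed z t u) s = hist M z s :=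
  hist_congr (fun _ hr => Function.update_of_ne (hr.trans_le hst).ne _ _) fun _ _ => rfl

theorem arm_updateSeed_self (t : Fin T) (z : Sample T k) (u : unitInterval) :
    arm M (updateSeed z t u) t = aseArm M t (Function.update z.1 t u) (hist M z t) := by
  rw [arm_eq, hist_updateSeed le_rfl]
  rfl

theorem condProb_updateSeed {s t : Fin T} (hst : s ≤ t) (z : Sample T k) (u : unitInterval)
    (i : Fin k) : condProb M (updateSeed z t u) s i = condProb M z s i := by
  rw [condProb, hist_updateSeed hst, condProb]

theorem arm_updateReward {s t : Fin T} (hst : s ≤ t) (z : Sample T k) (x : Fin k → ℝ) :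
    arm M (updateReward z t x) s = arm M z s :=
  arm_congr (fun _ _ => rfl) fun _ hr => Function.update_of_ne (hr.trans_le hst).ne _ _

/-- The one-step law of the algorithm: given the past, integrating over the current seed replaces
the choice of arm by its conditional probability. -/
theorem lintegral_ite_arm (t : Fin T) (z : Sample T k) (i : Fin k) (A B : ℝ≥0∞) :
    ∫⁻ u, (if arm M (updateSeed z t u) t = i then A else B) ∂volume =
      ENNReal.ofReal (condProb M z t i) * A + ENNReal.ofReal (1 - condProb M z t i) * B := by
  simp only [arm_updateSeed_self]
  exact lintegral_ite_aseArm t z.1 (hist M z t) i A B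

/-! ### Partial sums over time -/

/-- The sum of `f` over the first `n` time-steps. -/
def sumUpTo (f : Fin T → ℝ) (n : ℕ) : ℝ := ∑ s with s.val < n, f s

theorem sumUpTo_zero (f : Fin T → ℝ) : sumUpTo f 0 = 0 := by
  simp [sumUpTo]

theorem sumUpTo_succ (f : Fin T → ℝ) {n : ℕ} (hn : n < T) :
    sumUpTo f (n + 1) = sumUpTo f n + f ⟨n, hn⟩ := by
  have h : (Finset.univ.filter fun s : Fin T => s.val < n + 1) =
      insert ⟨n, hn⟩ (Finset.univ.filter fun s : Fin T => s.val < n) := by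
    ext s
    simp only [Finset.mem_filter, Finset.mem_univ, true_and, Finset.mem_insert, Fin.ext_iff]
    omega
  rw [sumUpTo, sumUpTo, h, Finset.sum_insert (by simp), add_comm]

theorem sumUpTo_congr {f g : Fin T → ℝ} {n : ℕ} (h : ∀ s : Fin T, s.val < n → f s = g s) :
    sumUpTo f n = sumUpTo g n :=
  Finset.sum_congr rfl fun s hs => h s (Finset.mem_filter.1 hs).2

omit [NeZero k] in
theorem measurable_sumUpTo {f : Sample T k → Fin T → ℝ} (hf : ∀ s, Measurable fun z => f z s)
    (n : ℕ) : Measurable fun z => sumUpTo (f z) n :=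
  Finset.measurable_sum _ fun s _ => hf s

/-- The number of plays of arm `i` in the first `n` time-steps. -/
noncomputable def plays (M : ℝ) (z : Sample T k) (n : ℕ) (i : Fin k) : ℝ :=
  sumUpTo (fun s => if arm M z s = i then 1 else 0) n

/-- The sum of the noise of the plays of arm `i` in the first `n` time-steps. -/
noncomputable def noise (M : ℝ) (ν : Environment k) (z : Sample T k) (n : ℕ) (i : Fin k) : ℝ :=
  sumUpTo (fun s => if arm M z s = i then z.2 s i - meanReward ν i else 0) n

/-- The sum of the conditional probabilities of arm `i` in the first `n` time-steps. -/
noncomputable def drift (M : ℝ) (z : Sample T k) (n : ℕ) (i : Fin k) : ℝ :=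
  sumUpTo (fun s => condProb M z s i) n

theorem measurableSet_arm_eq (t : Fin T) (i : Fin k) :
    MeasurableSet {z : Sample T k | arm M z t = i} :=
  measurable_arm t (MeasurableSet.singleton i)

theorem measurable_plays (n : ℕ) (i : Fin k) : Measurable fun z : Sample T k => plays M z n i :=
  measurable_sumUpTo (fun s => Measurable.ite (measurableSet_arm_eq s i) measurable_const
    measurable_const) n

theorem measurable_drift (n : ℕ) (i : Fin k) : Measurable fun z : Sample T k => drift M z n i :=
  measurable_sumUpTo (fun s => measurable_condProb s i) n

theorem plays_nonneg (z : Sample T k) (n : ℕ) (i : Fin k) : 0 ≤ plays M z n i := by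
  unfold plays sumUpTo
  positivity

theorem plays_eq_card (z : Sample T k) (n : ℕ) (i : Fin k) :
    plays M z n i =
      ((Finset.univ.filter fun s : Fin T => s.val < n ∧ arm M z s = i).card : ℝ) := by
  rw [plays, sumUpTo, ← Finset.sum_filter, Finset.filter_filter, Finset.sum_const, nsmul_eq_mul,
    mul_one]

theorem card_filter_val_lt {n : ℕ} (hn : n ≤ T) :
    (Finset.univ.filter fun s : Fin T => s.val < n).card = n := by
  rw [Fin.card_filter_val_lt, min_eq_right hn]

theorem plays_le {n : ℕ} (hn : n ≤ T) (z : Sample T k) (i : Fin k) : plays M z n i ≤ n := by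
  rw [plays_eq_card]
  refine Nat.cast_le.2 ((Finset.card_le_card ?_).trans (card_filter_val_lt hn).le)
  intro s hs
  rw [Finset.mem_filter] at hs ⊢
  exact ⟨hs.1, hs.2.1⟩

theorem sum_plays {n : ℕ} (hn : n ≤ T) (z : Sample T k) : ∑ i, plays M z n i = n := by
  simp only [plays, sumUpTo]
  rw [Finset.sum_comm]
  simp [Finset.sum_const, card_filter_val_lt hn]

end Run

/-! ### Exponential supermartingales and the second moment of the play counts -/

section Supermartingale

variable {T k : ℕ} {M : ℝ}

/-- The supermartingale induction: resampling the source of the last increment leaves earlier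
increments alone, so their exponential factors out and the rest integrates to at most 1. The map
`upd` is abstract since it stands for rewards in `upperMean_exp_noise` and for seeds in
`upperMean_exp_drift`. -/
theorem lintegral_exp_sumUpTo_le_one {Z β : Type*} [MeasurableSpace Z] [MeasurableSpace β]
    {μ : Measure Z} [IsProbabilityMeasure μ] {ρ : Measure β} {upd : Fin T → Z → β → Z}
    (hupd : ∀ t z, Measurable (upd t z))
    (hint : ∀ t (F : Z → ℝ≥0∞), Measurable F → ∫⁻ z, F z ∂μ = ∫⁻ z, ∫⁻ y, F (upd t z y) ∂ρ ∂μ)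
    {Y : Z → Fin T → ℝ} (hY : ∀ s, Measurable fun z => Y z s)
    (hpast : ∀ s t, s < t → ∀ z y, Y (upd t z y) s = Y z s)
    (hone : ∀ t z, ∫⁻ y, ENNReal.ofReal (Real.exp (Y (upd t z y) t)) ∂ρ ≤ 1)
    {n : ℕ} (hn : n ≤ T) : ∫⁻ z, ENNReal.ofReal (Real.exp (sumUpTo (Y z) n)) ∂μ ≤ 1 := by
  have hms : ∀ n, Measurable fun z => sumUpTo (Y z) n := fun n =>
    Finset.measurable_sum _ fun s _ => hY s
  induction n with
  | zero => simp [sumUpTo_zero]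
  | succ n ih =>
    have hn' : n < T := hn
    refine le_trans ?_ (ih hn'.le)
    rw [hint ⟨n, hn'⟩ _ (hms (n + 1)).exp.ennreal_ofReal]
    refine lintegral_mono fun z => ?_
    have h1 : ∀ y, ENNReal.ofReal (Real.exp (sumUpTo (Y (upd ⟨n, hn'⟩ z y)) (n + 1))) =
        ENNReal.ofReal (Real.exp (sumUpTo (Y z) n)) *
          ENNReal.ofReal (Real.exp (Y (upd ⟨n, hn'⟩ z y) ⟨n, hn'⟩)) := by
      intro y
      rw [sumUpTo_succ _ hn', sumUpTo_congr fun s hs => hpast s ⟨n, hn'⟩ hs z y, Real.exp_add,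
        ENNReal.ofReal_mul (Real.exp_pos _).le]
    simp only [h1]
    have h2 : Measurable fun y =>
        ENNReal.ofReal (Real.exp (Y (upd ⟨n, hn'⟩ z y) ⟨n, hn'⟩)) :=
      ((hY ⟨n, hn'⟩).comp (hupd ⟨n, hn'⟩ z)).exp.ennreal_ofReal
    rw [lintegral_const_mul _ h2]
    exact mul_le_of_le_one_right' (hone _ z)

theorem measurable_updateSeed (t : Fin T) (z : Sample T k) : Measurable (updateSeed z t) :=
  (measurable_update _).prodMk measurable_const

theorem measurable_updateReward (t : Fin T) (z : Sample T k) : Measurable (updateReward z t) :=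
  measurable_const.prodMk (measurable_update _)

theorem lintegral_exp_subgaussian_le_one {σ : ℝ≥0} {ν : Environment k} (hν : IsSubgaussianEnv σ ν)
    (i : Fin k) (c : ℝ) :
    ∫⁻ x, ENNReal.ofReal (Real.exp (c * (x - meanReward ν i) - c ^ 2 * (σ : ℝ) ^ 2 / 2))
      ∂(ν i : Measure ℝ) ≤ 1 := by
  have h1 := (hν i).integrable_exp_mul c
  have h2 := (hν i).mgf_le c
  have e : ∀ x, Real.exp (c * (x - meanReward ν i) - c ^ 2 * (σ : ℝ) ^ 2 / 2) =
      Real.exp (c * (x - meanReward ν i)) * Real.exp (-(c ^ 2 * (σ : ℝ) ^ 2 / 2)) := by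
    intro x
    rw [← Real.exp_add]
    congr 1
  simp only [e]
  rw [← ofReal_integral_eq_lintegral_ofReal (h1.mul_const _)
    (Filter.Eventually.of_forall fun x => by positivity), integral_mul_const, ← ENNReal.ofReal_one]
  refine ENNReal.ofReal_le_ofReal ?_
  calc (∫ x, Real.exp (c * (x - meanReward ν i)) ∂(ν i : Measure ℝ)) *
        Real.exp (-(c ^ 2 * (σ : ℝ) ^ 2 / 2))
      ≤ Real.exp ((σ ^ 2 : ℝ≥0) * c ^ 2 / 2) * Real.exp (-(c ^ 2 * (σ : ℝ) ^ 2 / 2)) :=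
        mul_le_mul_of_nonneg_right h2 (Real.exp_pos _).le
    _ = 1 := by
        rw [← Real.exp_add, Real.exp_eq_one_iff]
        push_cast
        ring

variable [NeZero k]

/-- The arm at time `t` is fixed before the rewards at `t` are resampled. If it is `i`, the
increment has exponential mean at most 1 by subgaussianity; otherwise the increment is 0. -/
theorem upperMean_exp_noise {σ : ℝ≥0} {ν : Environment k} (hν : IsSubgaussianEnv σ ν)
    (i : Fin k) (c : ℝ) {n : ℕ} (hn : n ≤ T) :
    UpperMean (sampleMeasure T ν)
      (fun z => Real.exp (c * noise M ν z n i - c ^ 2 * (σ : ℝ) ^ 2 / 2 * plays M z n i)) 1 := by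
  set Y : Sample T k → Fin T → ℝ := fun z s =>
    if arm M z s = i then c * (z.2 s i - meanReward ν i) - c ^ 2 * (σ : ℝ) ^ 2 / 2 else 0 with hYdef
  have hY : ∀ s, Measurable fun z => Y z s := fun s =>
    Measurable.ite (measurableSet_arm_eq s i)
      ((((measurable_reward s i).sub_const _).const_mul c).sub_const _) measurable_const
  have hsum : ∀ z, c * noise M ν z n i - c ^ 2 * (σ : ℝ) ^ 2 / 2 * plays M z n i =
      sumUpTo (Y z) n := by
    intro z
    simp only [noise, plays, sumUpTo, Finset.mul_sum, ← Finset.sum_sub_distrib, hYdef]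
    refine Finset.sum_congr rfl fun s _ => ?_
    split_ifs <;> ring
  simp only [hsum]
  refine UpperMean.of_lintegral (Finset.measurable_sum _ fun s _ => hY s).exp
    (fun z => (Real.exp_pos _).le) zero_le_one ?_
  rw [ENNReal.ofReal_one]
  refine lintegral_exp_sumUpTo_le_one (upd := fun t z x => updateReward z t x)
    (ρ := Measure.pi fun i : Fin k => (ν i : Measure ℝ))
    (fun t z => measurable_updateReward t z)
    (fun t F hF => lintegral_updateReward ν hF t) hY ?_ ?_ hn
  · intro s t hst z x
    simp only [hYdef, arm_updateReward hst.le]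
    simp only [updateReward, Function.update_of_ne hst.ne]
  · intro t z
    simp only [hYdef, arm_updateReward le_rfl]
    by_cases h : arm M z t = i
    · simp only [h, if_true, updateReward, Function.update_self]
      have hm : Measurable fun x : ℝ =>
          ENNReal.ofReal (Real.exp (c * (x - meanReward ν i) - c ^ 2 * (σ : ℝ) ^ 2 / 2)) := by
        fun_prop
      have := (measurePreserving_eval (fun i : Fin k => (ν i : Measure ℝ)) i).lintegral_comp hm
      simp only [Function.eval] at this
      rw [this]
      exact lintegral_exp_subgaussian_le_one hν i c
    · simp [h]

/-- The left side is the mean of `exp (c / 2 - X)` for a Bernoulli variable `X` of mean `c`. Since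
`exp (-1) ≤ 1 / 2`, it is at most `exp (c / 2) * (1 - c / 2)`, which is at most 1. -/
theorem exp_half_sub_le_one {c : ℝ} (h0 : 0 ≤ c) :
    c * Real.exp (c / 2 - 1) + (1 - c) * Real.exp (c / 2) ≤ 1 := by
  have h2 : Real.exp (c / 2 - 1) ≤ Real.exp (c / 2) * (1 / 2) := by
    rw [sub_eq_add_neg, Real.exp_add]
    refine mul_le_mul_of_nonneg_left ?_ (Real.exp_pos _).le
    rw [Real.exp_neg, ← one_div]
    exact one_div_le_one_div_of_le two_pos (by linarith [Real.add_one_le_exp (1 : ℝ)])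
  have h3 : 1 - c / 2 ≤ Real.exp (-(c / 2)) := by linarith [Real.add_one_le_exp (-(c / 2))]
  have h4 : Real.exp (c / 2) * Real.exp (-(c / 2)) = 1 := by
    rw [← Real.exp_add]; simp
  have h5 := mul_le_mul_of_nonneg_left h2 h0
  have h6 := mul_le_mul_of_nonneg_left h3 (Real.exp_pos (c / 2)).le
  linarith

theorem condProb_nonneg (z : Sample T k) (t : Fin T) (i : Fin k) : 0 ≤ condProb M z t i :=
  armProb_nonneg _ _ _

theorem condProb_le_one (z : Sample T k) (t : Fin T) (i : Fin k) : condProb M z t i ≤ 1 :=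
  armProb_le_one _ _ _

theorem upperMean_exp_drift (ν : Environment k) (i : Fin k) {n : ℕ} (hn : n ≤ T) :
    UpperMean (sampleMeasure T ν) (fun z => Real.exp (drift M z n i / 2 - plays M z n i)) 1 := by
  set Y : Sample T k → Fin T → ℝ := fun z s =>
    condProb M z s i / 2 - (if arm M z s = i then 1 else 0) with hYdef
  have hY : ∀ s, Measurable fun z => Y z s := fun s =>
    ((measurable_condProb s i).div_const 2).sub
      (Measurable.ite (measurableSet_arm_eq s i) measurable_const measurable_const)
  have hsum : ∀ z, drift M z n i / 2 - plays M z n i = sumUpTo (Y z) n := by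
    intro z
    simp only [drift, plays, sumUpTo, Finset.sum_div, ← Finset.sum_sub_distrib, hYdef]
  simp only [hsum]
  refine UpperMean.of_lintegral (Finset.measurable_sum _ fun s _ => hY s).exp
    (fun z => (Real.exp_pos _).le) zero_le_one ?_
  rw [ENNReal.ofReal_one]
  refine lintegral_exp_sumUpTo_le_one (upd := fun t z u => updateSeed z t u) (ρ := volume)
    (fun t z => measurable_updateSeed t z)
    (fun t F hF => lintegral_updateSeed ν hF t) hY ?_ ?_ hn
  · intro s t hst z u
    simp only [hYdef, arm_updateSeed_of_lt hst, condProb_updateSeed hst.le]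
  · intro t z
    set c := condProb M z t i with hc
    have h1 : ∀ u, ENNReal.ofReal (Real.exp (Y (updateSeed z t u) t)) =
        if arm M (updateSeed z t u) t = i then ENNReal.ofReal (Real.exp (c / 2 - 1))
          else ENNReal.ofReal (Real.exp (c / 2)) := by
      intro u
      simp only [hYdef, condProb_updateSeed le_rfl, ← hc]
      split_ifs <;> simp
    have hc0 : 0 ≤ c := condProb_nonneg z t i
    have hc1 : 0 ≤ 1 - c := sub_nonneg.2 (condProb_le_one z t i)
    simp only [h1]
    rw [lintegral_ite_arm, ← hc, ← ENNReal.ofReal_mul hc0, ← ENNReal.ofReal_mul hc1,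
      ← ENNReal.ofReal_add (by positivity) (by positivity)]
    exact ENNReal.ofReal_le_one.2 (exp_half_sub_le_one hc0)

/-- The difference of plays and drift is a martingale: averaging over the current seed cancels the
cross terms, and the square grows by the Bernoulli variance `c * (1 - c) ≤ 1` per step. -/
theorem lintegral_sq_plays_sub_drift_le (ν : Environment k) (i : Fin k) {n : ℕ} (hn : n ≤ T) :
    ∫⁻ z, ENNReal.ofReal ((plays M z n i - drift M z n i) ^ 2) ∂sampleMeasure T ν ≤ n := by
  have hm : ∀ n, Measurable fun z : Sample T k => (plays M z n i - drift M z n i) ^ 2 := fun n =>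
    ((measurable_plays n i).sub (measurable_drift n i)).pow_const 2
  induction n with
  | zero => simp [plays, drift, sumUpTo_zero]
  | succ n ih =>
    have hn' : n < T := hn
    set t : Fin T := ⟨n, hn'⟩ with ht
    rw [lintegral_updateSeed ν (hm (n + 1)).ennreal_ofReal t]
    have key : ∀ z : Sample T k,
        ∫⁻ u, ENNReal.ofReal ((plays M (updateSeed z t u) (n + 1) i -
          drift M (updateSeed z t u) (n + 1) i) ^ 2) ∂volume ≤
        ENNReal.ofReal ((plays M z n i - drift M z n i) ^ 2) + 1 := by
      intro z
      set c := condProb M z t i with hc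
      set y := plays M z n i - drift M z n i with hy
      have h1 : ∀ u, ENNReal.ofReal ((plays M (updateSeed z t u) (n + 1) i -
          drift M (updateSeed z t u) (n + 1) i) ^ 2) =
          if arm M (updateSeed z t u) t = i then ENNReal.ofReal ((y + (1 - c)) ^ 2)
            else ENNReal.ofReal ((y - c) ^ 2) := by
        intro u
        have h2 : plays M (updateSeed z t u) (n + 1) i =
            plays M z n i + if arm M (updateSeed z t u) t = i then 1 else 0 := by
          rw [plays, sumUpTo_succ _ hn', plays, sumUpTo_congr fun s hs => ?_]
          rw [arm_updateSeed_of_lt (t := t) hs]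
        have h3 : drift M (updateSeed z t u) (n + 1) i = drift M z n i + c := by
          rw [drift, sumUpTo_succ _ hn', drift, sumUpTo_congr fun s hs => ?_,
            condProb_updateSeed le_rfl]
          rw [condProb_updateSeed (t := t) (le_of_lt hs)]
        rw [h2, h3]
        split_ifs
        · congr 1; rw [hy]; ring
        · congr 1; rw [hy]; ring
      have hc0 : 0 ≤ c := condProb_nonneg z t i
      have hc1 : 0 ≤ 1 - c := sub_nonneg.2 (condProb_le_one z t i)
      simp only [h1]
      rw [lintegral_ite_arm, ← hc, ← ENNReal.ofReal_mul hc0, ← ENNReal.ofReal_mul hc1,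
        ← ENNReal.ofReal_add (by positivity) (by positivity), ← ENNReal.ofReal_one,
        ← ENNReal.ofReal_add (by positivity) (by positivity)]
      exact ENNReal.ofReal_le_ofReal (by nlinarith)
    calc _ ≤ ∫⁻ z, (ENNReal.ofReal ((plays M z n i - drift M z n i) ^ 2) + 1)
            ∂sampleMeasure T ν := lintegral_mono key
      _ ≤ n + 1 := by
          rw [lintegral_add_right _ measurable_const]
          simpa using ih hn'.le
      _ = _ := by push_cast; rfl

theorem upperMean_sq_plays_sub_drift (ν : Environment k) (i : Fin k) {n : ℕ} (hn : n ≤ T) :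
    UpperMean (sampleMeasure T ν) (fun z => (plays M z n i - drift M z n i) ^ 2) n := by
  refine UpperMean.of_lintegral (((measurable_plays n i).sub (measurable_drift n i)).pow_const 2)
    (fun z => sq_nonneg _) (Nat.cast_nonneg n) ?_
  rw [ENNReal.ofReal_natCast]
  exact lintegral_sq_plays_sub_drift_le ν i hn

theorem upperMean_noise_pow_four {σ : ℝ≥0} (hσ : 0 < σ) {ν : Environment k}
    (hν : IsSubgaussianEnv σ ν) (i : Fin k) (hT : 0 < T) {n : ℕ} (hn : n ≤ T) :
    UpperMean (sampleMeasure T ν) (fun z => noise M ν z n i ^ 4) (96 * (σ : ℝ) ^ 4 * T ^ 2) := by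
  have hσ' : (0 : ℝ) < σ := hσ
  have hT' : (0 : ℝ) < T := by exact_mod_cast hT
  -- With this tilt `c ^ 2 * σ ^ 2 * T = 1`, so the compensator is at most `1 / 2` whatever the
  -- number of plays. The fourth power is then at most `4!` times an exponential, and 96 is twice
  -- `24 * 2`.
  set c : ℝ := 1 / (σ * √T) with hc
  have hsq : √(T : ℝ) ^ 2 = T := Real.sq_sqrt hT'.le
  have hc0 : 0 < c := by positivity
  have hc2 : c ^ 2 * (σ : ℝ) ^ 2 * T = 1 := by
    rw [hc, div_pow, mul_pow, hsq]
    field_simp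
  have h1 := ((upperMean_exp_noise (M := M) hν i c hn).add
    (upperMean_exp_noise (M := M) hν i (-c) hn)).const_mul
      (show 0 ≤ 48 * (σ : ℝ) ^ 4 * T ^ 2 by positivity)
  refine (h1.mono fun z => ?_).le_bound (by linarith)
  set S := noise M ν z n i
  set N := plays M z n i
  have hN : N ≤ T := (plays_le hn z i).trans (by exact_mod_cast hn)
  have h2 : c ^ 2 * (σ : ℝ) ^ 2 / 2 * N ≤ 1 / 2 := by
    have := mul_le_mul_of_nonneg_left hN (show 0 ≤ c ^ 2 * (σ : ℝ) ^ 2 by positivity)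
    linarith
  have h3 : Real.exp (1 / 2) ≤ 2 := by
    have h4 : Real.exp (1 / 2) ^ 2 = Real.exp 1 := by
      rw [← Real.exp_nat_mul]; norm_num
    nlinarith [Real.exp_one_lt_d9, Real.exp_pos (1 / 2 : ℝ)]
  have h5 : ∀ x : ℝ, Real.exp x ≤ 2 * Real.exp (x - c ^ 2 * (σ : ℝ) ^ 2 / 2 * N) := by
    intro x
    calc Real.exp x ≤ Real.exp (1 / 2 + (x - c ^ 2 * (σ : ℝ) ^ 2 / 2 * N)) :=
          Real.exp_le_exp.2 (by linarith)
      _ ≤ _ := by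
          rw [Real.exp_add]
          exact mul_le_mul_of_nonneg_right h3 (Real.exp_pos _).le
  have h6 : (c * S) ^ 4 ≤ 24 * (Real.exp (c * S) + Real.exp (-c * S)) := by
    have h7 := Real.pow_div_factorial_le_exp _ (abs_nonneg (c * S)) 4
    have h8 : |c * S| ^ 4 = (c * S) ^ 4 := by
      rw [← abs_pow, abs_of_nonneg (by positivity)]
    have h9 : Real.exp |c * S| ≤ Real.exp (c * S) + Real.exp (-c * S) := by
      rcases abs_cases (c * S) with ⟨h, -⟩ | ⟨h, -⟩
      · rw [h]; linarith [Real.exp_pos (-c * S)]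
      · rw [h, ← neg_mul]; linarith [Real.exp_pos (c * S)]
    rw [h8] at h7
    have h10 : ((Nat.factorial 4 : ℕ) : ℝ) = 24 := by norm_num [Nat.factorial]
    rw [h10, div_le_iff₀ (by norm_num)] at h7
    linarith
  have h10 : S ^ 4 = (σ : ℝ) ^ 4 * T ^ 2 * (c * S) ^ 4 := by
    have : (σ : ℝ) ^ 4 * T ^ 2 * (c * S) ^ 4 = (c ^ 2 * (σ : ℝ) ^ 2 * T) ^ 2 * S ^ 4 := by ring
    rw [this, hc2]
    ring
  have h11 := h5 (c * S)
  have h12 := h5 (-c * S)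
  rw [h10]
  have h13 : (-c) ^ 2 = c ^ 2 := by ring
  rw [h13]
  calc (σ : ℝ) ^ 4 * T ^ 2 * (c * S) ^ 4
      ≤ (σ : ℝ) ^ 4 * T ^ 2 * (48 * (Real.exp (c * S - c ^ 2 * (σ : ℝ) ^ 2 / 2 * N) +
        Real.exp (-c * S - c ^ 2 * (σ : ℝ) ^ 2 / 2 * N))) :=
        mul_le_mul_of_nonneg_left (by linarith) (by positivity)
    _ = _ := by ring

end Supermartingale

/-! ### The error of the reward estimates -/

section Estimation

variable {T k : ℕ} [NeZero k] {M : ℝ}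

theorem playCount_hist (z : Sample T k) (t : Fin T) (i : Fin k) :
    (playCount (hist M z t) i : ℝ) = plays M z t i := by
  rw [plays_eq_card, playCount, Nat.cast_inj]
  refine Finset.card_bij (fun s _ => ⟨s, s.2.trans t.2⟩) ?_ ?_ ?_
  · intro s hs
    exact Finset.mem_filter.2 ⟨Finset.mem_univ _, s.2, (Finset.mem_filter.1 hs).2⟩
  · intro s _ s' _ h
    simpa [Fin.ext_iff] using h
  · intro s hs
    simp only [Finset.mem_filter, Finset.mem_univ, true_and] at hs
    exact ⟨⟨s, hs.1⟩, Finset.mem_filter.2 ⟨Finset.mem_univ _, hs.2⟩, rfl⟩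

theorem sum_hist_eq_sumUpTo (t : Fin T) (f : Fin T → ℝ) :
    ∑ s : Fin (t : ℕ), f ⟨s, s.2.trans t.2⟩ = sumUpTo f t := by
  rw [sumUpTo]
  refine Finset.sum_bij (fun s _ => ⟨s, s.2.trans t.2⟩) ?_ ?_ ?_ ?_
  · intro s _
    exact Finset.mem_filter.2 ⟨Finset.mem_univ _, s.2⟩
  · intro s _ s' _ h
    simpa [Fin.ext_iff] using h
  · intro s hs
    simp only [Finset.mem_filter, Finset.mem_univ, true_and] at hs
    exact ⟨⟨s, hs⟩, Finset.mem_univ _, rfl⟩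
  · intro s _
    rfl

theorem rewardEstimate_sub_meanReward (ν : Environment k) (z : Sample T k) (t : Fin T) (i : Fin k)
    (h : 0 < plays M z t i) :
    rewardEstimate (hist M z t) i - meanReward ν i = noise M ν z t i / plays M z t i := by
  have h1 : ∑ s, (if (hist M z t s).1 = i then (hist M z t s).2 else 0) =
      sumUpTo (fun s => if arm M z s = i then z.2 s i else 0) t := by
    rw [← sum_hist_eq_sumUpTo]
    refine Finset.sum_congr rfl fun s _ => ?_
    by_cases hs : arm M z ⟨s, s.2.trans t.2⟩ = i
    · rw [if_pos hs, if_pos (show (hist M z t s).1 = i from hs), hist_apply, hs]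
    · rw [if_neg hs, if_neg (show ¬ (hist M z t s).1 = i from hs)]
  have h2 : noise M ν z t i = sumUpTo (fun s => if arm M z s = i then z.2 s i else 0) t -
      meanReward ν i * plays M z t i := by
    simp only [noise, plays, sumUpTo, Finset.mul_sum, ← Finset.sum_sub_distrib]
    refine Finset.sum_congr rfl fun s _ => ?_
    split_ifs <;> ring
  rw [rewardEstimate, h1, playCount_hist, h2]
  field_simp

theorem arm_exploration (z : Sample T k) {t : Fin T} (ht : ((t : ℕ) + 1 : ℝ) ≤ M * k) :
    (arm M z t : ℕ) = ((t : ℕ) + 1) % k := by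
  rw [arm_eq, aseArm, if_pos ht]

theorem floor_le_plays (z : Sample T k) (i : Fin k) {m n : ℕ} (hm : (m : ℝ) ≤ M)
    (hn : n ≤ T) (hmn : m * k ≤ n) : (m : ℝ) ≤ plays M z n i := by
  have hk : 0 < k := NeZero.pos k
  -- The number `c` is the offset of arm `i` within each exploration block of length `k`. Times in
  -- `Fin T` are shifted by one, so arm 0 comes last in its block and arm `i > 0` has offset `i -
  -- 1`.
  obtain ⟨c, hc, hci⟩ : ∃ c < k, ∀ j : ℕ, (j * k + c + 1) % k = i := by
    by_cases h0 : (i : ℕ) = 0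
    · refine ⟨k - 1, by omega, fun j => ?_⟩
      have : j * k + (k - 1) + 1 = (j + 1) * k := by
        rw [add_mul]
        omega
      rw [this, h0, Nat.mul_mod_left]
    · refine ⟨i - 1, by omega, fun j => ?_⟩
      have : j * k + (i - 1) + 1 = i + j * k := by omega
      rw [this, Nat.add_mul_mod_self_right, Nat.mod_eq_of_lt i.2]
  have hlt : ∀ j < m, j * k + c + 1 ≤ m * k := by
    intro j hj
    have : (j + 1) * k ≤ m * k := Nat.mul_le_mul_right k hj
    rw [add_mul] at this
    omega
  rw [plays_eq_card, Nat.cast_le]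
  have h1 : (Finset.univ : Finset (Fin m)).card ≤
      (Finset.univ.filter fun s : Fin T => s.val < n ∧ arm M z s = i).card := by
    refine Finset.card_le_card_of_injOn
      (fun j : Fin m => (⟨j * k + c, by have := hlt j j.2; omega⟩ : Fin T)) ?_ ?_
    · intro j _
      have hj := hlt j j.2
      simp only [Finset.coe_filter, Finset.mem_univ, true_and, Set.mem_ofPred_eq]
      refine ⟨by omega, ?_⟩
      rw [Fin.ext_iff, arm_exploration, hci j]
      have h2 : ((j * k + c + 1 : ℕ) : ℝ) ≤ (m * k : ℕ) := Nat.cast_le.2 hj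
      push_cast at h2 ⊢
      exact h2.trans (mul_le_mul_of_nonneg_right hm (Nat.cast_nonneg k))
    · intro j _ j' _ h
      simp only [Fin.mk.injEq, Nat.add_right_cancel_iff] at h
      exact Fin.ext (Nat.eq_of_mul_eq_mul_right hk h)
  simpa using h1

/-- The sum of the exponential supermartingales that control the noise and the play counts. -/
noncomputable def tailSum (M : ℝ) (ν : Environment k) (σ L : ℝ) (z : Sample T k) : ℝ :=
  ∑ n ∈ Finset.range (T + 1), ∑ i, ((∑ m ∈ Finset.Icc 1 T,
    (Real.exp (√(2 * L / m) / σ * noise M ν z n i -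
        (√(2 * L / m) / σ) ^ 2 * σ ^ 2 / 2 * plays M z n i) +
      Real.exp (-(√(2 * L / m) / σ) * noise M ν z n i -
        (-(√(2 * L / m) / σ)) ^ 2 * σ ^ 2 / 2 * plays M z n i))) +
    Real.exp (drift M z n i / 2 - plays M z n i))

theorem upperMean_tailSum {σ : ℝ≥0} {ν : Environment k} (hν : IsSubgaussianEnv σ ν) (L : ℝ) :
    UpperMean (sampleMeasure T ν) (tailSum M ν σ L) ((T + 1) * (k * (2 * T + 1))) := by
  have h : UpperMean (sampleMeasure T ν) (tailSum M ν σ L)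
      (∑ n ∈ Finset.range (T + 1), ∑ _i : Fin k, ((∑ _m ∈ Finset.Icc 1 T, ((1 : ℝ) + 1)) + 1)) := by
    refine UpperMean.sum fun n hn => UpperMean.sum fun i _ => UpperMean.add
      (UpperMean.sum fun m _ => UpperMean.add ?_ ?_) ?_
    · exact upperMean_exp_noise hν i _ (Nat.lt_succ_iff.1 (Finset.mem_range.1 hn))
    · exact upperMean_exp_noise hν i _ (Nat.lt_succ_iff.1 (Finset.mem_range.1 hn))
    · exact upperMean_exp_drift ν i (Nat.lt_succ_iff.1 (Finset.mem_range.1 hn))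
  refine h.le_bound (le_of_eq ?_)
  simp only [Finset.sum_const, Finset.card_range, Finset.card_univ, Fintype.card_fin,
    Nat.card_Icc, nsmul_eq_mul, Nat.add_sub_cancel]
  push_cast
  ring

theorem tailSum_nonneg (ν : Environment k) (σ L : ℝ) (z : Sample T k) : 0 ≤ tailSum M ν σ L z := by
  unfold tailSum
  positivity

/-- Every summand is positive, hence below `exp L`, and logarithms can be taken. The number of plays
is random, so the tilt that is best for it cannot be fixed in advance; this is why `tailSum`
contains the tilts for all `m` from 1 to `T`, of which the realised count is selected. -/
theorem bounds_of_tailSum_lt {σ L : ℝ} (hσ : 0 < σ) (hL : 0 < L) {ν : Environment k}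
    {z : Sample T k} (h : tailSum M ν σ L z < Real.exp L) {n : ℕ} (hn : n ≤ T) (i : Fin k) :
    drift M z n i / 2 - L ≤ plays M z n i ∧
      (1 ≤ plays M z n i → noise M ν z n i ^ 2 ≤ 2 * σ ^ 2 * L * plays M z n i) := by
  have h1 : (∑ m ∈ Finset.Icc 1 T,
      (Real.exp (√(2 * L / m) / σ * noise M ν z n i -
          (√(2 * L / m) / σ) ^ 2 * σ ^ 2 / 2 * plays M z n i) +
        Real.exp (-(√(2 * L / m) / σ) * noise M ν z n i -
          (-(√(2 * L / m) / σ)) ^ 2 * σ ^ 2 / 2 * plays M z n i))) +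
      Real.exp (drift M z n i / 2 - plays M z n i) < Real.exp L := by
    refine lt_of_le_of_lt ?_ h
    refine le_trans ?_ (Finset.single_le_sum (f := fun n => ∑ i, ((∑ m ∈ Finset.Icc 1 T,
      (Real.exp (√(2 * L / m) / σ * noise M ν z n i -
          (√(2 * L / m) / σ) ^ 2 * σ ^ 2 / 2 * plays M z n i) +
        Real.exp (-(√(2 * L / m) / σ) * noise M ν z n i -
          (-(√(2 * L / m) / σ)) ^ 2 * σ ^ 2 / 2 * plays M z n i))) +
      Real.exp (drift M z n i / 2 - plays M z n i))) (fun n _ => by positivity)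
      (Finset.mem_range.2 (Nat.lt_succ_iff.2 hn)))
    exact Finset.single_le_sum (f := fun i => ((∑ m ∈ Finset.Icc 1 T,
      (Real.exp (√(2 * L / m) / σ * noise M ν z n i -
          (√(2 * L / m) / σ) ^ 2 * σ ^ 2 / 2 * plays M z n i) +
        Real.exp (-(√(2 * L / m) / σ) * noise M ν z n i -
          (-(√(2 * L / m) / σ)) ^ 2 * σ ^ 2 / 2 * plays M z n i))) +
      Real.exp (drift M z n i / 2 - plays M z n i))) (fun i _ => by positivity)
      (Finset.mem_univ i)
  constructor
  · have h2 : Real.exp (drift M z n i / 2 - plays M z n i) < Real.exp L :=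
      lt_of_le_of_lt (le_add_of_nonneg_left (by positivity)) h1
    linarith [Real.exp_lt_exp.1 h2]
  · intro hN
    obtain ⟨m, hm⟩ : ∃ m : ℕ, plays M z n i = m := ⟨_, plays_eq_card z n i⟩
    have hm1 : 1 ≤ m := by rw [hm] at hN; exact_mod_cast hN
    have hmT : m ≤ T := by
      have := plays_le (M := M) hn z i
      rw [hm] at this
      exact (Nat.cast_le.1 this).trans hn
    have hm0 : (0 : ℝ) < m := by exact_mod_cast hm1
    set c : ℝ := √(2 * L / m) / σ with hc
    have hc0 : 0 < c := by positivity
    -- For `m` plays the compensator equals `L`, so an exponential below `exp L` means `c * S < 2 *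
    -- L`, and likewise for `-S`.
    have hc2 : c ^ 2 * σ ^ 2 * m = 2 * L := by
      rw [hc, div_pow, Real.sq_sqrt (by positivity)]
      field_simp
    have h2 := lt_of_le_of_lt (le_add_of_nonneg_right (Real.exp_pos _).le) h1
    have h3 := lt_of_le_of_lt (Finset.single_le_sum (f := fun m : ℕ =>
      (Real.exp (√(2 * L / m) / σ * noise M ν z n i -
          (√(2 * L / m) / σ) ^ 2 * σ ^ 2 / 2 * plays M z n i) +
        Real.exp (-(√(2 * L / m) / σ) * noise M ν z n i -
          (-(√(2 * L / m) / σ)) ^ 2 * σ ^ 2 / 2 * plays M z n i)))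
      (fun m _ => by positivity) (Finset.mem_Icc.2 ⟨hm1, hmT⟩)) h2
    rw [hm] at h3 ⊢
    simp only [← hc] at h3
    set S := noise M ν z n i
    have h4 := Real.exp_lt_exp.1 (lt_of_le_of_lt (le_add_of_nonneg_right (Real.exp_pos _).le) h3)
    have h5 := Real.exp_lt_exp.1 (lt_of_le_of_lt (le_add_of_nonneg_left (Real.exp_pos _).le) h3)
    have h6 : (c * S) ^ 2 ≤ (2 * L) ^ 2 := by
      refine sq_le_sq' ?_ ?_
      · have : (-c) ^ 2 = c ^ 2 := by ring
        rw [this] at h5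
        linarith
      · linarith
    have h7 : 2 * L * S ^ 2 ≤ 2 * L * (2 * σ ^ 2 * L * m) := by
      calc 2 * L * S ^ 2 = (c * S) ^ 2 * (σ ^ 2 * m) := by rw [← hc2]; ring
        _ ≤ (2 * L) ^ 2 * (σ ^ 2 * m) := mul_le_mul_of_nonneg_right h6 (by positivity)
        _ = _ := by ring
    exact le_of_mul_le_mul_left h7 (by positivity)

theorem card_filter_succ_le {x : ℝ} (hx : 0 ≤ x) :
    ((Finset.univ.filter fun s : Fin T => ((s : ℕ) + 1 : ℝ) ≤ x).card : ℝ) ≤ x := by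
  have h1 : (Finset.univ.filter fun s : Fin T => ((s : ℕ) + 1 : ℝ) ≤ x).card ≤ ⌊x⌋₊ := by
    have h2 : (Finset.univ.filter fun s : Fin T => ((s : ℕ) + 1 : ℝ) ≤ x) ⊆
        Finset.univ.filter fun s : Fin T => s.val < ⌊x⌋₊ := by
      intro s hs
      simp only [Finset.mem_filter, Finset.mem_univ, true_and] at hs ⊢
      refine Nat.lt_of_succ_le (Nat.le_floor ?_)
      push_cast
      exact hs
    refine (Finset.card_le_card h2).trans ?_
    rw [Fin.card_filter_val_lt]
    exact min_le_right _ _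
  exact (Nat.cast_le.2 h1).trans (Nat.floor_le hx)

theorem mul_sub_le_drift {z : Sample T k} {β : ℝ} (hβ : 0 ≤ β) (hM : 0 ≤ M) {n : ℕ} (hn : n ≤ T)
    {i : Fin k} (h : ∀ s : Fin T, s.val < n → M * k < (s : ℕ) + 1 → β ≤ condProb M z s i) :
    β * (n - M * k) ≤ drift M z n i := by
  have h1 : ∀ s ∈ Finset.univ.filter fun s : Fin T => s.val < n,
      β * (1 - if ((s : ℕ) + 1 : ℝ) ≤ M * k then 1 else 0) ≤ condProb M z s i := by
    intro s hs
    split_ifs with hc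
    · simpa using condProb_nonneg z s i
    · simpa using h s (Finset.mem_filter.1 hs).2 (not_le.1 hc)
  refine le_trans ?_ (Finset.sum_le_sum h1)
  rw [← Finset.mul_sum, Finset.sum_sub_distrib, Finset.sum_const, card_filter_val_lt hn,
    nsmul_eq_mul, mul_one]
  refine mul_le_mul_of_nonneg_left (sub_le_sub_left ?_ _) hβ
  refine le_trans ?_ (card_filter_succ_le (T := T) (mul_nonneg hM (Nat.cast_nonneg k)))
  rw [← Finset.sum_filter, Finset.sum_const, nsmul_eq_mul, mul_one, Nat.cast_le]
  refine Finset.card_le_card fun s hs => ?_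
  simp only [Finset.mem_filter, Finset.mem_univ, true_and] at hs ⊢
  exact hs.2

/-- The constant in the bound on the mean squared error of the reward estimates. -/
noncomputable def errorConst (k T : ℕ) (σ α B : ℝ) : ℝ :=
  k * (2 * σ ^ 2 * (6 * Real.log T) *
    (2 * k + 2 * (1 + 6 * Real.log T) / (α * Real.exp (-(2 * B)))) + 48 * σ ^ 4 + 3 * k)

/-- The feedback argument on the good event: `⌊M⌋` plays per arm keep the estimates within `B` of
the means at all times after exploration, so every arm retains probability at least `β`; its drift,
and with it its number of plays, is then linear in `t`. -/
theorem sq_error_le_of_tailSum_lt {σ L α B : ℝ} (hσ : 0 < σ) (hL : 0 < L) (hα : 0 < α)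
    {ν : Environment k} (hp : ∀ i, α ≤ target ν i) (hM : 1 ≤ M) (hB0 : 0 ≤ B)
    (hB : 2 * σ ^ 2 * L ≤ B ^ 2 * ⌊M⌋₊) {z : Sample T k}
    (h : tailSum M ν σ L z < Real.exp L) (t : Fin T) (ht : M * k < (t : ℕ) + 1) (i : Fin k) :
    (rewardEstimate (hist M z t) i - meanReward ν i) ^ 2 ≤
      2 * σ ^ 2 * L * (2 * k + 2 * (1 + L) / (α * Real.exp (-(2 * B)))) / (t : ℕ) := by
  have hM0 : 0 ≤ M := zero_le_one.trans hM
  have hm1 : 1 ≤ ⌊M⌋₊ := Nat.one_le_floor_iff M |>.2 hM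
  have hmM : (⌊M⌋₊ : ℝ) ≤ M := Nat.floor_le hM0
  have hm1' : (1 : ℝ) ≤ ⌊M⌋₊ := by exact_mod_cast hm1
  have hplays : ∀ (s : Fin T) (j : Fin k), M * k < (s : ℕ) + 1 → (⌊M⌋₊ : ℝ) ≤ plays M z s j := by
    intro s j hs
    refine floor_le_plays z j hmM s.2.le ?_
    -- The history before step `s + 1` has only `s` rounds; the strict inequality between integers
    -- still yields `⌊M⌋₊ * k ≤ s`, that is, all full blocks.
    have h1 : ((⌊M⌋₊ * k : ℕ) : ℝ) < ((s : ℕ) + 1 : ℕ) := by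
      push_cast
      exact (mul_le_mul_of_nonneg_right hmM (Nat.cast_nonneg k)).trans_lt hs
    exact Nat.lt_succ_iff.1 (Nat.cast_lt.1 h1)
  have herr : ∀ (s : Fin T) (j : Fin k), M * k < (s : ℕ) + 1 →
      (rewardEstimate (hist M z s) j - meanReward ν j) ^ 2 * plays M z s j ≤ 2 * σ ^ 2 * L := by
    intro s j hs
    have hN := hplays s j hs
    have hN0 : 0 < plays M z s j := by linarith
    rw [rewardEstimate_sub_meanReward ν z s j hN0, div_pow]
    have h1 := (bounds_of_tailSum_lt hσ hL h s.2.le j).2 (hm1'.trans hN)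
    rw [div_mul_eq_mul_div, div_le_iff₀ (by positivity)]
    nlinarith
  have hclose : ∀ (s : Fin T) (j : Fin k), M * k < (s : ℕ) + 1 →
      |rewardEstimate (hist M z s) j - meanReward ν j| ≤ B := by
    intro s j hs
    refine abs_le_of_sq_le_sq ?_ hB0
    have h1 := herr s j hs
    have h2 := mul_le_mul_of_nonneg_left (hplays s j hs)
      (sq_nonneg (rewardEstimate (hist M z s) j - meanReward ν j))
    exact le_of_mul_le_mul_right (h2.trans (h1.trans hB)) (by linarith)
  set β := α * Real.exp (-(2 * B)) with hβ
  have hβ0 : 0 < β := mul_pos hα (Real.exp_pos _)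
  have hprob : ∀ s : Fin T, s.val < t → M * k < (s : ℕ) + 1 → β ≤ condProb M z s i := by
    intro s _ hs
    rw [condProb, armProb, if_neg (not_le.2 hs)]
    exact (mul_le_mul_of_nonneg_right (hp i) (Real.exp_pos _).le).trans
      (softmax_ge_of_close (fun j => hclose s j hs) i)
  have h1 := mul_sub_le_drift hβ0.le hM0 t.2.le hprob
  have h2 := (bounds_of_tailSum_lt hσ hL h t.2.le i).1
  have hN := hplays t i ht
  set N := plays M z t i with hNdef
  have hMN : M ≤ 2 * N := by linarith [Nat.lt_floor_add_one M]
  -- The drift bounds give `β * (t - M * k) ≤ 2 * (N + L)`. The terms `L` and `M * k` are absorbed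
  -- into multiples of `N` by `1 ≤ N` and `M ≤ 2 * N`.
  have h3 : ((t : ℕ) : ℝ) ≤ (2 * k + 2 * (1 + L) / β) * N := by
    have h4 : ((t : ℕ) : ℝ) - M * k ≤ 2 * (N + L) / β := by
      rw [le_div_iff₀ hβ0]
      linarith
    have h5 : M * k ≤ 2 * N * k := mul_le_mul_of_nonneg_right hMN (Nat.cast_nonneg k)
    have h6 : 2 * (N + L) / β ≤ 2 * (1 + L) / β * N := by
      rw [div_mul_eq_mul_div]
      refine div_le_div_of_nonneg_right ?_ hβ0.le
      nlinarith
    linarith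
  have ht0 : (0 : ℝ) < (t : ℕ) := by
    have hk1 : (1 : ℝ) ≤ k := by exact_mod_cast NeZero.pos k
    have h4 : (1 : ℝ) < (t : ℕ) + 1 := by nlinarith
    linarith
  rw [le_div_iff₀ ht0]
  have h7 := herr t i ht
  rw [← hNdef] at h7
  calc (rewardEstimate (hist M z t) i - meanReward ν i) ^ 2 * (t : ℕ)
      ≤ (rewardEstimate (hist M z t) i - meanReward ν i) ^ 2 *
        ((2 * k + 2 * (1 + L) / β) * N) := mul_le_mul_of_nonneg_left h3 (sq_nonneg _)
    _ = ((rewardEstimate (hist M z t) i - meanReward ν i) ^ 2 * N) *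
        (2 * k + 2 * (1 + L) / β) := by ring
    _ ≤ _ := mul_le_mul_of_nonneg_right h7 (by positivity)

/-- A single majorant covers both events: the deterministic bound of the good event plus small
multiples of `S ^ 4` and of `tailSum`, which dominate the squared error when `tailSum ≥ T ^ 6`. No
probability of the bad event has to be computed. -/
theorem upperMean_sq_error {σ : ℝ≥0} (hσ : 0 < σ) {α B : ℝ} (hα : 0 < α)
    {ν : Environment k} (hν : IsSubgaussianEnv σ ν) (hp : ∀ i, α ≤ target ν i) (hT : 2 ≤ T)
    (hM : 1 ≤ M) (hB0 : 0 ≤ B) (hB : 2 * (σ : ℝ) ^ 2 * (6 * Real.log T) ≤ B ^ 2 * ⌊M⌋₊)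
    (t : Fin T) (ht : M * k < (t : ℕ) + 1) :
    UpperMean (sampleMeasure T ν)
      (fun z => ∑ i, (rewardEstimate (hist M z t) i - meanReward ν i) ^ 2)
      (errorConst k T σ α B / (t : ℕ)) := by
  have hσ' : (0 : ℝ) < σ := hσ
  have hT1 : (2 : ℝ) ≤ T := by exact_mod_cast hT
  have hT0 : (0 : ℝ) < T := by linarith
  set L := 6 * Real.log T with hLdef
  have hL : 0 < L := mul_pos (by norm_num) (Real.log_pos (by linarith))
  have hexpL : Real.exp L = (T : ℝ) ^ 6 := by
    rw [hLdef, ← Real.rpow_natCast, Real.rpow_def_of_pos hT0]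
    congr 1
    push_cast
    ring
  have hk1 : (1 : ℝ) ≤ k := by exact_mod_cast NeZero.pos k
  have ht0 : (0 : ℝ) < (t : ℕ) := by
    have h4 : (1 : ℝ) < (t : ℕ) + 1 := by nlinarith
    linarith
  have htT : ((t : ℕ) : ℝ) ≤ T := by exact_mod_cast t.2.le
  set K := 2 * σ ^ 2 * L * (2 * k + 2 * (1 + L) / (α * Real.exp (-(2 * B)))) with hK
  have hK0 : 0 ≤ K := by positivity
  have key : ∀ i, UpperMean (sampleMeasure T ν)
      (fun z => (rewardEstimate (hist M z t) i - meanReward ν i) ^ 2)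
      (K / (t : ℕ) + (1 / (2 * (T : ℝ) ^ 3) * (96 * (σ : ℝ) ^ 4 * T ^ 2) +
        1 / (2 * (T : ℝ) ^ 3) * ((T + 1) * (k * (2 * T + 1))))) := by
    intro i
    refine ((UpperMean.const _).add (((upperMean_noise_pow_four (M := M) hσ hν i (by omega)
      t.2.le).const_mul (by positivity)).add ((upperMean_tailSum (M := M) hν L).const_mul
        (by positivity)))).mono fun z => ?_
    have hU0 := tailSum_nonneg (M := M) ν σ L z
    by_cases hz : tailSum M ν σ L z < Real.exp L
    · refine (sq_error_le_of_tailSum_lt hσ' hL hα hp hM hB0 hB hz t ht i).trans ?_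
      have h1 : 0 ≤ 1 / (2 * (T : ℝ) ^ 3) * noise M ν z t i ^ 4 := by positivity
      have h2 : 0 ≤ 1 / (2 * (T : ℝ) ^ 3) * tailSum M ν σ L z := by positivity
      linarith
    · have hU : (T : ℝ) ^ 6 ≤ tailSum M ν σ L z := by
        rw [← hexpL]
        exact not_lt.1 hz
      have hN : 1 ≤ plays M z t i := by
        have := floor_le_plays (M := M) z i (m := 1) (by exact_mod_cast hM) t.2.le ?_
        · exact_mod_cast this
        · have h1 : ((1 * k : ℕ) : ℝ) < ((t : ℕ) + 1 : ℕ) := by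
            push_cast
            nlinarith
          exact Nat.lt_succ_iff.1 (Nat.cast_lt.1 h1)
      rw [rewardEstimate_sub_meanReward ν z t i (by linarith), div_pow]
      set S := noise M ν z t i
      have h1 : S ^ 2 / plays M z t i ^ 2 ≤ S ^ 2 := div_le_self (sq_nonneg _) (by nlinarith)
      -- AM-GM with weight `T ^ 3`. The means of `S ^ 4` and `tailSum` are both of order `T ^ 2`, so
      -- after division by `2 * T ^ 3` they contribute `O(1 / T)`; this is what the exponent 6 in
      -- `exp L = T ^ 6` is for.
      have h2 : S ^ 2 ≤ 1 / (2 * (T : ℝ) ^ 3) * S ^ 4 + 1 / (2 * (T : ℝ) ^ 3) * (T : ℝ) ^ 6 := by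
        have h3 : 0 ≤ (S ^ 2 - T ^ 3) ^ 2 / (2 * (T : ℝ) ^ 3) := by positivity
        have e : (S ^ 2 - T ^ 3) ^ 2 / (2 * (T : ℝ) ^ 3) =
          1 / (2 * (T : ℝ) ^ 3) * S ^ 4 + 1 / (2 * (T : ℝ) ^ 3) * (T : ℝ) ^ 6 - S ^ 2 := by
          field_simp
          ring
        linarith
      have h3 : 1 / (2 * (T : ℝ) ^ 3) * (T : ℝ) ^ 6 ≤ 1 / (2 * (T : ℝ) ^ 3) * tailSum M ν σ L z :=
        mul_le_mul_of_nonneg_left hU (by positivity)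
      have h4 : 0 ≤ K / (t : ℕ) := by positivity
      linarith
  refine (UpperMean.sum fun i _ => key i).le_bound ?_
  rw [Finset.sum_const, Finset.card_univ, Fintype.card_fin, nsmul_eq_mul, errorConst, ← hLdef,
    ← hK, mul_div_assoc (k : ℝ)]
  refine mul_le_mul_of_nonneg_left ?_ (by positivity : (0 : ℝ) ≤ k)
  have h1 : 1 / (2 * (T : ℝ) ^ 3) * (96 * (σ : ℝ) ^ 4 * T ^ 2) = 48 * (σ : ℝ) ^ 4 / T := by
    field_simp
    ring
  have h2 : 1 / (2 * (T : ℝ) ^ 3) * ((T + 1) * (k * (2 * T + 1))) ≤ 3 * k / T := by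
    rw [one_div, inv_mul_le_iff₀ (by positivity)]
    have e : 2 * (T : ℝ) ^ 3 * (3 * k / T) = k * (6 * T ^ 2) := by
      field_simp
      ring
    rw [e]
    calc ((T : ℝ) + 1) * (k * (2 * T + 1)) = k * ((T + 1) * (2 * T + 1)) := by ring
      _ ≤ _ := mul_le_mul_of_nonneg_left (by nlinarith) (by positivity)
  have h3 : 48 * (σ : ℝ) ^ 4 / T ≤ 48 * (σ : ℝ) ^ 4 / (t : ℕ) :=
    div_le_div_of_nonneg_left (by positivity) ht0 htT
  have h4 : 3 * (k : ℝ) / T ≤ 3 * k / (t : ℕ) :=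
    div_le_div_of_nonneg_left (by positivity) ht0 htT
  rw [h1, add_div, add_div]
  linarith

end Estimation

/-! ### Squared distance of the performance distributions to the target -/

section SquaredDistance

variable {T k : ℕ} [NeZero k] {M : ℝ}

omit [NeZero k] in
theorem sum_sq_sub_le_two {q p : Fin k → ℝ} (hq : ∀ i, 0 ≤ q i) (hp : ∀ i, 0 ≤ p i)
    (hq1 : ∑ i, q i = 1) (hp1 : ∑ i, p i = 1) : ∑ i, (q i - p i) ^ 2 ≤ 2 := by
  have hle : ∀ {f : Fin k → ℝ}, (∀ i, 0 ≤ f i) → ∑ i, f i = 1 → ∀ i, f i ≤ 1 := by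
    intro f hf hf1 i
    rw [← hf1]
    exact Finset.single_le_sum (fun j _ => hf j) (Finset.mem_univ i)
  calc ∑ i, (q i - p i) ^ 2 ≤ ∑ i, (q i + p i) := by
        refine Finset.sum_le_sum fun i _ => ?_
        have h1 := hle hq hq1 i
        have h2 := hle hp hp1 i
        nlinarith [hq i, hp i, mul_nonneg (hq i) (hp i)]
    _ = 2 := by rw [Finset.sum_add_distrib, hq1, hp1]; norm_num

theorem sum_inv_le_one_add_log {n : ℕ} (s : Finset (Fin T)) (hs : ∀ t ∈ s, 1 ≤ t.val ∧ t.val < n) :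
    ∑ t ∈ s, 1 / ((t : ℕ) : ℝ) ≤ 1 + Real.log n := by
  refine le_trans ?_ (harmonic_le_one_add_log n)
  rw [harmonic]
  push_cast
  have h1 : ∑ t ∈ s, 1 / ((t : ℕ) : ℝ) =
      ∑ j ∈ s.image (fun t : Fin T => (t : ℕ) - 1), ((j : ℝ) + 1)⁻¹ := by
    rw [Finset.sum_image]
    · refine Finset.sum_congr rfl fun t ht => ?_
      rw [Nat.cast_sub (hs t ht).1, Nat.cast_one, sub_add_cancel, one_div]
    · intro t ht t' ht' h
      have h1 := (hs t ht).1
      have h2 := (hs t' ht').1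
      simp only at h
      exact Fin.ext (by omega)
  rw [h1]
  refine Finset.sum_le_sum_of_subset_of_nonneg ?_ fun _ _ _ => by positivity
  intro j hj
  obtain ⟨t, ht, rfl⟩ := Finset.mem_image.1 hj
  have := hs t ht
  rw [Finset.mem_range]
  omega

theorem sum_sq_condProb_sub_le (ν : Environment k) (z : Sample T k) (t : Fin T)
    (ht : M * k < (t : ℕ) + 1) :
    ∑ i, (condProb M z t i - target ν i) ^ 2 ≤
      4 * ∑ i, (rewardEstimate (hist M z t) i - meanReward ν i) ^ 2 := by
  have h : ∀ i, condProb M z t i = softmax (rewardEstimate (hist M z t)) i := fun i => by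
    rw [condProb, armProb, if_neg (not_le.2 ht)]
  simp only [h]
  exact sum_sq_softmax_sub_le _ _

/-- The deviation splits into the martingale part, the exploration steps (at most `M * k`, each off
by at most 1) and the policy errors afterwards, to which Cauchy-Schwarz over time applies. -/
theorem sq_plays_sub_le (ν : Environment k) (hM : 0 ≤ M) {n : ℕ} (hn : n ≤ T)
    (z : Sample T k) (i : Fin k) :
    (plays M z n i - n * target ν i) ^ 2 ≤
      3 * ((plays M z n i - drift M z n i) ^ 2 + ((M * k) ^ 2 + n *
        ∑ s ∈ Finset.univ.filter (fun s : Fin T => s.val < n ∧ M * k < (s : ℕ) + 1),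
          (condProb M z s i - target ν i) ^ 2)) := by
  have hp0 : 0 ≤ target ν i := (softmax_pos _ i).le
  have hp1 : target ν i ≤ 1 := softmax_le_one _ i
  set A := ∑ s ∈ Finset.univ.filter (fun s : Fin T => s.val < n ∧ ((s : ℕ) + 1 : ℝ) ≤ M * k),
    (condProb M z s i - target ν i) with hA
  set B := ∑ s ∈ Finset.univ.filter (fun s : Fin T => s.val < n ∧ M * k < (s : ℕ) + 1),
    (condProb M z s i - target ν i) with hB
  have h1 : drift M z n i - n * target ν i = A + B := by
    have h2 : ∑ s : Fin T with s.val < n, (condProb M z s i - target ν i) = A + B := by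
      rw [← Finset.sum_filter_add_sum_filter_not _
        (fun s : Fin T => ((s : ℕ) + 1 : ℝ) ≤ M * k), Finset.filter_filter, Finset.filter_filter]
      simp only [not_le]
      rw [hA, hB]
    rw [← h2, Finset.sum_sub_distrib, Finset.sum_const, card_filter_val_lt hn, nsmul_eq_mul,
      drift, sumUpTo]
  have hAabs : |A| ≤ M * k := by
    calc |A| ≤ ∑ s ∈ Finset.univ.filter
          (fun s : Fin T => s.val < n ∧ ((s : ℕ) + 1 : ℝ) ≤ M * k), |condProb M z s i - target ν i| :=
          Finset.abs_sum_le_sum_abs _ _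
      _ ≤ ∑ s ∈ Finset.univ.filter
          (fun s : Fin T => s.val < n ∧ ((s : ℕ) + 1 : ℝ) ≤ M * k), (1 : ℝ) := by
          refine Finset.sum_le_sum fun s _ => abs_sub_le_iff.2 ⟨?_, ?_⟩
          · linarith [condProb_le_one (M := M) z s i]
          · linarith [condProb_nonneg (M := M) z s i]
      _ ≤ ((Finset.univ.filter fun s : Fin T => ((s : ℕ) + 1 : ℝ) ≤ M * k).card : ℝ) := by
          rw [Finset.sum_const, nsmul_eq_mul, mul_one, Nat.cast_le]
          refine Finset.card_le_card fun s hs => ?_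
          simp only [Finset.mem_filter, Finset.mem_univ, true_and] at hs ⊢
          exact hs.2
      _ ≤ M * k := card_filter_succ_le (mul_nonneg hM (Nat.cast_nonneg k))
  have hA2 : A ^ 2 ≤ (M * k) ^ 2 := sq_le_sq' (abs_le.1 hAabs).1 (abs_le.1 hAabs).2
  have hB2 : B ^ 2 ≤ n *
      ∑ s ∈ Finset.univ.filter (fun s : Fin T => s.val < n ∧ M * k < (s : ℕ) + 1),
          (condProb M z s i - target ν i) ^ 2 := by
    refine (sq_sum_le_card_mul_sum_sq).trans (mul_le_mul_of_nonneg_right ?_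
      (Finset.sum_nonneg fun _ _ => sq_nonneg _))
    rw [Nat.cast_le]
    refine (Finset.card_le_card fun s hs => ?_).trans (card_filter_val_lt hn).le
    simp only [Finset.mem_filter, Finset.mem_univ, true_and] at hs ⊢
    exact hs.1
  have h3 : plays M z n i - n * target ν i = (plays M z n i - drift M z n i) + A + B := by
    linarith
  rw [h3]
  set x := plays M z n i - drift M z n i
  have h4 : (x + A + B) ^ 2 ≤ 3 * (x ^ 2 + (A ^ 2 + B ^ 2)) := by
    nlinarith [sq_nonneg (x - A), sq_nonneg (x - B), sq_nonneg (A - B)]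
  linarith

/-- The performance distribution of the algorithm, with the explicit conditional probability at the
policy level. -/
noncomputable def perfExplicit (M : ℝ) : Level → Fin T → Sample T k → Fin k → ℝ
  | .policy => fun t z i => condProb M z t i
  | .action => fun t z i => plays M z (t + 1) i / ((t : ℕ) + 1)

theorem perfExplicit_nonneg (l : Level) (t : Fin T) (z : Sample T k) (i : Fin k) :
    0 ≤ perfExplicit M l t z i := by
  cases l
  · exact condProb_nonneg z t i
  · exact div_nonneg (plays_nonneg z _ i) (by positivity)

theorem sum_perfExplicit (l : Level) (t : Fin T) (z : Sample T k) :
    ∑ i, perfExplicit M l t z i = 1 := by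
  cases l
  · exact sum_armProb t _
  · simp only [perfExplicit]
    rw [← Finset.sum_div, sum_plays t.2]
    push_cast
    exact div_self (by positivity)

theorem perfExplicit_le_one (l : Level) (t : Fin T) (z : Sample T k) (i : Fin k) :
    perfExplicit M l t z i ≤ 1 := by
  rw [← sum_perfExplicit (M := M) l t z]
  exact Finset.single_le_sum (fun j _ => perfExplicit_nonneg l t z j) (Finset.mem_univ i)

theorem measurable_perfExplicit (l : Level) (t : Fin T) (i : Fin k) :
    Measurable fun z : Sample T k => perfExplicit M l t z i := by
  cases l
  · exact measurable_condProb t i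
  · exact (measurable_plays _ i).div_const _

/-- The squared Euclidean distance of the performance distribution to the target. -/
noncomputable def sqDist (M : ℝ) (ν : Environment k) (l : Level) (t : Fin T) (z : Sample T k) : ℝ :=
  ∑ i, (perfExplicit M l t z i - target ν i) ^ 2

theorem sqDist_nonneg (ν : Environment k) (l : Level) (t : Fin T) (z : Sample T k) :
    0 ≤ sqDist M ν l t z :=
  Finset.sum_nonneg fun _ _ => sq_nonneg _

theorem measurable_sqDist (ν : Environment k) (l : Level) (t : Fin T) :
    Measurable (sqDist (T := T) M ν l t) :=
  Finset.measurable_sum _ fun i _ => ((measurable_perfExplicit l t i).sub_const _).pow_const 2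

theorem sqDist_le_two (ν : Environment k) (l : Level) (t : Fin T) (z : Sample T k) :
    sqDist M ν l t z ≤ 2 :=
  sum_sq_sub_le_two (perfExplicit_nonneg l t z) (fun i => (softmax_pos _ i).le)
    (sum_perfExplicit l t z) (sum_softmax _)

/-- The constant in the bound on the mean squared distance of the performance distributions to the
target. -/
noncomputable def distConst (k T : ℕ) (M E : ℝ) : ℝ :=
  3 * (k + k * (M * k) + 4 * E * (1 + Real.log T))

variable {ν : Environment k} {E : ℝ}

theorem one_le_of_exploration_lt (hM : 1 ≤ M) {t : Fin T} (ht : M * k < (t : ℕ) + 1) :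
    1 ≤ t.val := by
  have hk1 : (1 : ℝ) ≤ k := by exact_mod_cast NeZero.pos k
  have h : ((1 : ℕ) : ℝ) < ((t + 1 : ℕ) : ℝ) := by
    push_cast
    nlinarith
  have := Nat.cast_lt.1 h
  omega

theorem upperMean_sqDist_policy_of_lt (hM : 1 ≤ M) {t : Fin T}
    (ht : M * k < (t : ℕ) + 1) (hE0 : 0 ≤ E) (hE : UpperMean (sampleMeasure T ν)
      (fun z => ∑ i, (rewardEstimate (hist M z t) i - meanReward ν i) ^ 2) (E / (t : ℕ))) :
    UpperMean (sampleMeasure T ν) (sqDist M ν .policy t) (8 * E / ((t : ℕ) + 1)) := by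
  refine ((hE.const_mul (c := 4) (by norm_num)).mono fun z =>
    sum_sq_condProb_sub_le ν z t ht).le_bound ?_
  have ht1 : (1 : ℝ) ≤ (t : ℕ) := by exact_mod_cast one_le_of_exploration_lt hM ht
  -- Since `t ≥ 1`, passing from `1 / t` to `1 / (t + 1)` costs a factor of at most 2.
  rw [← mul_div_assoc, div_le_div_iff₀ (by linarith) (by linarith)]
  nlinarith

theorem upperMean_sqDist_action_of_le (hM : 1 ≤ M) {t : Fin T}
    (ht : M * k ≤ (t : ℕ) + 1) (hE0 : 0 ≤ E)
    (hE : ∀ s : Fin T, M * k < (s : ℕ) + 1 → UpperMean (sampleMeasure T ν)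
      (fun z => ∑ i, (rewardEstimate (hist M z s) i - meanReward ν i) ^ 2) (E / (s : ℕ))) :
    UpperMean (sampleMeasure T ν) (sqDist M ν .action t) (distConst k T M E / ((t : ℕ) + 1)) := by
  have hM0 : 0 ≤ M := zero_le_one.trans hM
  set n : ℕ := t + 1 with hn
  have hnT : n ≤ T := t.2
  have hn0 : (0 : ℝ) < n := by rw [hn]; positivity
  have hnc : ((t : ℕ) : ℝ) + 1 = n := by rw [hn]; push_cast; ring
  rw [hnc] at ht ⊢
  set s₀ := Finset.univ.filter (fun s : Fin T => s.val < n ∧ M * k < (s : ℕ) + 1) with hs₀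
  have h1 : UpperMean (sampleMeasure T ν)
      (fun z => (∑ i : Fin k, (plays M z n i - drift M z n i) ^ 2) + (k * (M * k) ^ 2 +
        n * ∑ s ∈ s₀, 4 * ∑ i, (rewardEstimate (hist M z s) i - meanReward ν i) ^ 2))
      ((∑ _i : Fin k, (n : ℝ)) + (k * (M * k) ^ 2 + n * ∑ s ∈ s₀, 4 * (E / (s : ℕ)))) := by
    refine (UpperMean.sum fun i _ => upperMean_sq_plays_sub_drift ν i hnT).add
      ((UpperMean.const _).add (UpperMean.const_mul (UpperMean.sum fun s hs =>
        (hE s ?_).const_mul (by norm_num)) hn0.le))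
    exact (Finset.mem_filter.1 hs).2.2
  refine ((h1.const_mul (c := 3 / (n : ℝ) ^ 2) (by positivity)).mono fun z => ?_).le_bound ?_
  · have h2 : sqDist M ν .action t z =
        1 / (n : ℝ) ^ 2 * ∑ i, (plays M z n i - n * target ν i) ^ 2 := by
      rw [sqDist, Finset.mul_sum]
      refine Finset.sum_congr rfl fun i _ => ?_
      simp only [perfExplicit]
      rw [hnc, ← hn]
      field_simp
    have h3 : ∑ i, (plays M z n i - n * target ν i) ^ 2 ≤
        3 * ((∑ i : Fin k, (plays M z n i - drift M z n i) ^ 2) + (k * (M * k) ^ 2 +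
        n * ∑ s ∈ s₀, 4 * ∑ i, (rewardEstimate (hist M z s) i - meanReward ν i) ^ 2)) := by
      refine (Finset.sum_le_sum fun i _ => sq_plays_sub_le ν hM0 hnT z i).trans ?_
      rw [← Finset.mul_sum, Finset.sum_add_distrib, Finset.sum_add_distrib, Finset.sum_const,
        Finset.card_univ, Fintype.card_fin, nsmul_eq_mul, ← Finset.mul_sum, Finset.sum_comm]
      have h4 : ∑ s ∈ s₀, ∑ i, (condProb M z s i - target ν i) ^ 2 ≤
          ∑ s ∈ s₀, 4 * ∑ i, (rewardEstimate (hist M z s) i - meanReward ν i) ^ 2 :=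
        Finset.sum_le_sum fun s hs =>
          sum_sq_condProb_sub_le ν z s (Finset.mem_filter.1 hs).2.2
      have h5 := mul_le_mul_of_nonneg_left h4 hn0.le
      linarith
    rw [h2]
    calc _ ≤ 1 / (n : ℝ) ^ 2 * _ := mul_le_mul_of_nonneg_left h3 (by positivity)
      _ = _ := by ring
  · have h2 : ∑ s ∈ s₀, 4 * (E / ((s : ℕ) : ℝ)) ≤ 4 * E * (1 + Real.log T) := by
      have h3 : ∑ s ∈ s₀, 4 * (E / ((s : ℕ) : ℝ)) = 4 * E * ∑ s ∈ s₀, 1 / ((s : ℕ) : ℝ) := by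
        rw [Finset.mul_sum]
        exact Finset.sum_congr rfl fun s _ => by ring
      rw [h3]
      refine mul_le_mul_of_nonneg_left ?_ (by positivity)
      refine (sum_inv_le_one_add_log (n := n) s₀ fun s hs => ?_).trans ?_
      · have := (Finset.mem_filter.1 hs).2
        exact ⟨one_le_of_exploration_lt hM this.2, this.1⟩
      · linarith [Real.log_le_log hn0 (Nat.cast_le.2 hnT : (n : ℝ) ≤ T)]
    -- Past the exploration phase `M * k ≤ n`, so the squared exploration term costs only one factor
    -- of `M` after division by `n ^ 2`.
    have h3 : (M * k) ^ 2 ≤ M * k * n := by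
      rw [sq]
      exact mul_le_mul_of_nonneg_left ht (by positivity)
    rw [Finset.sum_const, Finset.card_univ, Fintype.card_fin, nsmul_eq_mul, distConst,
      div_mul_eq_mul_div, div_le_div_iff₀ (by positivity) hn0]
    have h4 : (k : ℝ) * (M * k) ^ 2 ≤ k * (M * k * n) :=
      mul_le_mul_of_nonneg_left h3 (Nat.cast_nonneg k)
    have h5 := mul_le_mul_of_nonneg_left h2 hn0.le
    have h6 : (k : ℝ) * n + (k * (M * k) ^ 2 + n * ∑ s ∈ s₀, 4 * (E / ((s : ℕ) : ℝ))) ≤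
        n * (k + k * (M * k) + 4 * E * (1 + Real.log T)) := by linarith
    calc _ ≤ 3 * (n * (k + k * (M * k) + 4 * E * (1 + Real.log T))) * (n : ℝ) :=
          mul_le_mul_of_nonneg_right (mul_le_mul_of_nonneg_left h6 (by norm_num)) hn0.le
      _ = _ := by ring

theorem upperMean_sqDist (hM : 1 ≤ M) (hE0 : 0 ≤ E)
    (hE : ∀ s : Fin T, M * k < (s : ℕ) + 1 → UpperMean (sampleMeasure T ν)
      (fun z => ∑ i, (rewardEstimate (hist M z s) i - meanReward ν i) ^ 2) (E / (s : ℕ)))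
    (l : Level) (t : Fin T) :
    UpperMean (sampleMeasure T ν) (sqDist M ν l t) (distConst k T M E / ((t : ℕ) + 1)) := by
  have hk1 : (1 : ℝ) ≤ k := by exact_mod_cast NeZero.pos k
  have hlog : 0 ≤ Real.log T := Real.log_natCast_nonneg T
  have hMk : 0 ≤ M * k := by positivity
  have h1 : M * k ≤ k * (M * k) := le_mul_of_one_le_left hMk hk1
  have h2 : 0 ≤ E * Real.log T := mul_nonneg hE0 hlog
  have hexplore : ((t : ℕ) + 1 : ℝ) ≤ M * k →
      UpperMean (sampleMeasure T ν) (sqDist M ν l t) (distConst k T M E / ((t : ℕ) + 1)) := by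
    intro ht
    -- During exploration the trivial bound 2 suffices, because `t + 1 ≤ M * k` and `distConst`
    -- contains a multiple of `M * k`.
    refine ((UpperMean.const 2).mono fun z => sqDist_le_two ν l t z).le_bound ?_
    rw [le_div_iff₀ (by positivity), distConst]
    linarith
  rcases le_or_gt ((t : ℕ) + 1 : ℝ) (M * k) with ht | ht
  · exact hexplore ht
  · cases l
    · refine (upperMean_sqDist_policy_of_lt hM ht hE0 (hE t ht)).le_bound ?_
      refine div_le_div_of_nonneg_right ?_ (by positivity)
      rw [distConst]
      linarith
    · exact upperMean_sqDist_action_of_le hM ht.le hE0 hE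

end SquaredDistance

/-! ### Jensen's inequality for the distances -/

section Jensen

variable {k : ℕ}

theorem ofReal_integral_le_lintegral {Ω : Type*} [MeasurableSpace Ω] {μ : Measure Ω} {f : Ω → ℝ}
    (hf : Integrable f μ) : ENNReal.ofReal (∫ x, f x ∂μ) ≤ ∫⁻ x, ENNReal.ofReal (f x) ∂μ := by
  have h1 : ∫ x, f x ∂μ ≤ ∫ x, max (f x) 0 ∂μ :=
    integral_mono hf hf.pos_part fun x => le_max_left _ _
  refine (ENNReal.ofReal_le_ofReal h1).trans ?_
  rw [ofReal_integral_eq_lintegral_ofReal hf.pos_part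
    (Filter.Eventually.of_forall fun x => le_max_right _ _)]
  refine lintegral_mono fun x => ?_
  rw [ENNReal.ofReal_max]
  simp

/-- A function of `q` with a supporting affine function at the mean of `q` satisfies Jensen's
inequality. -/
theorem ofReal_le_lintegral_of_tangent {Ω : Type*} [MeasurableSpace Ω] {μ : Measure Ω}
    [IsProbabilityMeasure μ] {q : Ω → Fin k → ℝ} (hq : ∀ i, Integrable (fun x => q x i) μ)
    {a : ℝ} (c : Fin k → ℝ) {F : Ω → ℝ}
    (h : ∀ᵐ x ∂μ, a + ∑ i, c i * (q x i - ∫ y, q y i ∂μ) ≤ F x) :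
    ENNReal.ofReal a ≤ ∫⁻ x, ENNReal.ofReal (F x) ∂μ := by
  have h1 : ∀ i, Integrable (fun x => c i * (q x i - ∫ y, q y i ∂μ)) μ := fun i =>
    ((hq i).sub (integrable_const _)).const_mul _
  have h2 : Integrable (fun x => ∑ i, c i * (q x i - ∫ y, q y i ∂μ)) μ :=
    integrable_finsetSum _ fun i _ => h1 i
  have h3 : ∫ x, (a + ∑ i, c i * (q x i - ∫ y, q y i ∂μ)) ∂μ = a := by
    rw [integral_add (integrable_const _) h2, integral_finsetSum _ fun i _ => h1 i]
    simp [integral_const_mul, integral_sub (hq _) (integrable_const _)]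
  calc ENNReal.ofReal a = ENNReal.ofReal (∫ x, (a + ∑ i, c i * (q x i - ∫ y, q y i ∂μ)) ∂μ) := by
        rw [h3]
    _ ≤ ∫⁻ x, ENNReal.ofReal (a + ∑ i, c i * (q x i - ∫ y, q y i ∂μ)) ∂μ :=
        ofReal_integral_le_lintegral ((integrable_const a).add h2)
    _ ≤ _ := lintegral_mono_ae (h.mono fun x hx => ENNReal.ofReal_le_ofReal hx)

/-- Jensen's inequality holds for the distance `d` to `p` on vectors that lie in `D`. -/
def JensenOn (d : (Fin k → ℝ) → (Fin k → ℝ) → ℝ≥0∞) (p : Fin k → ℝ) (D : Set (Fin k → ℝ)) : Prop :=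
  ∀ (Ω : Type) [MeasurableSpace Ω] (μ : Measure Ω) [IsProbabilityMeasure μ] (q : Ω → Fin k → ℝ),
    (∀ i, Measurable fun x => q x i) → (∀ x, q x ∈ D) →
      d (fun i => ∫ x, q x i ∂μ) p ≤ ∫⁻ x, d (q x) p ∂μ

/-- The vectors with entries in `[0, 1]`. -/
def unitCube (k : ℕ) : Set (Fin k → ℝ) := {q | ∀ i, 0 ≤ q i ∧ q i ≤ 1}

/-- The vectors with entries in `(0, 1]`. -/
def posUnitCube (k : ℕ) : Set (Fin k → ℝ) := {q | ∀ i, 0 < q i ∧ q i ≤ 1}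

theorem integrable_of_mem_unitCube {Ω : Type*} [MeasurableSpace Ω] {μ : Measure Ω}
    [IsProbabilityMeasure μ] {q : Ω → Fin k → ℝ} (hm : ∀ i, Measurable fun x => q x i)
    (hq : ∀ x, q x ∈ unitCube k) (i : Fin k) : Integrable (fun x => q x i) μ :=
  Integrable.of_bound (hm i).aestronglyMeasurable 1 (Filter.Eventually.of_forall fun x => by
    rw [Real.norm_eq_abs, abs_of_nonneg (hq x i).1]
    exact (hq x i).2)

theorem jensenOn_distTV (p : Fin k → ℝ) : JensenOn distTV p (unitCube k) := by
  intro Ω _ μ _ q hm hq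
  have hint := integrable_of_mem_unitCube (μ := μ) hm hq
  refine ofReal_le_lintegral_of_tangent hint
    -- The sign vector is a subgradient of the `ℓ¹` norm; at 0 the sign is 0, which is also a valid
    -- choice.
    (fun i => 1 / 2 * (SignType.sign ((∫ y, q y i ∂μ) - p i) : ℝ))
    (Filter.Eventually.of_forall fun x => ?_)
  rw [Finset.mul_sum, Finset.mul_sum, ← Finset.sum_add_distrib]
  refine Finset.sum_le_sum fun i _ => ?_
  set m := ∫ y, q y i ∂μ
  rcases lt_trichotomy (m - p i) 0 with h | h | h
  · rw [sign_neg h, abs_of_neg h]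
    simp only [SignType.coe_neg, SignType.coe_one]
    linarith [neg_abs_le (q x i - p i)]
  · rw [h]
    simp
  · rw [sign_pos h, abs_of_pos h]
    simp only [SignType.coe_one]
    linarith [le_abs_self (q x i - p i)]

/-- Convexity of `x * log (x / p)`: the gap to the tangent at `m` is `q * log (q / m) - (q - m)`,
which is nonnegative. -/
theorem mul_log_tangent {q m p : ℝ} (hq : 0 ≤ q) (hm : 0 < m) (hp : 0 < p) :
    m * Real.log (m / p) + (Real.log (m / p) + 1) * (q - m) ≤ q * Real.log (q / p) := by
  rcases hq.eq_or_lt with h | h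
  · rw [← h]
    simp only [zero_mul]
    linarith
  · have h1 := Real.one_sub_inv_le_log_of_pos (div_pos h hm)
    have h2 : Real.log (q / p) = Real.log (q / m) + Real.log (m / p) := by
      rw [← Real.log_mul (div_pos h hm).ne' (div_pos hm hp).ne']
      congr 1
      field_simp
    have h3 := mul_le_mul_of_nonneg_left h1 hq
    have h4 : q * (1 - (q / m)⁻¹) = q - m := by field_simp
    rw [h2]
    linarith

theorem log_div_tangent {q m p : ℝ} (hq : 0 < q) (hm : 0 < m) (hp : 0 < p) :
    p * Real.log (p / m) + -(p / m) * (q - m) ≤ p * Real.log (p / q) := by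
  have h1 := Real.one_sub_inv_le_log_of_pos (div_pos hm hq)
  have h2 : Real.log (p / q) = Real.log (m / q) + Real.log (p / m) := by
    rw [← Real.log_mul (div_pos hm hq).ne' (div_pos hp hm).ne']
    congr 1
    field_simp
  have h3 := mul_le_mul_of_nonneg_left h1 hp.le
  have h4 : p * (1 - (m / q)⁻¹) = -(p / m) * (q - m) := by field_simp; ring
  rw [h2]
  linarith

theorem jensenOn_distRKL {p : Fin k → ℝ} (hp : ∀ i, 0 < p i) :
    JensenOn distRKL p (unitCube k) := by
  intro Ω _ μ _ q hm hq
  have hint := integrable_of_mem_unitCube (μ := μ) hm hq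
  simp only [distRKL, klVec_eq_ofReal hp]
  refine ofReal_le_lintegral_of_tangent hint
    (fun i => Real.log ((∫ y, q y i ∂μ) / p i) + 1) ?_
  -- Where the mean of an entry vanishes there is no finite tangent slope, but then the nonnegative
  -- entry is zero almost everywhere and the coordinate contributes nothing.
  have h0 : ∀ i, ∀ᵐ x ∂μ, (∫ y, q y i ∂μ) = 0 → q x i = 0 := by
    intro i
    by_cases h : ∫ y, q y i ∂μ = 0
    · have := (integral_eq_zero_iff_of_nonneg (fun x => (hq x i).1) (hint i)).1 h
      exact this.mono fun x hx _ => hx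
    · exact Filter.Eventually.of_forall fun x hx => absurd hx h
  filter_upwards [ae_all_iff.2 h0] with x hx
  rw [klReal, klReal, ← Finset.sum_add_distrib]
  refine Finset.sum_le_sum fun i _ => ?_
  have hm0 : 0 ≤ ∫ y, q y i ∂μ := integral_nonneg fun y => (hq y i).1
  rcases hm0.eq_or_lt with h | h
  · rw [hx i h.symm, ← h]
    simp
  · exact mul_log_tangent (hq x i).1 h (hp i)

theorem jensenOn_distFKL {p : Fin k → ℝ} (hp : ∀ i, 0 < p i) :
    JensenOn distFKL p (posUnitCube k) := by
  intro Ω _ μ _ q hm hq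
  have hint := integrable_of_mem_unitCube (μ := μ) hm fun x i => ⟨(hq x i).1.le, (hq x i).2⟩
  have hpos : ∀ i, 0 < ∫ y, q y i ∂μ := by
    intro i
    rw [integral_pos_iff_support_of_nonneg (fun x => (hq x i).1.le) (hint i)]
    have : Function.support (fun x => q x i) = Set.univ :=
      Set.eq_univ_of_forall fun x => (hq x i).1.ne'
    rw [this]
    simp
  have e : ∀ x, distFKL (q x) p = ENNReal.ofReal (klReal p (q x)) := fun x =>
    klVec_eq_ofReal fun i => (hq x i).1
  have e2 : distFKL (fun i => ∫ x, q x i ∂μ) p =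
      ENNReal.ofReal (klReal p fun i => ∫ x, q x i ∂μ) := klVec_eq_ofReal hpos
  simp only [e, e2]
  refine ofReal_le_lintegral_of_tangent hint (fun i => -(p i / ∫ y, q y i ∂μ))
    (Filter.Eventually.of_forall fun x => ?_)
  rw [klReal, klReal, ← Finset.sum_add_distrib]
  exact Finset.sum_le_sum fun i _ => log_div_tangent (hq x i).1 (hpos i) (hp i)

end Jensen

/-! ### Regrets in terms of the explicit performance distributions -/

section Regret

variable {T k : ℕ} [NeZero k] {M : ℝ}

theorem actionDist_eq (t : Fin T) (z : Sample T k) (i : Fin k) :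
    (ase T k M).actionDist t z i = perfExplicit M .action t z i := by
  have h : (Finset.univ.filter fun s : Fin T => s ≤ t ∧ arm M z s = i) =
      Finset.univ.filter fun s : Fin T => s.val < t + 1 ∧ arm M z s = i := by
    ext s
    simp only [Finset.mem_filter, Finset.mem_univ, true_and, Fin.le_def, Nat.lt_succ_iff]
  change ((Finset.univ.filter fun s : Fin T => s ≤ t ∧ arm M z s = i).card : ℝ) / ((t : ℕ) + 1) = _
  rw [h]
  simp only [perfExplicit, plays_eq_card]

/-- The event lies in the past of step `t + 1`, so it survives resampling the seed, and the seed can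
be integrated out first. This is the defining property of the conditional expectation in
`policyDist`. -/
theorem setLIntegral_arm_eq (ν : Environment k) (t : Fin T) (i : Fin k) {A : Set (History k t)}
    (hA : MeasurableSet A) :
    ∫⁻ z in (fun z => hist M z t) ⁻¹' A, ENNReal.ofReal (if arm M z t = i then 1 else 0)
        ∂sampleMeasure T ν =
      ∫⁻ z in (fun z => hist M z t) ⁻¹' A, ENNReal.ofReal (condProb M z t i)
        ∂sampleMeasure T ν := by
  classical
  have hs := measurable_hist (M := M) t hA
  have hm : Measurable fun z : Sample T k => ENNReal.ofReal (if arm M z t = i then 1 else 0) :=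
    (Measurable.ite (measurableSet_arm_eq t i) measurable_const measurable_const).ennreal_ofReal
  rw [← lintegral_indicator hs, ← lintegral_indicator hs,
    lintegral_updateSeed ν (hm.indicator hs) t]
  refine lintegral_congr fun z => ?_
  simp only [Set.indicator_apply, Set.mem_preimage, hist_updateSeed le_rfl]
  split_ifs with h
  · have e : ∀ u, ENNReal.ofReal (if arm M (updateSeed z t u) t = i then 1 else 0) =
        if arm M (updateSeed z t u) t = i then 1 else 0 := by
      intro u
      split_ifs <;> simp
    simp only [e]
    rw [lintegral_ite_arm]
    simp
  · simp

theorem condExp_arm_ae_eq (ν : Environment k) (t : Fin T) (i : Fin k) :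
    (fun z => condProb M z t i) =ᵐ[sampleMeasure T ν]
      (sampleMeasure T ν)[fun z : Sample T k => if arm M z t = i then (1 : ℝ) else 0 |
        MeasurableSpace.comap (fun z => hist M z t) inferInstance] := by
  have hcm := measurable_condProb (T := T) (M := M) t i
  have hci : Integrable (fun z => condProb M z t i) (sampleMeasure T ν) :=
    Integrable.of_bound hcm.aestronglyMeasurable 1 (Filter.Eventually.of_forall fun z => by
      rw [Real.norm_eq_abs, abs_of_nonneg (condProb_nonneg z t i)]
      exact condProb_le_one z t i)
  have hfm : Measurable fun z : Sample T k => if arm M z t = i then (1 : ℝ) else 0 :=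
    Measurable.ite (measurableSet_arm_eq t i) measurable_const measurable_const
  have hf0 : ∀ z : Sample T k, (0 : ℝ) ≤ if arm M z t = i then (1 : ℝ) else 0 := fun z => by
    positivity
  have hfi : Integrable (fun z : Sample T k => if arm M z t = i then (1 : ℝ) else 0)
      (sampleMeasure T ν) :=
    Integrable.of_bound hfm.aestronglyMeasurable 1 (Filter.Eventually.of_forall fun z => by
      split_ifs <;> simp)
  refine ae_eq_condExp_of_forall_setIntegral_eq (measurable_hist t).comap_le hfi
    (fun s _ _ => hci.integrableOn) ?_ ?_
  · rintro s ⟨A, hA, rfl⟩ _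
    rw [integral_eq_lintegral_of_nonneg_ae
        (Filter.Eventually.of_forall fun z => condProb_nonneg z t i) hcm.aestronglyMeasurable,
      integral_eq_lintegral_of_nonneg_ae (Filter.Eventually.of_forall hf0)
        hfm.aestronglyMeasurable, setLIntegral_arm_eq ν t i hA]
  · exact ((measurable_armProb t i).comp (comap_measurable _)).aestronglyMeasurable

theorem perf_ae_eq (ν : Environment k) (l : Level) (t : Fin T) :
    ∀ᵐ z ∂sampleMeasure T ν, (ase T k M).perf ν l t z = perfExplicit M l t z := by
  cases l
  · have h : ∀ i, ∀ᵐ z ∂sampleMeasure T ν, condProb M z t i = (ase T k M).policyDist ν t z i :=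
      fun i => condExp_arm_ae_eq ν t i
    filter_upwards [ae_all_iff.2 h] with z hz
    exact funext fun i => (hz i).symm
  · exact Filter.Eventually.of_forall fun z => funext fun i => actionDist_eq t z i

/-- The plain and the environment version share the majorant `F`. For the latter, Fubini puts the
realization outside, and Jensen is applied to the seeds for each fixed realization. -/
theorem expectedRegret_le {ν : Environment k} {d : (Fin k → ℝ) → (Fin k → ℝ) → ℝ≥0∞}
    {D : Set (Fin k → ℝ)} (hJ : JensenOn d (target ν) D) {l : Level} {S : Finset (Fin T)}
    (hD : ∀ t ∈ S, ∀ z, perfExplicit M l t z ∈ D) {F : Fin T → Sample T k → ℝ}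
    (hF0 : ∀ t ∈ S, ∀ z, 0 ≤ F t z) (hFm : ∀ t ∈ S, Measurable (F t))
    (hdF : ∀ t ∈ S, ∀ z, d (perfExplicit M l t z) (target ν) ≤ ENNReal.ofReal (F t z))
    {b : Fin T → ℝ} (hb : ∀ t ∈ S, UpperMean (sampleMeasure T ν) (F t) (b t)) (a : Averaging) :
    (ase T k M).expectedRegret ν d l S a ≤ ENNReal.ofReal (∑ t ∈ S, b t) := by
  have hae : ∀ᵐ z : Sample T k ∂sampleMeasure T ν, ∀ t, (ase T k M).perf ν l t z = perfExplicit M l t z :=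
    ae_all_iff.2 fun t => perf_ae_eq ν l t
  have hsum : ∫⁻ z, ∑ t ∈ S, ENNReal.ofReal (F t z) ∂sampleMeasure T ν ≤
      ENNReal.ofReal (∑ t ∈ S, b t) := by
    have h1 := (UpperMean.sum hb).lintegral_le fun z => Finset.sum_nonneg fun t ht => hF0 t ht z
    refine le_trans (le_of_eq (lintegral_congr fun z => ?_)) h1
    exact (ENNReal.ofReal_sum_of_nonneg fun t ht => hF0 t ht z).symm
  cases a
  · refine le_trans ?_ hsum
    refine lintegral_mono_ae (μ := sampleMeasure T ν) ?_
    filter_upwards [hae] with z hz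
    refine Finset.sum_le_sum fun t ht => ?_
    rw [hz t]
    exact hdF t ht z
  · refine le_trans ?_ hsum
    have hm : Measurable fun z : Sample T k => ∑ t ∈ S, ENNReal.ofReal (F t z) :=
      Finset.measurable_sum _ fun t ht => (hFm t ht).ennreal_ofReal
    rw [sampleMeasure, lintegral_prod_symm _ hm.aemeasurable]
    -- The identification of `perf` with its explicit form holds only almost everywhere jointly; it
    -- has to be turned into a statement for almost every realization, so the factors are swapped
    -- first.
    have hae2 : ∀ᵐ w ∂realizationMeasure T ν,
        ∀ᵐ ω : Fin T → unitInterval ∂(Measure.pi fun _ : Fin T => (volume : Measure unitInterval)),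
          ∀ t, (ase T k M).perf ν l t (ω, w) = perfExplicit M l t (ω, w) := by
      have h2 : ∀ᵐ z : Realization T k × (Fin T → unitInterval) ∂(realizationMeasure T ν).prod
          (Measure.pi fun _ : Fin T => (volume : Measure unitInterval)),
          ∀ t, (ase T k M).perf ν l t (z.2, z.1) = perfExplicit M l t (z.2, z.1) :=
        Measure.measurePreserving_swap.quasiMeasurePreserving.ae hae
      exact Measure.ae_ae_of_ae_prod h2
    refine lintegral_mono_ae ?_
    filter_upwards [hae2] with w hw
    have h4 : ∀ t ∈ S, AEMeasurable (fun ω : Fin T → unitInterval =>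
        ENNReal.ofReal (F t (ω, w))) (Measure.pi fun _ : Fin T => (volume : Measure unitInterval)) :=
      fun t ht => ((hFm t ht).comp measurable_prodMk_right).ennreal_ofReal.aemeasurable
    rw [lintegral_finsetSum' _ h4]
    refine Finset.sum_le_sum fun t ht => ?_
    have h3 : (fun i => ∫ ω, (ase T k M).perf ν l t (ω, w) i ∂(ase T k M).prob) =
        fun i => ∫ ω, perfExplicit M l t (ω, w) i
          ∂(Measure.pi fun _ : Fin T => (volume : Measure unitInterval)) := by
      funext i
      refine integral_congr_ae ?_
      exact hw.mono fun ω h => by simp only [h t]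
    rw [h3]
    refine (hJ _ _ (fun ω : Fin T → unitInterval => perfExplicit M l t (ω, w)) (fun i =>
      (measurable_perfExplicit l t i).comp measurable_prodMk_right) fun ω => hD t ht _).trans ?_
    exact lintegral_mono fun ω => hdF t ht _

end Regret

/-! ### Regret bounds -/

section RegretBounds

variable {T k : ℕ} [NeZero k] {M α G E : ℝ} {ν : Environment k}

theorem perfExplicit_mem_unitCube (l : Level) (t : Fin T) (z : Sample T k) :
    perfExplicit M l t z ∈ unitCube k :=
  fun i => ⟨perfExplicit_nonneg l t z i, perfExplicit_le_one l t z i⟩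

/-- AM-GM in `distTV_le` with `η = √(t + 1)` makes the bound affine in the squared distance, and
this `η` balances the two terms when the mean is `G / (t + 1)`. -/
theorem expectedRegret_distTV_le {l : Level} {S : Finset (Fin T)}
    (h : ∀ t ∈ S, UpperMean (sampleMeasure T ν) (sqDist M ν l t) (G / ((t : ℕ) + 1)))
    (a : Averaging) :
    (ase T k M).expectedRegret ν distTV l S a ≤
      ENNReal.ofReal (∑ t ∈ S, (G + k) / 4 * (1 / √((t : ℕ) + 1))) := by
  have hpos : ∀ t : Fin T, 0 < √((t : ℕ) + 1 : ℝ) := fun t => Real.sqrt_pos.2 (by positivity)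
  refine expectedRegret_le (jensenOn_distTV _) (fun t _ z => perfExplicit_mem_unitCube l t z)
    (F := fun t z => 1 / 4 * (√((t : ℕ) + 1) * sqDist M ν l t z + k / √((t : ℕ) + 1)))
    ?_ ?_ ?_ ?_ a
  · intro t _ z
    have := sqDist_nonneg (M := M) ν l t z
    positivity
  · intro t _
    exact (((measurable_sqDist ν l t).const_mul _).add_const _).const_mul _
  · intro t _ z
    refine ENNReal.ofReal_le_ofReal ((distTV_le (hpos t)).trans (le_of_eq ?_))
    rw [sqDist]
    ring
  · intro t ht
    refine ((((h t ht).const_mul (hpos t).le).add (UpperMean.const _)).const_mul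
      (by norm_num)).le_bound (le_of_eq ?_)
    have h1 : √((t : ℕ) + 1 : ℝ) ^ 2 = (t : ℕ) + 1 := Real.sq_sqrt (by positivity)
    have h2 := (hpos t).ne'
    rw [← h1]
    rw [Real.sqrt_sq (hpos t).le]
    field_simp

theorem expectedRegret_distRKL_le (hα : 0 < α) (hp : ∀ i, α ≤ target ν i)
    {l : Level} {S : Finset (Fin T)}
    (h : ∀ t ∈ S, UpperMean (sampleMeasure T ν) (sqDist M ν l t) (G / ((t : ℕ) + 1)))
    (a : Averaging) :
    (ase T k M).expectedRegret ν distRKL l S a ≤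
      ENNReal.ofReal (∑ t ∈ S, G / α * (1 / ((t : ℕ) + 1))) := by
  have hp0 : ∀ i, 0 < target ν i := fun i => hα.trans_le (hp i)
  refine expectedRegret_le (jensenOn_distRKL hp0) (fun t _ z => perfExplicit_mem_unitCube l t z)
    (F := fun t z => 1 / α * sqDist M ν l t z) ?_ ?_ ?_ ?_ a
  · intro t _ z
    have := sqDist_nonneg (M := M) ν l t z
    positivity
  · intro t _
    exact (measurable_sqDist ν l t).const_mul _
  · intro t _ z
    rw [distRKL, klVec_eq_ofReal hp0]
    exact ENNReal.ofReal_le_ofReal (klReal_le_of_lower_bound hα (perfExplicit_nonneg l t z) hp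
      (sum_perfExplicit l t z) (sum_softmax _))
  · intro t ht
    exact ((h t ht).const_mul (by positivity)).le_bound (le_of_eq (by ring))

theorem expectedRegret_distFKL_policy_le (hM : 1 ≤ M) {S : Finset (Fin T)}
    (hS : ∀ t ∈ S, M * k < (t : ℕ) + 1) (hE0 : 0 ≤ E)
    (hE : ∀ s : Fin T, M * k < (s : ℕ) + 1 → UpperMean (sampleMeasure T ν)
      (fun z => ∑ i, (rewardEstimate (hist M z s) i - meanReward ν i) ^ 2) (E / (s : ℕ)))
    (a : Averaging) :
    (ase T k M).expectedRegret ν distFKL .policy S a ≤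
      ENNReal.ofReal (∑ t ∈ S, 4 * E * (1 / ((t : ℕ) + 1))) := by
  have he : ∀ t ∈ S, ∀ z : Sample T k,
      perfExplicit M .policy t z = softmax (rewardEstimate (hist M z t)) := fun t ht z =>
    funext fun i => by
      simp only [perfExplicit]
      rw [condProb, armProb, if_neg (not_le.2 (hS t ht))]
  refine expectedRegret_le (jensenOn_distFKL fun i => softmax_pos _ i) (fun t ht z i => ?_)
    (F := fun t z => 2 * ∑ i, (rewardEstimate (hist M z t) i - meanReward ν i) ^ 2) ?_ ?_ ?_ ?_ a
  · rw [he t ht z]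
    exact ⟨softmax_pos _ i, softmax_le_one _ i⟩
  · intro t _ z
    positivity
  · intro t _
    exact (Finset.measurable_sum _ fun i _ => (((measurable_rewardEstimate i).comp
      (measurable_hist t)).sub_const _).pow_const 2).const_mul _
  · intro t ht z
    rw [he t ht z, distFKL, klVec_eq_ofReal fun i => softmax_pos _ i]
    exact ENNReal.ofReal_le_ofReal (klReal_softmax_le _ _)
  · intro t ht
    refine ((hE t (hS t ht)).const_mul (by norm_num)).le_bound ?_
    have ht1 : (1 : ℝ) ≤ (t : ℕ) := by exact_mod_cast one_le_of_exploration_lt hM (hS t ht)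
    rw [mul_one_div, ← mul_div_assoc, div_le_div_iff₀ (by linarith) (by linarith)]
    nlinarith

/-- From time `k` on every arm has been played, so each frequency is at least `1 / (t + 1)`; this
makes forward KL finite and `klReal_forward_le` applicable. -/
theorem expectedRegret_distFKL_action_le (hM : 1 ≤ M) (hα : 0 < α) (hp : ∀ i, α ≤ target ν i)
    {S : Finset (Fin T)} (hS : ∀ t ∈ S, k ≤ (t : ℕ) + 1)
    (h : ∀ t ∈ S, UpperMean (sampleMeasure T ν) (sqDist M ν .action t) (G / ((t : ℕ) + 1)))
    (a : Averaging) :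
    (ase T k M).expectedRegret ν distFKL .action S a ≤
      ENNReal.ofReal (∑ t ∈ S, (2 / α + 4 * Real.log T / α ^ 2) * G * (1 / ((t : ℕ) + 1))) := by
  have hp0 : ∀ i, 0 < target ν i := fun i => hα.trans_le (hp i)
  have hlog : 0 ≤ Real.log T := Real.log_natCast_nonneg T
  have hlow : ∀ t ∈ S, ∀ (z : Sample T k) i,
      1 / ((t + 1 : ℕ) : ℝ) ≤ perfExplicit M .action t z i := by
    intro t ht z i
    simp only [perfExplicit]
    push_cast
    refine div_le_div_of_nonneg_right ?_ (by positivity)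
    exact_mod_cast floor_le_plays (M := M) z i (m := 1) (by exact_mod_cast hM) t.2
      (by rw [one_mul]; exact hS t ht)
  have hpos : ∀ t ∈ S, ∀ (z : Sample T k) i, 0 < perfExplicit M .action t z i := fun t ht z i =>
    lt_of_lt_of_le (by positivity) (hlow t ht z i)
  refine expectedRegret_le (jensenOn_distFKL hp0)
    (fun t ht z i => ⟨hpos t ht z i, perfExplicit_le_one _ t z i⟩)
    (F := fun t z => (2 / α + 4 * Real.log T / α ^ 2) * sqDist M ν .action t z) ?_ ?_ ?_ ?_ a
  · intro t _ z
    have := sqDist_nonneg (M := M) ν .action t z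
    positivity
  · intro t _
    exact (measurable_sqDist ν .action t).const_mul _
  · intro t ht z
    rw [distFKL, klVec_eq_ofReal (hpos t ht z)]
    refine ENNReal.ofReal_le_ofReal (klReal_forward_le hα (n := t + 1) (by omega) ?_
      (hlow t ht z) hp (sum_perfExplicit _ t z) (sum_softmax _))
    refine Real.log_le_log (by positivity) ?_
    exact_mod_cast t.2
  · intro t ht
    exact ((h t ht).const_mul (by positivity)).le_bound (le_of_eq (by ring))

/-! ### Sums over time and assembly of the bounds -/

theorem sum_lastStep (hT : 0 < T) (f : ℝ → ℝ) : ∑ t ∈ lastStep T, f ((t : ℕ) + 1) = f T := by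
  have h : lastStep T = {⟨T - 1, by omega⟩} := by
    ext t
    simp only [lastStep, Finset.mem_filter, Finset.mem_univ, true_and, Finset.mem_singleton,
      Fin.ext_iff]
    omega
  rw [h, Finset.sum_singleton]
  congr 1
  simp only
  rw [Nat.cast_sub hT]
  simp

theorem sum_one_div_succ_le (S : Finset (Fin T)) :
    ∑ t ∈ S, 1 / (((t : ℕ) : ℝ) + 1) ≤ 1 + Real.log T := by
  refine le_trans ?_ (harmonic_le_one_add_log T)
  rw [harmonic]
  push_cast
  rw [← Fin.sum_univ_eq_sum_range (fun j : ℕ => ((j : ℝ) + 1)⁻¹)]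
  simp only [one_div]
  exact Finset.sum_le_sum_of_subset_of_nonneg (Finset.subset_univ S) fun _ _ _ => by positivity

theorem sum_one_div_sqrt_le (n : ℕ) : ∑ j ∈ Finset.range n, 1 / √((j : ℝ) + 1) ≤ 2 * √(n : ℝ) := by
  induction n with
  | zero => simp
  | succ n ih =>
    rw [Finset.sum_range_succ]
    push_cast
    have h1 : 0 < √((n : ℝ) + 1) := Real.sqrt_pos.2 (by positivity)
    have h2 : √((n : ℝ) + 1) ^ 2 = n + 1 := Real.sq_sqrt (by positivity)
    have h3 : √(n : ℝ) ^ 2 = n := Real.sq_sqrt (by positivity)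
    have h4 : 1 / √((n : ℝ) + 1) ≤ 2 * √((n : ℝ) + 1) - 2 * √(n : ℝ) := by
      rw [div_le_iff₀ h1]
      nlinarith [sq_nonneg (√((n : ℝ) + 1) - √(n : ℝ))]
    linarith

/-- Numerical conditions under which `g` is an admissible factor in all bounds. -/
structure IsAdmissibleFactor (k T : ℕ) (α G E g : ℝ) : Prop where
  tv : G + k ≤ g
  rkl : G / α * (1 + Real.log T) ≤ g
  policy_fkl : 4 * E * (1 + Real.log T) ≤ g
  action_fkl : (2 / α + 4 * Real.log T / α ^ 2) * G * (1 + Real.log T) ≤ g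

theorem le_of_mul_one_add_log_le {x g : ℝ} (hx : 0 ≤ x) (h : x * (1 + Real.log T) ≤ g) : x ≤ g :=
  (le_mul_of_one_le_right hx (by linarith [Real.log_natCast_nonneg T])).trans h

theorem expectedRegret_lastStep_le (hT : 0 < T) {d : (Fin k → ℝ) → (Fin k → ℝ) → ℝ≥0∞}
    {l : Level} {a : Averaging} {x g : ℝ} (hxg : x ≤ g)
    (h : (ase T k M).expectedRegret ν d l (lastStep T) a ≤
      ENNReal.ofReal (∑ t ∈ lastStep T, x * (1 / ((t : ℕ) + 1)))) :
    (ase T k M).expectedRegret ν d l (lastStep T) a ≤ ENNReal.ofReal (g * (T : ℝ)⁻¹) := by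
  refine h.trans (ENNReal.ofReal_le_ofReal ?_)
  rw [sum_lastStep hT fun y => x * (1 / y), one_div]
  exact mul_le_mul_of_nonneg_right hxg (by positivity)

theorem expectedRegret_distTV_lastStep_le (hT : 0 < T) {l : Level} {a : Averaging} {g : ℝ}
    (hG : 0 ≤ G) (hg : G + k ≤ g)
    (h : (ase T k M).expectedRegret ν distTV l (lastStep T) a ≤
      ENNReal.ofReal (∑ t ∈ lastStep T, (G + k) / 4 * (1 / √((t : ℕ) + 1)))) :
    (ase T k M).expectedRegret ν distTV l (lastStep T) a ≤
      ENNReal.ofReal (g * (T : ℝ) ^ (-(1 / 2) : ℝ)) := by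
  refine h.trans (ENNReal.ofReal_le_ofReal ?_)
  rw [sum_lastStep hT fun y => (G + k) / 4 * (1 / √y), Real.rpow_neg (Nat.cast_nonneg T),
    ← Real.sqrt_eq_rpow, one_div]
  have : (0 : ℝ) ≤ k := Nat.cast_nonneg k
  exact mul_le_mul_of_nonneg_right (by linarith) (by positivity)

theorem simplePolicyBounds_of_estimation (σ : ℝ≥0) (hT : 0 < T) (hM : 1 ≤ M) (hα : 0 < α)
    (hp : ∀ i, α ≤ target ν i) (hE0 : 0 ≤ E)
    (hE : ∀ s : Fin T, M * k < (s : ℕ) + 1 → UpperMean (sampleMeasure T ν)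
      (fun z => ∑ i, (rewardEstimate (hist M z s) i - meanReward ν i) ^ 2) (E / (s : ℕ)))
    {g : ℝ} (hg : IsAdmissibleFactor k T α (8 * E) E g) : SimplePolicyBounds σ ν T M g := by
  intro hMT a
  have hlast : ∀ t ∈ lastStep T, M * k < (t : ℕ) + 1 := by
    intro t ht
    have : (t : ℕ) + 1 = T := (Finset.mem_filter.1 ht).2
    rw [← this] at hMT
    exact_mod_cast hMT
  have hV : ∀ t ∈ lastStep T,
      UpperMean (sampleMeasure T ν) (sqDist M ν .policy t) (8 * E / ((t : ℕ) + 1)) := fun t ht =>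
    upperMean_sqDist_policy_of_lt hM (hlast t ht) hE0 (hE t (hlast t ht))
  refine ⟨expectedRegret_distTV_lastStep_le hT (by positivity) hg.tv
      (expectedRegret_distTV_le hV a),
    expectedRegret_lastStep_le hT (le_of_mul_one_add_log_le (by positivity) hg.rkl)
      (expectedRegret_distRKL_le hα hp hV a), fun _ =>
    expectedRegret_lastStep_le hT (le_of_mul_one_add_log_le (by positivity) hg.policy_fkl)
      (expectedRegret_distFKL_policy_le hM hlast hE0 hE a)⟩

theorem simpleActionBounds_of_estimation (σ : ℝ≥0) (hT : 0 < T) (hkT : k ≤ T) (hM : 1 ≤ M)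
    (hα : 0 < α) (hp : ∀ i, α ≤ target ν i) (hG : 0 ≤ G)
    (hV : ∀ t : Fin T,
      UpperMean (sampleMeasure T ν) (sqDist M ν .action t) (G / ((t : ℕ) + 1)))
    {g : ℝ} (hg : IsAdmissibleFactor k T α G E g) : SimpleActionBounds σ ν T M g := by
  intro a
  have hlog : 0 ≤ Real.log T := Real.log_natCast_nonneg T
  have hlast : ∀ t ∈ lastStep T, k ≤ (t : ℕ) + 1 := by
    intro t ht
    rwa [(Finset.mem_filter.1 ht).2]
  exact ⟨expectedRegret_distTV_lastStep_le hT hG hg.tv (expectedRegret_distTV_le (fun t _ => hV t) a),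
    expectedRegret_lastStep_le hT (le_of_mul_one_add_log_le (by positivity) hg.rkl)
      (expectedRegret_distRKL_le hα hp (fun t _ => hV t) a), fun _ =>
    expectedRegret_lastStep_le hT (le_of_mul_one_add_log_le (by positivity) hg.action_fkl)
      (expectedRegret_distFKL_action_le hM hα hp hlast (fun t _ => hV t) a)⟩

theorem cumulativeBounds_of_estimation (σ : ℝ≥0) (hM : 1 ≤ M)
    (hα : 0 < α) (hp : ∀ i, α ≤ target ν i) (hE0 : 0 ≤ E)
    (hE : ∀ s : Fin T, M * k < (s : ℕ) + 1 → UpperMean (sampleMeasure T ν)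
      (fun z => ∑ i, (rewardEstimate (hist M z s) i - meanReward ν i) ^ 2) (E / (s : ℕ)))
    (hG : 0 ≤ G) (hV : ∀ (l : Level) (t : Fin T),
      UpperMean (sampleMeasure T ν) (sqDist M ν l t) (G / ((t : ℕ) + 1)))
    {g : ℝ} (hg : IsAdmissibleFactor k T α G E g) : CumulativeBounds σ ν T M g := by
  intro l a
  have hlog : 0 ≤ Real.log T := Real.log_natCast_nonneg T
  have hsum : ∀ (S : Finset (Fin T)) {x : ℝ}, 0 ≤ x → x * (1 + Real.log T) ≤ g →
      ENNReal.ofReal (∑ t ∈ S, x * (1 / ((t : ℕ) + 1))) ≤ ENNReal.ofReal g := by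
    intro S x hx hxg
    rw [← Finset.mul_sum]
    exact ENNReal.ofReal_le_ofReal
      ((mul_le_mul_of_nonneg_left (sum_one_div_succ_le S) hx).trans hxg)
  refine ⟨?_, ?_, fun _ => ?_⟩
  · refine (expectedRegret_distTV_le (fun t _ => hV l t) a).trans (ENNReal.ofReal_le_ofReal ?_)
    have h1 : ∑ t ∈ allSteps T, 1 / √(((t : ℕ) : ℝ) + 1) ≤ 2 * √(T : ℝ) := by
      rw [allSteps, Fin.sum_univ_eq_sum_range (fun j : ℕ => 1 / √((j : ℝ) + 1))]
      exact sum_one_div_sqrt_le T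
    have hk0 : (0 : ℝ) ≤ k := Nat.cast_nonneg k
    rw [← Finset.mul_sum, ← Real.sqrt_eq_rpow]
    have hGk : 0 ≤ (G + k) / 4 := by positivity
    calc _ ≤ (G + k) / 4 * (2 * √(T : ℝ)) := mul_le_mul_of_nonneg_left h1 hGk
      _ = (G + k) / 2 * √(T : ℝ) := by ring
      _ ≤ g * √(T : ℝ) :=
        mul_le_mul_of_nonneg_right (by linarith [hg.tv]) (Real.sqrt_nonneg _)
  · exact (expectedRegret_distRKL_le hα hp (fun t _ => hV l t) a).trans
      (hsum _ (by positivity) hg.rkl)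
  · cases l
    · exact (expectedRegret_distFKL_policy_le hM
        (fun t ht => by simpa [fklSteps] using ht) hE0 hE a).trans
        (hsum _ (by positivity) hg.policy_fkl)
    · exact (expectedRegret_distFKL_action_le hM hα hp
        (fun t ht => by simpa [fklSteps] using ht) (fun t _ => hV .action t) a).trans
        (hsum _ (by positivity) hg.action_fkl)

omit [NeZero k] in
/-- The growth of the constants in the horizon and in the exploration factor. -/
theorem exists_admissibleFactor (σ : ℝ) (hα : 0 < α) :
    ∃ c : ℝ, 0 ≤ c ∧ ∀ (T : ℕ) (M B : ℝ), 1 ≤ M → 0 ≤ B →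
      IsAdmissibleFactor k T α (8 * errorConst k T σ α B) (errorConst k T σ α B)
        (c * (1 + Real.log T) ^ 5 * Real.exp (2 * B)) ∧
      IsAdmissibleFactor k T α (distConst k T M (errorConst k T σ α B)) (errorConst k T σ α B)
        (c * M * (1 + Real.log T) ^ 5 * Real.exp (2 * B)) := by
  set c₁ : ℝ := k * (12 * σ ^ 2 * (2 * k + 12 / α) + 48 * σ ^ 4 + 3 * k) with hc₁
  set c₂ : ℝ := 3 * (k + k * k + 4 * c₁) with hc₂
  have h1 : 0 ≤ c₁ := by positivity
  have h2 : 0 ≤ c₂ := by positivity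
  have h12 : 8 * c₁ ≤ c₂ := by
    have : (0 : ℝ) ≤ k + k * k := by positivity
    linarith
  set c : ℝ := c₂ + k + c₂ / α + (2 / α + 4 / α ^ 2) * c₂ with hc
  have hcb : c₂ + k ≤ c ∧ c₂ / α ≤ c ∧ (2 / α + 4 / α ^ 2) * c₂ ≤ c ∧ c₂ ≤ c := by
    have a1 : 0 ≤ c₂ / α := by positivity
    have a2 : 0 ≤ (2 / α + 4 / α ^ 2) * c₂ := by positivity
    have a3 : (0 : ℝ) ≤ k := by positivity
    refine ⟨?_, ?_, ?_, ?_⟩ <;> linarith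
  refine ⟨c, by positivity, fun T M B hM hB => ?_⟩
  set l := Real.log T with hl
  have hl0 : 0 ≤ l := Real.log_natCast_nonneg T
  set X := 1 + l with hX
  have hX1 : 1 ≤ X := by linarith
  set Y := Real.exp (2 * B) with hY
  have hY1 : 1 ≤ Y := Real.one_le_exp (by linarith)
  set E := errorConst k T σ α B with hE
  have hE1 : E = k * (2 * σ ^ 2 * (6 * l) * (2 * k + 2 * (1 + 6 * l) / α * Y) + 48 * σ ^ 4 +
      3 * k) := by
    rw [hE, errorConst, ← hl, Real.exp_neg, ← hY]
    have : Y ≠ 0 := by positivity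
    field_simp
  have hE0 : 0 ≤ E := by rw [hE1]; positivity
  have hXY : 1 ≤ X ^ 2 * Y := one_le_mul_of_one_le_of_one_le (one_le_pow₀ hX1) hY1
  -- `E` is quadratic in `log T` and linear in `exp (2 * B)`. Each remaining constant is multiplied
  -- by `X ^ 2 * Y ≥ 1`.
  have hEc : E ≤ c₁ * (X ^ 2 * Y) := by
    rw [hE1, hc₁, mul_assoc (k : ℝ) (_ + _ + _)]
    refine mul_le_mul_of_nonneg_left ?_ (by positivity)
    have b1 : 2 * (k : ℝ) + 2 * (1 + 6 * l) / α * Y ≤ (2 * k + 12 / α) * (X * Y) := by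
      have e1 : (1 : ℝ) ≤ X * Y := one_le_mul_of_one_le_of_one_le hX1 hY1
      have e2 : 2 * (k : ℝ) ≤ 2 * k * (X * Y) := le_mul_of_one_le_right (by positivity) e1
      have e3 : 2 * (1 + 6 * l) / α ≤ 12 / α * X := by
        rw [div_mul_eq_mul_div]
        exact div_le_div_of_nonneg_right (by linarith) hα.le
      have e4 := mul_le_mul_of_nonneg_right e3 (zero_le_one.trans hY1)
      linarith
    have b2 : 2 * σ ^ 2 * (6 * l) ≤ 12 * σ ^ 2 * X := by
      have : 12 * σ ^ 2 * l ≤ 12 * σ ^ 2 * X :=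
        mul_le_mul_of_nonneg_left (by linarith) (by positivity)
      linarith
    have b3 : 2 * σ ^ 2 * (6 * l) * (2 * k + 2 * (1 + 6 * l) / α * Y) ≤
        12 * σ ^ 2 * X * ((2 * k + 12 / α) * (X * Y)) :=
      mul_le_mul b2 b1 (by positivity) (by positivity)
    have b4 : 48 * σ ^ 4 + 3 * (k : ℝ) ≤ (48 * σ ^ 4 + 3 * k) * (X ^ 2 * Y) :=
      le_mul_of_one_le_right (by positivity) hXY
    linarith
  have hpow : ∀ m ≤ 5, X ^ m ≤ X ^ 5 := fun m hm => pow_le_pow_right₀ hX1 hm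
  have hl4 : 2 / α + 4 * l / α ^ 2 ≤ (2 / α + 4 / α ^ 2) * X := by
    have e1 : 2 / α ≤ 2 / α * X := le_mul_of_one_le_right (by positivity) hX1
    have e2 : 4 * l / α ^ 2 ≤ 4 / α ^ 2 * X := by
      rw [div_mul_eq_mul_div]
      exact div_le_div_of_nonneg_right (by linarith) (by positivity)
    linarith
  -- The policy level uses `N = 1`, the action level `N = M`. The exponent 5 is the budget of
  -- logarithms: 3 in `G`, one from summing `1 / t`, and one from the logarithm in action-level
  -- forward KL.
  have key : ∀ {G N : ℝ}, 1 ≤ N → 0 ≤ G → G ≤ c₂ * N * X ^ 3 * Y →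
      IsAdmissibleFactor k T α G E (c * N * X ^ 5 * Y) := by
    intro G N hN hG0 hG
    have hN0 : 0 ≤ N := zero_le_one.trans hN
    have f1 : (1 : ℝ) ≤ N * X ^ 3 * Y :=
      one_le_mul_of_one_le_of_one_le (one_le_mul_of_one_le_of_one_le hN (one_le_pow₀ hX1)) hY1
    have mono : ∀ {a : ℝ} {m : ℕ}, 0 ≤ a → a ≤ c → m ≤ 5 →
        a * N * X ^ m * Y ≤ c * N * X ^ 5 * Y := by
      intro a m ha hac hm
      have := hpow m hm
      gcongr
    refine ⟨?_, ?_, ?_, ?_⟩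
    · have : (k : ℝ) ≤ k * (N * X ^ 3 * Y) := le_mul_of_one_le_right (by positivity) f1
      refine le_trans ?_ (mono (m := 3) (add_nonneg h2 (Nat.cast_nonneg k)) hcb.1 (by norm_num))
      linarith
    · refine le_trans ?_ (mono (m := 4) (by positivity) hcb.2.1 (by norm_num))
      calc G / α * X ≤ c₂ * N * X ^ 3 * Y / α * X := by gcongr
        _ = _ := by ring
    · refine le_trans ?_ (mono (m := 3) h2 hcb.2.2.2 (by norm_num))
      calc 4 * E * X ≤ 4 * (c₁ * (X ^ 2 * Y)) * X := by gcongr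
        _ = 4 * c₁ * (X ^ 3 * Y) := by ring
        _ ≤ c₂ * (X ^ 3 * Y) := mul_le_mul_of_nonneg_right (by linarith) (by positivity)
        _ ≤ N * (c₂ * (X ^ 3 * Y)) := le_mul_of_one_le_left (by positivity) hN
        _ = _ := by ring
    · refine le_trans ?_ (mono (m := 5) (by positivity) hcb.2.2.1 le_rfl)
      calc (2 / α + 4 * l / α ^ 2) * G * X
          ≤ (2 / α + 4 / α ^ 2) * X * (c₂ * N * X ^ 3 * Y) * X := by gcongr
        _ = _ := by ring
  constructor
  · have := key (G := 8 * E) (N := 1) le_rfl (by positivity) ?_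
    · simpa only [mul_one] using this
    · calc 8 * E ≤ 8 * (c₁ * (X ^ 2 * Y)) := by gcongr
        _ = 8 * c₁ * (X ^ 2 * Y) := by ring
        _ ≤ c₂ * (X ^ 3 * Y) := by
          have : X ^ 2 ≤ X ^ 3 := pow_le_pow_right₀ hX1 (by norm_num)
          gcongr
        _ = _ := by ring
  · refine key hM ?_ ?_
    · rw [distConst]
      positivity
    · rw [distConst, hc₂, ← hl, ← hX]
      have f1 : (1 : ℝ) ≤ X ^ 3 * Y := one_le_mul_of_one_le_of_one_le (one_le_pow₀ hX1) hY1
      have f2 : (k : ℝ) ≤ k * (M * (X ^ 3 * Y)) :=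
        le_mul_of_one_le_right (by positivity) (one_le_mul_of_one_le_of_one_le hM f1)
      have f3 : (k : ℝ) * (M * k) ≤ k * (M * k) * (X ^ 3 * Y) :=
        le_mul_of_one_le_right (by positivity) f1
      have f4 : 4 * E * X ≤ 4 * c₁ * (M * (X ^ 3 * Y)) := by
        calc 4 * E * X ≤ 4 * (c₁ * (X ^ 2 * Y)) * X := by gcongr
          _ = 4 * c₁ * (X ^ 3 * Y) := by ring
          _ ≤ M * (4 * c₁ * (X ^ 3 * Y)) := le_mul_of_one_le_left (by positivity) hM
          _ = _ := by ring
      linarith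

/-- The radius `B` is kept free: the condition linking it to `⌊M⌋₊` says that exploration confines
the estimates to that radius, and the price is `exp (2 * B)`. Only the last two bounds carry a
factor `M`. -/
theorem exists_regret_bounds (hk : 2 ≤ k) {σ : ℝ≥0} (hσ : 0 < σ) (hα : 0 < α) :
    ∃ c : ℝ, 0 ≤ c ∧ ∀ ν : Environment k, IsSubgaussianEnv σ ν → (∀ i, α ≤ target ν i) →
      ∀ (T : ℕ) (M B : ℝ), 1 ≤ M → M * k ≤ T → 0 ≤ B →
        2 * (σ : ℝ) ^ 2 * (6 * Real.log T) ≤ B ^ 2 * ⌊M⌋₊ →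
        SimplePolicyBounds σ ν T M (c * (1 + Real.log T) ^ 5 * Real.exp (2 * B)) ∧
        SimpleActionBounds σ ν T M (c * M * (1 + Real.log T) ^ 5 * Real.exp (2 * B)) ∧
        CumulativeBounds σ ν T M (c * M * (1 + Real.log T) ^ 5 * Real.exp (2 * B)) := by
  obtain ⟨c, hc0, hc⟩ := exists_admissibleFactor (k := k) (σ : ℝ) hα
  refine ⟨c, hc0, fun ν hν hp T M B hM hMT hB0 hB => ?_⟩
  have hkT : k ≤ T := by
    have h1 : (k : ℝ) ≤ T := (le_mul_of_one_le_left (Nat.cast_nonneg k) hM).trans hMT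
    exact_mod_cast h1
  have hT : 2 ≤ T := hk.trans hkT
  obtain ⟨hg1, hg2⟩ := hc T M B hM hB0
  have hlog : 0 ≤ Real.log T := Real.log_natCast_nonneg T
  have hE := upperMean_sq_error hσ hα hν hp hT hM hB0 hB
  have hE0 : 0 ≤ errorConst k T σ α B := by
    rw [errorConst]
    positivity
  have hV := upperMean_sqDist hM hE0 hE
  have hG0 : 0 ≤ distConst k T M (errorConst k T σ α B) := by
    rw [distConst]
    positivity
  exact ⟨simplePolicyBounds_of_estimation σ (by omega) hM hα hp hE0 hE hg1,
    simpleActionBounds_of_estimation σ (by omega) hkT hM hα hp hG0 (hV .action) hg2,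
    cumulativeBounds_of_estimation σ hM hα hp hE0 hE hG0 hV hg2⟩

/-! ### Monotonicity in the factor and elementary estimates -/

theorem SimplePolicyBounds.mono {σ : ℝ≥0} {g g' : ℝ} (h : SimplePolicyBounds σ ν T M g)
    (hg : g ≤ g') : SimplePolicyBounds σ ν T M g' := by
  intro hMT a
  obtain ⟨h1, h2, h3⟩ := h hMT a
  refine ⟨h1.trans ?_, h2.trans ?_, fun hb => (h3 hb).trans ?_⟩ <;>
  exact ENNReal.ofReal_le_ofReal (mul_le_mul_of_nonneg_right hg (by positivity))

theorem SimpleActionBounds.mono {σ : ℝ≥0} {g g' : ℝ} (h : SimpleActionBounds σ ν T M g)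
    (hg : g ≤ g') : SimpleActionBounds σ ν T M g' := by
  intro a
  obtain ⟨h1, h2, h3⟩ := h a
  refine ⟨h1.trans ?_, h2.trans ?_, fun hb => (h3 hb).trans ?_⟩ <;>
  exact ENNReal.ofReal_le_ofReal (mul_le_mul_of_nonneg_right hg (by positivity))

theorem CumulativeBounds.mono {σ : ℝ≥0} {g g' : ℝ} (h : CumulativeBounds σ ν T M g)
    (hg : g ≤ g') : CumulativeBounds σ ν T M g' := by
  intro l a
  obtain ⟨h1, h2, h3⟩ := h l a
  exact ⟨h1.trans (ENNReal.ofReal_le_ofReal (mul_le_mul_of_nonneg_right hg (by positivity))),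
    h2.trans (ENNReal.ofReal_le_ofReal hg), fun hb => (h3 hb).trans (ENNReal.ofReal_le_ofReal hg)⟩

theorem one_add_log_le (hT : 2 ≤ T) : 1 + Real.log T ≤ 3 * Real.log T := by
  have h1 : Real.log 2 ≤ Real.log T := Real.log_le_log two_pos (by exact_mod_cast hT)
  linarith [Real.log_two_gt_d9]

/-- Rounding down loses at most half of `M ≥ 1`, so 36 leaves at least 18, while radius 1 requires
12. -/
theorem subgaussian_scale_le {s : ℝ} (hM : 1 ≤ M) (h : 36 * s ^ 2 * Real.log T ≤ M) :
    2 * s ^ 2 * (6 * Real.log T) ≤ 1 ^ 2 * ⌊M⌋₊ := by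
  have h1 : (1 : ℝ) ≤ ⌊M⌋₊ := by exact_mod_cast (Nat.one_le_floor_iff M).2 hM
  linarith [Nat.lt_floor_add_one M]

/-- From `1 + x ≤ (1 + √x) ^ 2 ≤ exp (2 * √x)`. It absorbs the powers of `log T` into the
exponential when there is no exploration. -/
theorem one_add_pow_five_le {x : ℝ} (hx : 0 ≤ x) : (1 + x) ^ 5 ≤ Real.exp (10 * √x) := by
  have h1 : 1 + x ≤ Real.exp (2 * √x) := by
    have h2 := Real.add_one_le_exp (√x)
    have h3 : Real.exp (2 * √x) = Real.exp (√x) ^ 2 := by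
      rw [← Real.exp_nat_mul]
      norm_num
    rw [h3]
    nlinarith [Real.sq_sqrt hx, Real.sqrt_nonneg x]
  calc (1 + x) ^ 5 ≤ Real.exp (2 * √x) ^ 5 := pow_le_pow_left₀ (by linarith) h1 5
    _ = Real.exp (10 * √x) := by
      rw [← Real.exp_nat_mul]
      congr 1
      push_cast
      ring

end RegretBounds

end MultiArmedSampling

/-! ### Choice of the radius and proof of the theorem -/

theorem mainTheorem1 (k : ℕ) [NeZero k] (hk : 2 ≤ k) (σ : ℝ≥0) (hσ : 0 < σ)
    (α : ℝ) (hα : 0 < α) :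
    -- Exploration `M ≥ 36 σ² log T`: simple policy-level regrets, for every such `M`.
    (∃ (C : ℝ) (n : ℕ), ∀ ν : Environment k, IsSubgaussianEnv σ ν → (∀ i, α ≤ target ν i) →
      ∀ (T : ℕ) (M : ℝ), 1 ≤ M → M * k ≤ T → 36 * (σ : ℝ) ^ 2 * Real.log T ≤ M →
        SimplePolicyBounds σ ν T M (C * Real.log T ^ n)) ∧
    -- Exploration `M ≥ 36 σ² log T` that is polylogarithmic in `T`: all other regrets.
    (∀ (A : ℝ) (m : ℕ), ∃ (C : ℝ) (n : ℕ),
      ∀ ν : Environment k, IsSubgaussianEnv σ ν → (∀ i, α ≤ target ν i) →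
      ∀ (T : ℕ) (M : ℝ), 1 ≤ M → M * k ≤ T → 36 * (σ : ℝ) ^ 2 * Real.log T ≤ M →
        M ≤ A * Real.log T ^ m →
        SimpleActionBounds σ ν T M (C * Real.log T ^ n) ∧
        CumulativeBounds σ ν T M (C * Real.log T ^ n)) ∧
    -- No exploration.
    (∃ C : ℝ, ∀ ν : Environment k, IsSubgaussianEnv σ ν → (∀ i, α ≤ target ν i) →
      ∀ T : ℕ, k ≤ T →
        SimplePolicyBounds σ ν T 1 (C * Real.exp (C * √(Real.log T))) ∧
        SimpleActionBounds σ ν T 1 (C * Real.exp (C * √(Real.log T))) ∧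
        CumulativeBounds σ ν T 1 (C * Real.exp (C * √(Real.log T)))) := by
  obtain ⟨c, hc0, hc⟩ := exists_regret_bounds hk hσ hα
  have two_le : ∀ {T : ℕ} {M : ℝ}, 1 ≤ M → M * k ≤ T → 2 ≤ T := by
    intro T M hM hMT
    have h1 : (k : ℝ) ≤ T := (le_mul_of_one_le_left (Nat.cast_nonneg k) hM).trans hMT
    exact hk.trans (by exact_mod_cast h1)
  have hpow : ∀ {T : ℕ}, 2 ≤ T → (1 + Real.log T) ^ 5 ≤ 3 ^ 5 * Real.log T ^ 5 := by
    intro T hT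
    rw [← mul_pow]
    exact pow_le_pow_left₀ (by linarith [Real.log_natCast_nonneg T]) (one_add_log_le hT) 5
  refine ⟨⟨c * 3 ^ 5 * Real.exp (2 * 1), 5, fun ν hν hp T M hM hMT hlog => ?_⟩,
    fun A m => ⟨c * A * 3 ^ 5 * Real.exp (2 * 1), m + 5, fun ν hν hp T M hM hMT hlog hMA => ?_⟩,
    ⟨c + (10 + 8 * σ), fun ν hν hp T hkT => ?_⟩⟩
  · refine (hc ν hν hp T M 1 hM hMT zero_le_one (subgaussian_scale_le hM hlog)).1.mono ?_
    calc c * (1 + Real.log T) ^ 5 * Real.exp (2 * 1)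
        ≤ c * (3 ^ 5 * Real.log T ^ 5) * Real.exp (2 * 1) := by
          have := hpow (two_le hM hMT)
          gcongr
      _ = _ := by ring
  · have h := (hc ν hν hp T M 1 hM hMT zero_le_one (subgaussian_scale_le hM hlog)).2
    have hle : c * M * (1 + Real.log T) ^ 5 * Real.exp (2 * 1) ≤
        c * A * 3 ^ 5 * Real.exp (2 * 1) * Real.log T ^ (m + 5) := by
      have h0 : 0 ≤ Real.log T := Real.log_natCast_nonneg T
      calc c * M * (1 + Real.log T) ^ 5 * Real.exp (2 * 1)
          ≤ c * (A * Real.log T ^ m) * (3 ^ 5 * Real.log T ^ 5) * Real.exp (2 * 1) := by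
            have h1 := hpow (two_le hM hMT)
            -- The sign of `A` is not given; nonnegativity of the product comes from `1 ≤ M ≤ A *
            -- log T ^ m`.
            have h2 : 0 ≤ A * Real.log T ^ m := (zero_le_one.trans hM).trans hMA
            gcongr
        _ = _ := by ring
    exact ⟨h.1.mono hle, h.2.mono hle⟩
  · have h0 : 0 ≤ Real.log T := Real.log_natCast_nonneg T
    have hσ0 : (0 : ℝ) ≤ σ := σ.2
    -- A single play per arm gives `⌊M⌋₊ = 1`, so `B ^ 2` alone must exceed `12 * σ ^ 2 * log T`;
    -- the choice made has 16 in place of 12.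
    have hB : 2 * (σ : ℝ) ^ 2 * (6 * Real.log T) ≤ (4 * σ * √(Real.log T)) ^ 2 * ⌊(1 : ℝ)⌋₊ := by
      rw [mul_pow, Real.sq_sqrt h0, Nat.floor_one]
      have : 0 ≤ (σ : ℝ) ^ 2 * Real.log T := by positivity
      push_cast
      linarith
    have h := hc ν hν hp T 1 (4 * σ * √(Real.log T)) le_rfl
      (by rw [one_mul]; exact_mod_cast hkT) (by positivity) hB
    -- In the exponent, 10 comes from the fifth power of `1 + log T` and `8 * σ` from `2 * B`.
    -- Adding `c` lets one constant serve as prefactor and exponent.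
    have hle : c * (1 + Real.log T) ^ 5 * Real.exp (2 * (4 * σ * √(Real.log T))) ≤
        (c + (10 + 8 * σ)) * Real.exp ((c + (10 + 8 * σ)) * √(Real.log T)) := by
      calc c * (1 + Real.log T) ^ 5 * Real.exp (2 * (4 * σ * √(Real.log T)))
          ≤ c * Real.exp (10 * √(Real.log T)) * Real.exp (2 * (4 * σ * √(Real.log T))) := by
            have := one_add_pow_five_le h0
            gcongr
        _ = c * Real.exp ((10 + 8 * σ) * √(Real.log T)) := by
            rw [mul_assoc, ← Real.exp_add]
            congr 2
            ring
        _ ≤ _ := by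
            have h1 : 10 + 8 * (σ : ℝ) ≤ c + (10 + 8 * σ) := by linarith
            refine mul_le_mul (by linarith) (Real.exp_le_exp.2 ?_) (Real.exp_pos _).le
              (by positivity)
            exact mul_le_mul_of_nonneg_right h1 (Real.sqrt_nonneg _)
    simp only [mul_one] at h
    exact ⟨h.1.mono hle, h.2.1.mono hle, h.2.2.mono hle⟩
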